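/- Let $n\geq 3$ be an integer and let $(X,Y)=(X(k),Y(k))_{k\geq 0}$ be the Markov chain on $\mathbb{Z}_+^2=\{0,1,2,\dots\}^2$ which is absorbed on the axes (every point with a zero coordinate is absorbing) and which, from an interior point $(i,j)$ with $i,j\geq 1$, jumps by $(1,0)$ or $(-1,0)$ with probability $\tfrac12\sin(\pi/n)^2$ each, and by $(1,-1)$ or $(-1,1)$ with probability $\tfrac12\cos(\pi/n)^2$ each. Let $(X,Y)$ start at $(i_0,j_0)$ with $i_0,j_0\geq 1$; it is said to be killed at a point of the axes if that is the first point of the axes which it visits. Put $z_0=-\exp(-\mathrm{i}\pi/n)$ (where $\mathrm i^2=-1$), \[ x(z)=\frac{(z+z_0)(z+\overline{z_0})}{(z-z_0)(z-\overline{z_0})},\qquad y(z)=\frac{(z+z_0)^2}{(z-z_0)^2}, \] let $\kappa_n(i_0,j_0)$ be the coefficient of $z^n$ in the Taylor expansion at $0$ of $x(z)^{i_0}y(z)^{j_0}$, and let $f_n$ be the real-valued function \[ f_n(i_0,j_0)=n\,\frac{\kappa_n(i_0,j_0)-\overline{\kappa_n(i_0,j_0)}}{(-1)^n\,\mathrm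 i}. \] Then, for fixed $n,i_0,j_0$, as $i\to\infty$ and as $j\to\infty$ respectively, \[ \mathbb{P}_{(i_0,j_0)}[(X,Y)\text{ is killed at }(i,0)]\sim\frac{1}{2\pi}\,\frac{n!}{[4\cos(\pi/n)]^{n}}\,f_n(i_0,j_0)\,\frac{1}{i^{n+1}}, \] \[ \mathbb{P}_{(i_0,j_0)}[(X,Y)\text{ is killed at }(0,j)]\sim\frac{1}{2\pi}\,\frac{n!}{4^{n}}\,f_n(i_0,j_0)\,\frac{1}{j^{n+1}}. \] -/

import Mathlib

open Filter Asymptotics MeasureTheory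

noncomputable section

namespace WeylWalk

/-- Jump probabilities in the interior: `p_{±1,0} = sin(π/n)²/2`, `p_{1,-1} = p_{-1,1} = cos(π/n)²/2`,
and zero for every other jump. -/
def jump (n : ℕ) (d : ℤ × ℤ) : ℝ :=
  if d = (1, 0) ∨ d = (-1, 0) then Real.sin (Real.pi / n) ^ 2 / 2
  else if d = (1, -1) ∨ d = (-1, 1) then Real.cos (Real.pi / n) ^ 2 / 2
  else 0

/-- One-step transition probabilities on the quarter plane: homogeneous in the interior,
absorbing on the two axes. -/
def trans (n : ℕ) (z w : ℕ × ℕ) : ℝ :=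
  if 0 < z.1 ∧ 0 < z.2 then jump n ((w.1 : ℤ) - z.1, (w.2 : ℤ) - z.2)
  else if w = z then 1 else 0

/-- `Z` is a Markov chain on the quarter plane, started at `z₀`, with transition
probabilities `trans n`. -/
structure IsKilledWalk {Ω : Type*} [MeasurableSpace Ω] (n : ℕ) (z₀ : ℕ × ℕ)
    (Z : ℕ → Ω → ℕ × ℕ) (P : Measure Ω) : Prop where
  measurable : ∀ k, Measurable (Z k)
  start : ∀ᵐ ω ∂P, Z 0 ω = z₀
  markov : ∀ (k : ℕ) (z : ℕ → ℕ × ℕ),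
    P.real {ω | ∀ l ≤ k + 1, Z l ω = z l} =
      P.real {ω | ∀ l ≤ k, Z l ω = z l} * trans n (z k) (z (k + 1))

/-- The event that the walk is killed at `b`: the first point of the axes that it visits is `b`
(to be used for a point `b` of the axes). -/
def killedAt {Ω : Type*} (Z : ℕ → Ω → ℕ × ℕ) (b : ℕ × ℕ) : Set Ω :=
  {ω | ∃ k, Z k ω = b ∧ ∀ l < k, 0 < (Z l ω).1 ∧ 0 < (Z l ω).2}

/-- `z₀ = -exp(-iπ/n)`. -/
def base (n : ℕ) : ℂ := -Complex.exp (-(Complex.I * Real.pi / n))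

/-- `x(z) = (z + z₀)(z + z̄₀) / ((z - z₀)(z - z̄₀))`. -/
def unifX (n : ℕ) (z : ℂ) : ℂ :=
  (z + base n) * (z + starRingEnd ℂ (base n)) / ((z - base n) * (z - starRingEnd ℂ (base n)))

/-- `y(z) = (z + z₀)² / (z - z₀)²`. -/
def unifY (n : ℕ) (z : ℂ) : ℂ := (z + base n) ^ 2 / (z - base n) ^ 2

/-- `κ_p(i, j)`: the coefficient of `z ^ p` in the Taylor expansion at `0` of `x(z)^i y(z)^j`. -/
def kappa (n p i j : ℕ) : ℂ :=
  iteratedDeriv p (fun z => unifX n z ^ i * unifY n z ^ j) 0 / (p.factorial : ℂ)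

/-- The harmonic function `f_n(i, j) = n (κ_n(i, j) - conj κ_n(i, j)) / ((-1)^n √-1)`.
The expression is a real number, see `coe_harm`. -/
def harm (n i j : ℕ) : ℝ :=
  ((n : ℂ) * (kappa n n i j - starRingEnd ℂ (kappa n n i j)) / ((-1) ^ n * Complex.I)).re

theorem coe_harm (n i j : ℕ) :
    (harm n i j : ℂ) =
      (n : ℂ) * (kappa n n i j - starRingEnd ℂ (kappa n n i j)) / ((-1) ^ n * Complex.I) := by
  have h : (n : ℂ) * (kappa n n i j - starRingEnd ℂ (kappa n n i j)) / ((-1) ^ n * Complex.I) =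
      ((n * (2 * (kappa n n i j).im) / (-1) ^ n : ℝ) : ℂ) := by
    rw [Complex.sub_conj]
    push_cast
    have := Complex.I_ne_zero
    field_simp
  rw [harm, h, Complex.ofReal_re]

end WeylWalk

end

/-!
The walk is a martingale in its second coordinate and is absorbed almost surely, so a bounded
harmonic function on the quarter plane is determined by its values on the axes
(`IsKilledWalk.real_killedAt`). The probability of being killed at a point `b` of the axes is
therefore the bounded solution of the Dirichlet problem with boundary values the indicator function
of `b`, and the task is to find this solution in closed form and to read off its asymptotics.

With `θ = π / n`, the zero set of the kernel of the walk is the rational curve `x = cay θ s`,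
`y = cay 0 (s + i θ)`, where `cay α s = (cosh s - cos α) / (cosh s + cos α)`; in the coordinate
`z = exp s` these are the functions `x(z)` and `y(z)` of the statement. Every `x ^ i y ^ j` on this
curve is harmonic at the interior points (`OnKernel.harmonic`), and the curve is preserved by the
dihedral group of order `2 n` generated by `s ↦ -s` and `s ↦ -s - 2 i θ`, which fix `x` and `y`
respectively. Half of the corresponding alternating sum of `x ^ i y ^ j` over the orbit,
`orbitSum`, integrated against `x ^ (-m - 2) dx` along a horizontal line, is the solution `exitInt`.
For `j = 0` the orbit sum telescopes to its end terms, and what remains is a residue which picks out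
`i = m + 1` (`exitInt_zero_right`); for `i = 0` the integral vanishes by symmetry
(`exitInt_zero_left`). The integral is bounded in the starting point because each term of the orbit
sum can be integrated along a line of its own on which `|x| ≤ 1` and `|y| ≤ 1`
(`exists_norm_exitInt_le`). The same function `exitInt` with the angles of `x` and `y` exchanged
serves for the other axis.

For the asymptotics, both ends of the line of integration are pushed to the line `Im s = π`, that
is to the negative real axis of the coordinate `z`, where `|x| > 1` except at the ends `z = 0` and
`z = ∞`. The integral becomes a Laplace integral of the function `foldSum` near `z = 0`, up to
exponentially small terms (`tendsto_exitInt`). Evaluated there, the orbit sum is the sum of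
`x ^ i y ^ j` over the points `-r ω` with `ω` an `n`-th root of unity (up to a rotation), minus its
conjugate. Summation over the roots of unity kills all Taylor coefficients of degrees
`1, …, n - 1`, and the constant one is real, so the leading term is `r ^ n` times `i f_n`
(`tendsto_foldSum`), which Watson's lemma (`tendsto_laplace`) turns into the decay `m ^ (-n - 1)`.

An asymptotic equivalence needs the constant not to be zero. As a limit of harmonic functions with
values in `[0, ∞)`, `f_n` is nonnegative and harmonic, so if it vanished at one interior point it
would vanish at all of them. Then all real combinations of the `x ^ i y ^ j` with `i, j ≥ 1` would
have a real coefficient of `z ^ n`, but that of `(x - 1) ^ (n - 1) (y - 1) x y` is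
`x'(0) ^ (n - 1) y'(0)`, which is not real (`harm_pos`).
-/

noncomputable section

namespace WeylWalk

/-! ### The transition operator and the law of the walk -/

section

/-- The transition operator of the absorbed walk, acting on functions on the quarter plane. -/
def step (n : ℕ) (g : ℕ × ℕ → ℝ) (z : ℕ × ℕ) : ℝ :=
  if 0 < z.1 ∧ 0 < z.2 then
    Real.sin (Real.pi / n) ^ 2 / 2 * (g (z.1 + 1, z.2) + g (z.1 - 1, z.2)) +
      Real.cos (Real.pi / n) ^ 2 / 2 * (g (z.1 + 1, z.2 - 1) + g (z.1 - 1, z.2 + 1))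
  else g z

/-- The indicator function of a point. -/
def pointMass (b z : ℕ × ℕ) : ℝ := if z = b then 1 else 0

lemma step_pointMass (n : ℕ) (w z : ℕ × ℕ) : step n (pointMass w) z = trans n z w := by
  obtain ⟨i, j⟩ := z
  obtain ⟨a, b⟩ := w
  simp only [step, trans, pointMass, jump, Prod.mk.injEq]
  by_cases h : 0 < i ∧ 0 < j
  · obtain ⟨i, rfl⟩ := Nat.exists_eq_succ_of_ne_zero h.1.ne'
    obtain ⟨j, rfl⟩ := Nat.exists_eq_succ_of_ne_zero h.2.ne'
    rw [if_pos h, if_pos h]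
    simp only [Nat.succ_eq_add_one, Nat.add_sub_cancel]
    push_cast
    split_ifs <;> first | (exfalso; omega) | simp
  · rw [if_neg h, if_neg h]
    congr 1
    simp only [eq_comm]

lemma step_sum {ι : Type*} (n : ℕ) (F : Finset ι) (c : ι → ℝ) (g : ι → ℕ × ℕ → ℝ) :
    step n (fun z => ∑ w ∈ F, c w * g w z) = fun z => ∑ w ∈ F, c w * step n (g w) z := by
  funext z
  unfold step
  split_ifs
  · simp only [mul_add, Finset.mul_sum, Finset.sum_add_distrib]
    simp only [mul_left_comm]
  · rfl

variable {Ω : Type*} [MeasurableSpace Ω] {P : Measure Ω} {n : ℕ} {z₀ : ℕ × ℕ} {Z : ℕ → Ω → ℕ × ℕ}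

/-- The Markov property in terms of the history `(Z 0, …, Z k)` of the walk. -/
lemma IsKilledWalk.real_history (hZ : IsKilledWalk n z₀ Z P) (k : ℕ)
    (h : Fin (k + 1) → ℕ × ℕ) (w : ℕ × ℕ) :
    P.real ((fun ω (l : Fin (k + 1)) => Z l ω) ⁻¹' {h} ∩ {ω | Z (k + 1) ω = w}) =
      P.real ((fun ω (l : Fin (k + 1)) => Z l ω) ⁻¹' {h}) * trans n (h (Fin.last k)) w := by
  let X : Ω → (Fin (k + 1) → ℕ × ℕ) := fun ω l => Z l ω
  have hm := hZ.markov k (fun l => if hl : l < k + 1 then h ⟨l, hl⟩ else w)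
  have e1 : {ω | ∀ l ≤ k + 1, Z l ω = (fun l => if hl : l < k + 1 then h ⟨l, hl⟩ else w) l} =
      X ⁻¹' {h} ∩ {ω | Z (k + 1) ω = w} := by
    ext ω
    simp only [Set.mem_ofPred_eq, Set.mem_inter_iff, Set.mem_preimage, Set.mem_singleton_iff, X]
    constructor
    · intro H
      refine ⟨funext fun l => ?_, ?_⟩
      · have := H l (by omega)
        rwa [dif_pos l.2] at this
      · simpa using H (k + 1) le_rfl
    · rintro ⟨H1, H2⟩ l hl
      by_cases hl' : l < k + 1
      · rw [dif_pos hl', ← H1]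
      · rw [dif_neg hl', ← H2]
        congr 1
        omega
  have e2 : {ω | ∀ l ≤ k, Z l ω = (fun l => if hl : l < k + 1 then h ⟨l, hl⟩ else w) l} =
      X ⁻¹' {h} := by
    ext ω
    simp only [Set.mem_ofPred_eq, Set.mem_preimage, Set.mem_singleton_iff, X]
    constructor
    · intro H
      refine funext fun l => ?_
      have := H l (by omega)
      rwa [dif_pos l.2] at this
    · rintro H1 l hl
      rw [dif_pos (by omega), ← H1]
  rw [e1, e2] at hm
  simpa [Fin.last] using hm

variable [IsProbabilityMeasure P]

/-- The Markov property at time `k`, summed over the history of the walk. -/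
lemma IsKilledWalk.real_succ_eq_integral (hZ : IsKilledWalk n z₀ Z P) (k : ℕ) (w : ℕ × ℕ) :
    P.real {ω | Z (k + 1) ω = w} = ∫ ω, trans n (Z k ω) w ∂P := by
  let X : Ω → (Fin (k + 1) → ℕ × ℕ) := fun ω l => Z l ω
  have hX : Measurable X := measurable_pi_lambda _ fun l => hZ.measurable l
  have hB : MeasurableSet {ω | Z (k + 1) ω = w} :=
    hZ.measurable (k + 1) (measurableSet_singleton w)
  have hbd : ∃ C, ∀ z w, |trans n z w| ≤ C := by
    refine ⟨1, fun z w => ?_⟩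
    have hs := Real.sin_sq_le_one (Real.pi / n)
    have hc := Real.cos_sq_le_one (Real.pi / n)
    have hs0 := sq_nonneg (Real.sin (Real.pi / n))
    have hc0 := sq_nonneg (Real.cos (Real.pi / n))
    unfold trans jump
    rw [abs_le]
    split_ifs <;> constructor <;> linarith
  obtain ⟨C, hC⟩ := hbd
  have h1 : ∫ ω, trans n (Z k ω) w ∂P =
      ∑' h : Fin (k + 1) → ℕ × ℕ, (P.map X).real {h} • trans n (h (Fin.last k)) w := by
    rw [← integral_countable (μ := P.map X) (f := fun h => trans n (h (Fin.last k)) w),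
      integral_map hX.aemeasurable]
    · simp [X]
    · exact (measurable_of_countable _).aestronglyMeasurable
    · have : IsProbabilityMeasure (P.map X) := Measure.isProbabilityMeasure_map hX.aemeasurable
      exact Integrable.of_bound (measurable_of_countable _).aestronglyMeasurable C
        (Eventually.of_forall fun h => hC _ _)
  have h2 : P.real {ω | Z (k + 1) ω = w} =
      ∑' h : Fin (k + 1) → ℕ × ℕ, ((P.restrict {ω | Z (k + 1) ω = w}).map X).real {h} • (1 : ℝ) := by
    rw [← integral_countable (f := fun _ => (1 : ℝ)), integral_map hX.aemeasurable]
    · simp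
    · exact aestronglyMeasurable_const
    · exact integrable_const _
  rw [h1, h2]
  congr 1
  funext h
  rw [map_measureReal_apply hX (measurableSet_singleton h),
    map_measureReal_apply hX (measurableSet_singleton h),
    measureReal_restrict_apply (hX (measurableSet_singleton h)), hZ.real_history k h w]
  simp [X]

/-- The law of the walk at time `k` is given by the powers of the transition operator. For functions
`g` of finite support no integrability has to be checked. -/
lemma IsKilledWalk.integral_comp (hZ : IsKilledWalk n z₀ Z P) (k : ℕ) :
    ∀ (g : ℕ × ℕ → ℝ) (N : ℕ), (∀ z : ℕ × ℕ, N ≤ z.1 ∨ N ≤ z.2 → g z = 0) →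
      ∫ ω, g (Z k ω) ∂P = ((step n)^[k] g) z₀ := by
  have hint : ∀ (k : ℕ) (w : ℕ × ℕ), Integrable (fun ω => pointMass w (Z k ω)) P := fun k w =>
    Integrable.of_bound ((measurable_of_countable (pointMass w)).comp (hZ.measurable k)).aestronglyMeasurable 1
      (Eventually.of_forall fun ω => by unfold pointMass; split_ifs <;> simp)
  have hint' : ∀ (k : ℕ) (w : ℕ × ℕ), Integrable (fun ω => step n (pointMass w) (Z k ω)) P := by
    intro k w
    refine Integrable.of_bound
      ((measurable_of_countable (step n (pointMass w))).comp (hZ.measurable k)).aestronglyMeasurable 4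
      (Eventually.of_forall fun ω => ?_)
    rw [step_pointMass]
    have hs := Real.sin_sq_le_one (Real.pi / n)
    have hc := Real.cos_sq_le_one (Real.pi / n)
    have hs0 := sq_nonneg (Real.sin (Real.pi / n))
    have hc0 := sq_nonneg (Real.cos (Real.pi / n))
    unfold trans jump
    rw [Real.norm_eq_abs, abs_le]
    split_ifs <;> constructor <;> linarith
  have hrep : ∀ (g : ℕ × ℕ → ℝ) (N : ℕ), (∀ z : ℕ × ℕ, N ≤ z.1 ∨ N ≤ z.2 → g z = 0) →
      g = fun z => ∑ w ∈ Finset.range N ×ˢ Finset.range N, g w * pointMass w z := by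
    intro g N hg
    funext z
    simp only [pointMass, mul_ite, mul_one, mul_zero, Finset.sum_ite_eq, Finset.mem_product,
      Finset.mem_range]
    split_ifs with h
    · rfl
    · exact hg z (by omega)
  induction k with
  | zero =>
    intro g N hg
    have : ∫ ω, g (Z 0 ω) ∂P = ∫ _ω, g z₀ ∂P :=
      integral_congr_ae (hZ.start.mono fun ω h => by simp only [h])
    simpa using this
  | succ k ih =>
    intro g N hg
    rw [Function.iterate_succ_apply, ← ih (step n g) (N + 1)]
    · have h1 := hrep g N hg
      rw [h1, step_sum]
      simp only
      rw [integral_finsetSum _ fun w _ => (hint (k + 1) w).const_mul _,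
        integral_finsetSum _ fun w _ => (hint' k w).const_mul _]
      refine Finset.sum_congr rfl fun w _ => ?_
      rw [integral_const_mul, integral_const_mul]
      congr 1
      simp only [step_pointMass]
      rw [← hZ.real_succ_eq_integral k w]
      have : (fun ω => pointMass w (Z (k + 1) ω)) = {ω | Z (k + 1) ω = w}.indicator 1 := by
        funext ω
        simp [pointMass, Set.indicator_apply]
      rw [this, integral_indicator_one]
      exact hZ.measurable (k + 1) (measurableSet_singleton w)
    · rintro ⟨i, j⟩ hz
      simp only at hz
      unfold step
      split_ifs with h
      · rw [hg _ (by simp only; omega), hg _ (by simp only; omega), hg _ (by simp only; omega),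
          hg _ (by simp only; omega)]
        simp
      · exact hg _ (by simp only; omega)

lemma IsKilledWalk.real_eq (hZ : IsKilledWalk n z₀ Z P) (k : ℕ) (b : ℕ × ℕ) :
    P.real {ω | Z k ω = b} = ((step n)^[k] (pointMass b)) z₀ := by
  rw [← hZ.integral_comp k (pointMass b) (b.1 + b.2 + 1)]
  · have : (fun ω => pointMass b (Z k ω)) = {ω | Z k ω = b}.indicator 1 := by
      funext ω
      simp [pointMass, Set.indicator_apply]
    rw [this, integral_indicator_one]
    exact hZ.measurable k (measurableSet_singleton b)
  · intro z hz
    rw [pointMass, if_neg]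
    rintro rfl
    omega

end

/-! ### Bounded harmonic functions and the place of death -/

section

lemma step_mono (n : ℕ) {g h : ℕ × ℕ → ℝ} (hgh : ∀ z, g z ≤ h z) (z : ℕ × ℕ) :
    step n g z ≤ step n h z := by
  unfold step
  split_ifs
  · gcongr <;> apply hgh
  · exact hgh z

lemma iterate_step_mono (n k : ℕ) {g h : ℕ × ℕ → ℝ} (hgh : ∀ z, g z ≤ h z) (z : ℕ × ℕ) :
    (step n)^[k] g z ≤ (step n)^[k] h z := by
  induction k generalizing z with
  | zero => exact hgh z
  | succ k ih =>
    rw [Function.iterate_succ_apply', Function.iterate_succ_apply']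
    exact step_mono n ih z

lemma step_linear (n : ℕ) (a b : ℝ) (g h : ℕ × ℕ → ℝ) :
    step n (fun z => a * g z + b * h z) = fun z => a * step n g z + b * step n h z := by
  funext z
  unfold step
  split_ifs
  · ring
  · rfl

lemma iterate_step_linear (n k : ℕ) (a b : ℝ) (g h : ℕ × ℕ → ℝ) :
    (step n)^[k] (fun z => a * g z + b * h z) =
      fun z => a * (step n)^[k] g z + b * (step n)^[k] h z := by
  induction k with
  | zero => rfl
  | succ k ih =>
    rw [Function.iterate_succ_apply', ih, step_linear, Function.iterate_succ_apply',
      Function.iterate_succ_apply']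

lemma iterate_step_nonneg (n k : ℕ) {g : ℕ × ℕ → ℝ} (hg : ∀ z, 0 ≤ g z) (z : ℕ × ℕ) :
    0 ≤ (step n)^[k] g z := by
  have h0 : (step n)^[k] (fun _ => 0) = fun _ => 0 :=
    Function.iterate_fixed (by funext z; simp [step]) k
  have := iterate_step_mono n k hg z
  rwa [h0] at this

/-- The second coordinate is a harmonic function: the walk has no drift. -/
lemma step_snd (n : ℕ) : step n (fun z => (z.2 : ℝ)) = fun z => (z.2 : ℝ) := by
  funext z
  unfold step
  split_ifs with h
  · have : ((z.2 - 1 : ℕ) : ℝ) = z.2 - 1 := by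
      rw [Nat.cast_sub h.2]; simp
    have h2 := Real.sin_sq_add_cos_sq (Real.pi / n)
    simp only [this]
    push_cast
    linear_combination (z.2 : ℝ) * h2
  · rfl

/-- The indicator function of the interior of the quarter plane. -/
def inside (z : ℕ × ℕ) : ℝ := if 0 < z.1 ∧ 0 < z.2 then 1 else 0

lemma cos_pi_div_pos {n : ℕ} (hn : 3 ≤ n) : 0 < Real.cos (Real.pi / n) := by
  have hn' : (3 : ℝ) ≤ n := by exact_mod_cast hn
  have hpi := Real.pi_pos
  apply Real.cos_pos_of_mem_Ioo
  constructor
  · have : 0 < Real.pi / n := by positivity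
    linarith
  · exact div_lt_div_of_pos_left hpi (by norm_num) (by linarith)

lemma sin_pi_div_pos {n : ℕ} (hn : 3 ≤ n) : 0 < Real.sin (Real.pi / n) := by
  have hn' : (3 : ℝ) ≤ n := by exact_mod_cast hn
  have hpi := Real.pi_pos
  apply Real.sin_pos_of_pos_of_lt_pi (by positivity)
  exact div_lt_self hpi (by linarith)

/-- The concave function `1 - 2 ^ (-j)` of the second coordinate decreases in mean by a multiple
of `2 ^ (-j)` as long as the walk has not been absorbed; being bounded, it cannot do so for ever. -/
lemma tendsto_iterate_step_half_pow {n : ℕ} (hn : 3 ≤ n) (z : ℕ × ℕ) :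
    Tendsto (fun k => (step n)^[k] (fun w => inside w * (1 / 2) ^ w.2) z) atTop (nhds 0) := by
  set c : ℝ := Real.cos (Real.pi / n) ^ 2 / 4 with hc
  have hcpos : 0 < c := by have := cos_pi_div_pos hn; positivity
  set ψ : ℕ × ℕ → ℝ := fun w => (1 / 2) ^ w.2 with hψ
  set φ : ℕ × ℕ → ℝ := fun w => inside w * (1 / 2) ^ w.2 with hφ
  have hstep : step n ψ = fun w => 1 * ψ w + c * φ w := by
    funext w
    unfold step
    simp only [hψ, hφ, inside]
    split_ifs with h
    · obtain ⟨j, hj⟩ := Nat.exists_eq_succ_of_ne_zero h.2.ne'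
      have h2 := Real.sin_sq_add_cos_sq (Real.pi / n)
      rw [hj, hc]
      simp only [Nat.succ_eq_add_one, Nat.add_sub_cancel, pow_succ]
      linear_combination (1 / 2 : ℝ) ^ j * (1 / 2) * h2
    · simp
  have hφ0 : ∀ w, 0 ≤ φ w := fun w => by
    simp only [hφ, inside]; split_ifs <;> simp
  have hψ1 : ∀ w, ψ w ≤ 1 := fun w => pow_le_one₀ (by norm_num) (by norm_num)
  have hone : ∀ k, (step n)^[k] (fun _ => 1) = fun _ => 1 := fun k =>
    Function.iterate_fixed (by
      funext w
      have h2 := Real.sin_sq_add_cos_sq (Real.pi / n)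
      unfold step
      split_ifs
      · linear_combination h2
      · rfl) k
  have hpart : ∀ K, ∑ k ∈ Finset.range K, c * (step n)^[k] φ z = (step n)^[K] ψ z - ψ z := by
    intro K
    induction K with
    | zero => simp
    | succ K ih =>
      rw [Finset.sum_range_succ, ih, Function.iterate_succ_apply, hstep, iterate_step_linear]
      ring
  have hsum : Summable fun k => c * (step n)^[k] φ z := by
    refine summable_of_sum_range_le (c := 1)
      (fun k => mul_nonneg hcpos.le (iterate_step_nonneg n k hφ0 z)) fun K => ?_
    rw [hpart]
    have h1 := iterate_step_mono n K hψ1 z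
    rw [hone] at h1
    have h2 : 0 ≤ ψ z := by positivity
    linarith
  have := hsum.tendsto_atTop_zero.const_mul c⁻¹
  simpa [← mul_assoc, inv_mul_cancel₀ hcpos.ne'] using this

/-- The walk is absorbed almost surely. -/
lemma tendsto_iterate_step_inside {n : ℕ} (hn : 3 ≤ n) (z : ℕ × ℕ) :
    Tendsto (fun k => (step n)^[k] inside z) atTop (nhds 0) := by
  rw [Metric.tendsto_atTop]
  intro ε hε
  obtain ⟨M, hM⟩ := exists_nat_gt (2 * (z.2 : ℝ) / ε)
  have hM0 : (0 : ℝ) < M := lt_of_le_of_lt (by positivity) hM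
  -- Far from the first axis the martingale `w.2` bounds `inside`, by Markov's inequality.
  have hle : ∀ w, inside w ≤ 2 ^ M * (inside w * (1 / 2) ^ w.2) + (M : ℝ)⁻¹ * (w.2 : ℝ) := by
    intro w
    have h0 : 0 ≤ inside w := by unfold inside; split_ifs <;> simp
    have h1 : inside w ≤ 1 := by unfold inside; split_ifs <;> simp
    rcases le_total w.2 M with h | h
    · have : (1 : ℝ) ≤ 2 ^ M * (1 / 2) ^ w.2 := by
        rw [one_div, inv_pow, ← div_eq_mul_inv, one_le_div (by positivity)]
        exact pow_le_pow_right₀ (by norm_num) h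
      have h3 : 0 ≤ (M : ℝ)⁻¹ * (w.2 : ℝ) := by positivity
      nlinarith
    · have : (1 : ℝ) ≤ (M : ℝ)⁻¹ * (w.2 : ℝ) := by
        rw [inv_mul_eq_div, one_le_div hM0]
        exact_mod_cast h
      have h3 : 0 ≤ 2 ^ M * (inside w * (1 / 2) ^ w.2) := by positivity
      linarith
  have hev := (tendsto_iterate_step_half_pow hn z).const_mul ((2 : ℝ) ^ M)
  rw [mul_zero] at hev
  obtain ⟨K, hK⟩ := (Metric.tendsto_atTop.1 hev) (ε / 2) (by positivity)
  refine ⟨K, fun k hk => ?_⟩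
  have h1 := iterate_step_mono n k hle z
  rw [iterate_step_linear] at h1
  have h2 : (step n)^[k] (fun w => (w.2 : ℝ)) = fun w => (w.2 : ℝ) :=
    Function.iterate_fixed (step_snd n) k
  rw [h2] at h1
  have h3 := hK k hk
  rw [Real.dist_eq, sub_zero] at h3 ⊢
  rw [abs_of_nonneg (iterate_step_nonneg n k (fun w => by unfold inside; split_ifs <;> simp) z)]
  have h4 : (M : ℝ)⁻¹ * (z.2 : ℝ) < ε / 2 := by
    rw [inv_mul_eq_div, div_lt_iff₀ hM0]
    rw [div_lt_iff₀ hε] at hM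
    linarith
  have := (abs_lt.1 h3).2
  simp only at h1
  linarith

/-- A bounded harmonic function whose boundary values are the indicator of `b` is the probability
of absorption at `b`. -/
lemma tendsto_iterate_step_pointMass {n : ℕ} (hn : 3 ≤ n) {b : ℕ × ℕ} {u : ℕ × ℕ → ℝ} {C : ℝ}
    (hb : b.1 = 0 ∨ b.2 = 0) (hC : ∀ z, |u z| ≤ C) (hu : step n u = u)
    (hbd : ∀ z : ℕ × ℕ, z.1 = 0 ∨ z.2 = 0 → u z = pointMass b z) (z : ℕ × ℕ) :
    Tendsto (fun k => (step n)^[k] (pointMass b) z) atTop (nhds (u z)) := by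
  have hC0 : 0 ≤ C := (abs_nonneg _).trans (hC z)
  -- The two functions agree on the axes, and the walk is eventually there.
  have hpt : ∀ w, |u w - pointMass b w| ≤ C * inside w := by
    intro w
    unfold inside
    split_ifs with h
    · have : pointMass b w = 0 := by
        rw [pointMass, if_neg]; rintro rfl; omega
      simpa [this] using hC w
    · rw [hbd w (by omega)]; simp
  have hlim := (tendsto_iterate_step_inside hn z).const_mul C
  rw [mul_zero] at hlim
  rw [tendsto_iff_norm_sub_tendsto_zero]
  refine squeeze_zero (fun _ => norm_nonneg _) (fun k => ?_) hlim
  have hfix : (step n)^[k] u = u := Function.iterate_fixed hu k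
  have hin : (step n)^[k] (fun w => C * inside w) z = C * (step n)^[k] inside z := by
    have := congrFun (iterate_step_linear n k C 0 inside inside) z
    simpa using this
  have hdiff := congrFun (iterate_step_linear n k 1 (-1) u (pointMass b)) z
  have h1 := iterate_step_mono n k (g := fun w => 1 * u w + -1 * pointMass b w)
    (h := fun w => C * inside w) (fun w => by have := (abs_le.1 (hpt w)).2; linarith) z
  have h2 := iterate_step_mono n k (g := fun w => 1 * pointMass b w + -1 * u w)
    (h := fun w => C * inside w) (fun w => by have := (abs_le.1 (hpt w)).1; linarith) z
  rw [iterate_step_linear, hfix, hin] at h1 h2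
  rw [Real.norm_eq_abs, abs_le]
  constructor <;> linarith

variable {Ω : Type*} [MeasurableSpace Ω] {P : Measure Ω} [IsProbabilityMeasure P]
  {n : ℕ} {z₀ : ℕ × ℕ} {Z : ℕ → Ω → ℕ × ℕ}

/-- The points of the axes are absorbing. -/
lemma IsKilledWalk.ae_absorbed (hZ : IsKilledWalk n z₀ Z P) :
    ∀ᵐ ω ∂P, ∀ k, (Z k ω).1 = 0 ∨ (Z k ω).2 = 0 → Z (k + 1) ω = Z k ω := by
  rw [ae_all_iff]
  intro k
  have hnull : P (⋃ p : {p : (Fin (k + 1) → ℕ × ℕ) × (ℕ × ℕ) // trans n (p.1 (Fin.last k)) p.2 = 0},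
      (fun ω (l : Fin (k + 1)) => Z l ω) ⁻¹' {p.1.1} ∩ {ω | Z (k + 1) ω = p.1.2}) = 0 := by
    refine measure_iUnion_null fun p => ?_
    have := hZ.real_history k p.1.1 p.1.2
    rwa [p.2, mul_zero, measureReal_eq_zero_iff] at this
  refine measure_mono_null (fun ω hω => ?_) hnull
  simp only [Set.mem_compl_iff, Set.mem_ofPred_eq, Classical.not_imp] at hω
  refine Set.mem_iUnion.2 ⟨⟨(fun l => Z l ω, Z (k + 1) ω), ?_⟩, ?_⟩
  · have h1 : ¬ (0 < (Z k ω).1 ∧ 0 < (Z k ω).2) := by omega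
    simp only [trans, Fin.val_last]
    rw [if_neg h1, if_neg hω.2]
  · exact ⟨rfl, rfl⟩

/-- The absorption probabilities are the unique bounded solution of the discrete Dirichlet
problem. -/
theorem IsKilledWalk.real_killedAt (hn : 3 ≤ n) (hZ : IsKilledWalk n z₀ Z P) {b : ℕ × ℕ}
    {u : ℕ × ℕ → ℝ} {C : ℝ} (hb : b.1 = 0 ∨ b.2 = 0) (hC : ∀ z, |u z| ≤ C) (hu : step n u = u)
    (hbd : ∀ z : ℕ × ℕ, z.1 = 0 ∨ z.2 = 0 → u z = pointMass b z) :
    P.real (killedAt Z b) = u z₀ := by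
  set S : ℕ → Set Ω := fun k => {ω | ∃ l ≤ k, Z l ω = b} with hS
  have hmono : Monotone S := fun k m hkm ω ⟨l, hl, h⟩ => ⟨l, hl.trans hkm, h⟩
  have hstay : ∀ᵐ ω ∂P, ∀ l, Z l ω = b → ∀ m, Z (l + m) ω = b := by
    filter_upwards [hZ.ae_absorbed] with ω hω l hl m
    induction m with
    | zero => exact hl
    | succ m ih => rw [← add_assoc, hω (l + m) (by rw [ih]; exact hb), ih]
  have hSk : ∀ k, P.real (S k) = ((step n)^[k] (pointMass b)) z₀ := by
    intro k
    rw [← hZ.real_eq k b]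
    refine measureReal_congr ?_
    filter_upwards [hstay] with ω hω
    refine propext ⟨?_, fun h => ⟨k, le_rfl, h⟩⟩
    rintro ⟨l, hl, h⟩
    have := hω l h (k - l)
    rwa [Nat.add_sub_cancel' hl] at this
  have hkill : P.real (killedAt Z b) = P.real (⋃ k, S k) := by
    refine measureReal_congr ?_
    filter_upwards [hZ.ae_absorbed, hstay] with ω hω hst
    refine propext ⟨?_, ?_⟩
    · rintro ⟨k, h, -⟩
      exact Set.mem_iUnion.2 ⟨k, k, le_rfl, h⟩
    · intro h
      obtain ⟨-, k, -, h⟩ := Set.mem_iUnion.1 h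
      have hex : ∃ k, Z k ω = b := ⟨k, h⟩
      classical
      refine ⟨Nat.find hex, Nat.find_spec hex, fun l hl => ?_⟩
      by_contra hcon
      have hax : (Z l ω).1 = 0 ∨ (Z l ω).2 = 0 := by omega
      have hsame : ∀ m, Z (l + m) ω = Z l ω := by
        intro m
        induction m with
        | zero => rfl
        | succ m ih => rw [← add_assoc, hω (l + m) (by rw [ih]; exact hax), ih]
      have h1 := hsame (Nat.find hex - l)
      rw [Nat.add_sub_cancel' hl.le, Nat.find_spec hex] at h1
      exact Nat.find_min hex hl h1.symm
  have h1 : Tendsto (fun k => P.real (S k)) atTop (nhds (P.real (⋃ k, S k))) :=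
    (ENNReal.tendsto_toReal (measure_ne_top _ _)).comp (tendsto_measure_iUnion_atTop hmono)
  rw [hkill]
  simp only [hSk] at h1
  exact tendsto_nhds_unique h1 (tendsto_iterate_step_pointMass hn hb hC hu hbd z₀)

end

/-! ### The uniformizing functions and their growth -/

/-- The conformal map `(cosh s - cos α) / (cosh s + cos α)` of the strip `|Im s| < π / 2`, modulo
`s ↦ -s`, onto the unit disc, for `cos α > 0`. -/
def cay (α : ℝ) (s : ℂ) : ℂ :=
  (Complex.cosh s - (Real.cos α : ℝ)) / (Complex.cosh s + (Real.cos α : ℝ))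

/-- The differential form `x ^ (-m - 2) dx` for `x = cay α s`, in terms of `ds`. It extracts the
coefficient of `x ^ (m + 1)`. -/
def cayForm (α : ℝ) (m : ℕ) (s : ℂ) : ℂ :=
  2 * (Real.cos α : ℝ) * Complex.sinh s * (Complex.cosh s + (Real.cos α : ℝ)) ^ m /
    (Complex.cosh s - (Real.cos α : ℝ)) ^ (m + 2)

/-- On `S`, the function `w` is bounded below by a multiple of `cosh (re s)`. -/
def CoshBelow (S : Set ℂ) (w : ℂ → ℂ) : Prop :=
  ∃ δ > 0, ∀ s ∈ S, δ * Real.cosh s.re ≤ ‖w s‖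

/-- Bounded holomorphic functions on `S`. -/
def BddHol (S : Set ℂ) (G : ℂ → ℂ) : Prop :=
  DifferentiableOn ℂ G S ∧ ∃ C, ∀ s ∈ S, ‖G s‖ ≤ C

/-- Holomorphic functions on `S` which decay exponentially in horizontal directions. -/
def DecHol (S : Set ℂ) (G : ℂ → ℂ) : Prop :=
  DifferentiableOn ℂ G S ∧ ∃ C, ∀ s ∈ S, ‖G s‖ ≤ C / Real.cosh s.re

/-- The modulus of `cosh s - cos γ` reflects its factorization
`2 sinh ((s + i γ) / 2) sinh ((s - i γ) / 2)`. -/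
lemma normSq_cosh_sub_cos (s : ℂ) (γ : ℝ) :
    ‖Complex.cosh s - (Real.cos γ : ℝ)‖ ^ 2 =
      (Real.cosh s.re - Real.cos (s.im + γ)) * (Real.cosh s.re - Real.cos (s.im - γ)) := by
  have h1 : (Complex.cosh s - (Real.cos γ : ℝ)).re = Real.cosh s.re * Real.cos s.im - Real.cos γ := by
    rw [Complex.sub_re, Complex.ofReal_re]
    conv_lhs => rw [← Complex.re_add_im s, Complex.cosh_add, Complex.cosh_mul_I, Complex.sinh_mul_I]
    rw [← Complex.ofReal_cosh, ← Complex.ofReal_sinh, ← Complex.ofReal_cos, ← Complex.ofReal_sin]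
    simp [-Complex.ofReal_cosh, -Complex.ofReal_sinh, -Complex.ofReal_cos, -Complex.ofReal_sin]
  have h2 : (Complex.cosh s - (Real.cos γ : ℝ)).im = Real.sinh s.re * Real.sin s.im := by
    rw [Complex.sub_im, Complex.ofReal_im]
    conv_lhs => rw [← Complex.re_add_im s, Complex.cosh_add, Complex.cosh_mul_I, Complex.sinh_mul_I]
    rw [← Complex.ofReal_cosh, ← Complex.ofReal_sinh, ← Complex.ofReal_cos, ← Complex.ofReal_sin]
    simp [-Complex.ofReal_cosh, -Complex.ofReal_sinh, -Complex.ofReal_cos, -Complex.ofReal_sin]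
  rw [← Complex.normSq_eq_norm_sq, Complex.normSq_apply, h1, h2, Real.cos_add, Real.cos_sub]
  have e1 := Real.cosh_sq s.re
  have e2 := Real.sin_sq_add_cos_sq s.im
  have e3 := Real.sin_sq_add_cos_sq γ
  set C := Real.cosh s.re
  set D := Real.sinh s.re
  set x := Real.cos s.im
  set y := Real.sin s.im
  set p := Real.cos γ
  set q := Real.sin γ
  linear_combination (-y ^ 2) * e1 + (C ^ 2 - p ^ 2) * e2 + y ^ 2 * e3

lemma coshBelow_of_le {S : Set ℂ} {γ δ : ℝ} (hδ : 0 < δ)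
    (h : ∀ s ∈ S, δ * Real.cosh s.re ≤ Real.cosh s.re - Real.cos (s.im + γ) ∧
      δ * Real.cosh s.re ≤ Real.cosh s.re - Real.cos (s.im - γ)) :
    CoshBelow S (fun s => Complex.cosh s - (Real.cos γ : ℝ)) := by
  refine ⟨δ, hδ, fun s hs => ?_⟩
  obtain ⟨h1, h2⟩ := h s hs
  have hC := Real.one_le_cosh s.re
  have h0 : 0 ≤ δ * Real.cosh s.re := by positivity
  refine le_of_sq_le_sq ?_ (norm_nonneg _)
  rw [normSq_cosh_sub_cos, sq]
  exact mul_le_mul h1 h2 h0 (h0.trans h1)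

lemma mul_le_sub_of_le {C δ u : ℝ} (hC : 1 ≤ C) (hδ : δ ≤ 1) (hu : u ≤ 1 - δ) :
    δ * C ≤ C - u := by nlinarith

/-- The zeros of `cosh s - cos γ` have imaginary part `± γ` modulo `2 π`. -/
lemma coshBelow_strip {γ lo hi : ℝ} (h0 : 0 ≤ γ) (hlo : γ < lo) (hhi : hi < 2 * Real.pi - γ) :
    CoshBelow {s | s.im ∈ Set.Icc lo hi} (fun s => Complex.cosh s - (Real.cos γ : ℝ)) := by
  rcases lt_or_ge hi lo with hlt | hle
  · exact ⟨1, one_pos, fun s hs => absurd (hs.1.trans hs.2) (not_le.2 hlt)⟩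
  have hcont : ContinuousOn (fun φ => min (1 - Real.cos (φ + γ)) (1 - Real.cos (φ - γ)))
      (Set.Icc lo hi) := by fun_prop
  obtain ⟨φ₀, hφ₀, hmin⟩ := isCompact_Icc.exists_isMinOn (Set.nonempty_Icc.2 hle) hcont
  have hlt1 : ∀ u, 0 < u → u < 2 * Real.pi → Real.cos u < 1 := by
    intro u hu hu'
    refine lt_of_le_of_ne (Real.cos_le_one u) fun h => ?_
    exact hu.ne' ((Real.cos_eq_one_iff_of_lt_of_lt (by linarith) hu').1 h)
  set δ := min (1 - Real.cos (φ₀ + γ)) (1 - Real.cos (φ₀ - γ)) with hδ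
  have hδpos : 0 < δ := by
    rw [hδ, lt_min_iff]
    have := hφ₀.1
    have := hφ₀.2
    exact ⟨sub_pos.2 (hlt1 _ (by linarith) (by linarith)),
      sub_pos.2 (hlt1 _ (by linarith) (by linarith))⟩
  refine coshBelow_of_le (δ := min δ 1) (lt_min hδpos one_pos) fun s hs => ?_
  have h1 : δ ≤ _ := hmin hs
  have hC := Real.one_le_cosh s.re
  rw [le_min_iff] at h1
  have h2 := min_le_left δ 1
  exact ⟨mul_le_sub_of_le hC (min_le_right _ _) (by linarith [h1.1]),
    mul_le_sub_of_le hC (min_le_right _ _) (by linarith [h1.2])⟩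

lemma coshBelow_tail {γ R : ℝ} (hR : 0 < R) :
    CoshBelow {s | R ≤ |s.re|} (fun s => Complex.cosh s - (Real.cos γ : ℝ)) := by
  have h1 : 1 < Real.cosh R := Real.one_lt_cosh.2 hR.ne'
  refine coshBelow_of_le (δ := 1 - (Real.cosh R)⁻¹) (sub_pos.2 (inv_lt_one_of_one_lt₀ h1)) ?_
  intro s hs
  have h2 : Real.cosh R ≤ Real.cosh s.re := by
    rw [Real.cosh_le_cosh, abs_of_pos hR]
    exact hs
  have h3 : 1 ≤ (Real.cosh R)⁻¹ * Real.cosh s.re := by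
    rw [inv_mul_eq_div, one_le_div (by linarith)]
    exact h2
  constructor
  · have := Real.cos_le_one (s.im + γ)
    linarith
  · have := Real.cos_le_one (s.im - γ)
    linarith

lemma CoshBelow.mono {S T : Set ℂ} {w : ℂ → ℂ} (h : CoshBelow T w) (hST : S ⊆ T) :
    CoshBelow S w := by
  obtain ⟨δ, h0, hδ⟩ := h
  exact ⟨δ, h0, fun s hs => hδ s (hST hs)⟩

lemma CoshBelow.shift {S T : Set ℂ} {w : ℂ → ℂ} (h : CoshBelow T w) (ψ : ℝ)
    (hST : ∀ s ∈ S, s - ψ * Complex.I ∈ T) : CoshBelow S (fun s => w (s - ψ * Complex.I)) := by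
  obtain ⟨δ, h0, hδ⟩ := h
  refine ⟨δ, h0, fun s hs => ?_⟩
  have := hδ _ (hST s hs)
  simpa using this

lemma CoshBelow.ne_zero {S : Set ℂ} {w : ℂ → ℂ} (h : CoshBelow S w) {s : ℂ} (hs : s ∈ S) :
    w s ≠ 0 := by
  obtain ⟨δ, h0, hδ⟩ := h
  have := hδ s hs
  have := Real.cosh_pos s.re
  have : 0 < ‖w s‖ := lt_of_lt_of_le (by positivity) (hδ s hs)
  exact norm_pos_iff.1 this

lemma cosh_sub_neg_pi_mul_I (s : ℂ) : Complex.cosh (s - (-Real.pi : ℝ) * Complex.I) = -Complex.cosh s := by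
  have : s - (-Real.pi : ℝ) * Complex.I = s + Real.pi * Complex.I := by push_cast; ring
  rw [this, Complex.cosh_add, Complex.cosh_mul_I, Complex.sinh_mul_I]
  simp

lemma CoshBelow.add_of_shift {S T : Set ℂ} {γ : ℝ}
    (h : CoshBelow T (fun s => Complex.cosh s - (Real.cos γ : ℝ)))
    (hST : ∀ s ∈ S, s - (-Real.pi : ℝ) * Complex.I ∈ T) :
    CoshBelow S (fun s => Complex.cosh s + (Real.cos γ : ℝ)) := by
  obtain ⟨δ, h0, hδ⟩ := h.shift (-Real.pi) hST
  refine ⟨δ, h0, fun s hs => ?_⟩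
  have := hδ s hs
  beta_reduce at this ⊢
  rwa [cosh_sub_neg_pi_mul_I, ← norm_neg, neg_sub, sub_neg_eq_add, add_comm] at this

lemma coshBelow_add_strip {γ lo hi : ℝ} (h0 : 0 ≤ γ) (hlo : -(Real.pi - γ) < lo)
    (hhi : hi < Real.pi - γ) :
    CoshBelow {s | s.im ∈ Set.Icc lo hi} (fun s => Complex.cosh s + (Real.cos γ : ℝ)) := by
  refine (coshBelow_strip (γ := γ) (lo := lo + Real.pi) (hi := hi + Real.pi) h0
    (by linarith) (by linarith)).add_of_shift fun s hs => ?_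
  have h1 : lo ≤ s.im ∧ s.im ≤ hi := hs
  have : (s - (-Real.pi : ℝ) * Complex.I).im = s.im + Real.pi := by simp
  show _ ∈ Set.Icc _ _
  rw [this]
  constructor <;> linarith [h1.1, h1.2]

lemma coshBelow_add_tail {γ R : ℝ} (hR : 0 < R) :
    CoshBelow {s | R ≤ |s.re|} (fun s => Complex.cosh s + (Real.cos γ : ℝ)) :=
  (coshBelow_tail (γ := γ) hR).add_of_shift fun s hs => by simpa using hs

lemma norm_cosh_le (s : ℂ) : ‖Complex.cosh s‖ ≤ Real.cosh s.re := by
  have h1 := normSq_cosh_sub_cos s (Real.pi / 2)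
  rw [Real.cos_pi_div_two, Complex.ofReal_zero, sub_zero, Real.cos_add_pi_div_two,
    Real.cos_sub_pi_div_two] at h1
  have h2 := Real.cosh_pos s.re
  refine le_of_sq_le_sq ?_ h2.le
  rw [h1]
  nlinarith [sq_nonneg (Real.sin s.im)]

lemma norm_sinh_le (s : ℂ) : ‖Complex.sinh s‖ ≤ Real.cosh s.re := by
  have h := norm_cosh_le (s + (Real.pi / 2 : ℝ) * Complex.I)
  rw [Complex.cosh_add, Complex.cosh_mul_I, Complex.sinh_mul_I, ← Complex.ofReal_cos,
    ← Complex.ofReal_sin, Real.cos_pi_div_two, Real.sin_pi_div_two] at h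
  simpa using h

lemma norm_cosh_add_cos_le (s : ℂ) (γ : ℝ) :
    ‖Complex.cosh s + (Real.cos γ : ℝ)‖ ≤ 2 * Real.cosh s.re := by
  refine (norm_add_le _ _).trans ?_
  rw [Complex.norm_real, Real.norm_eq_abs]
  have := norm_cosh_le s
  have := Real.one_le_cosh s.re
  have := Real.abs_cos_le_one γ
  linarith

lemma norm_cosh_sub_cos_le (s : ℂ) (γ : ℝ) :
    ‖Complex.cosh s - (Real.cos γ : ℝ)‖ ≤ 2 * Real.cosh s.re := by
  refine (norm_sub_le _ _).trans ?_
  rw [Complex.norm_real, Real.norm_eq_abs]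
  have := norm_cosh_le s
  have := Real.one_le_cosh s.re
  have := Real.abs_cos_le_one γ
  linarith

lemma BddHol.mul {S : Set ℂ} {G H : ℂ → ℂ} (hG : BddHol S G) (hH : BddHol S H) :
    BddHol S (fun s => G s * H s) := by
  obtain ⟨dG, C, hC⟩ := hG
  obtain ⟨dH, D, hD⟩ := hH
  refine ⟨dG.mul dH, C * D, fun s hs => ?_⟩
  rw [norm_mul]
  exact mul_le_mul (hC s hs) (hD s hs) (norm_nonneg _) ((norm_nonneg _).trans (hC s hs))

lemma BddHol.pow {S : Set ℂ} {G : ℂ → ℂ} (hG : BddHol S G) (k : ℕ) :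
    BddHol S (fun s => G s ^ k) := by
  obtain ⟨dG, C, hC⟩ := hG
  refine ⟨dG.pow k, C ^ k, fun s hs => ?_⟩
  rw [norm_pow]
  exact pow_le_pow_left₀ (norm_nonneg _) (hC s hs) k

lemma BddHol.sum {ι : Type*} {S : Set ℂ} {F : Finset ι} {G : ι → ℂ → ℂ}
    (hG : ∀ i ∈ F, BddHol S (G i)) : BddHol S (fun s => ∑ i ∈ F, G i s) := by
  choose! dG C hC using hG
  refine ⟨DifferentiableOn.fun_sum dG, ∑ i ∈ F, C i, fun s hs => ?_⟩
  exact norm_sum_le_of_le _ fun i hi => hC i hi s hs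

lemma BddHol.sub {S : Set ℂ} {G H : ℂ → ℂ} (hG : BddHol S G) (hH : BddHol S H) :
    BddHol S (fun s => G s - H s) := by
  obtain ⟨dG, C, hC⟩ := hG
  obtain ⟨dH, D, hD⟩ := hH
  refine ⟨dG.sub dH, C + D, fun s hs => ?_⟩
  exact (norm_sub_le _ _).trans (add_le_add (hC s hs) (hD s hs))

lemma BddHol.mono {S T : Set ℂ} {G : ℂ → ℂ} (hG : BddHol T G) (h : S ⊆ T) : BddHol S G :=
  ⟨hG.1.mono h, hG.2.imp fun _ hC s hs => hC s (h hs)⟩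

lemma DecHol.mono {S T : Set ℂ} {G : ℂ → ℂ} (hG : DecHol T G) (h : S ⊆ T) : DecHol S G :=
  ⟨hG.1.mono h, hG.2.imp fun _ hC s hs => hC s (h hs)⟩

lemma BddHol.mul_decHol {S : Set ℂ} {G H : ℂ → ℂ} (hG : BddHol S G) (hH : DecHol S H) :
    DecHol S (fun s => G s * H s) := by
  obtain ⟨dG, C, hC⟩ := hG
  obtain ⟨dH, D, hD⟩ := hH
  refine ⟨dG.mul dH, C * D, fun s hs => ?_⟩
  rw [norm_mul, mul_div_assoc]
  exact mul_le_mul (hC s hs) (hD s hs) (norm_nonneg _) ((norm_nonneg _).trans (hC s hs))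

lemma bddHol_cay {S : Set ℂ} {α : ℝ}
    (h : CoshBelow S (fun s => Complex.cosh s + (Real.cos α : ℝ))) : BddHol S (cay α) := by
  refine ⟨fun s hs => ?_, ?_⟩
  · have := h.ne_zero hs
    unfold cay
    exact DifferentiableAt.differentiableWithinAt (by fun_prop (disch := exact this))
  · obtain ⟨δ, h0, hδ⟩ := h
    refine ⟨2 / δ, fun s hs => ?_⟩
    have h1 := hδ s hs
    have hC := Real.cosh_pos s.re
    unfold cay
    rw [norm_div, div_le_div_iff₀ (lt_of_lt_of_le (by positivity) h1) h0]
    have h2 := norm_cosh_sub_cos_le s α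
    nlinarith

lemma BddHol.shift {S T : Set ℂ} {G : ℂ → ℂ} (h : BddHol T G) (ψ : ℝ)
    (hST : ∀ s ∈ S, s - ψ * Complex.I ∈ T) : BddHol S (fun s => G (s - ψ * Complex.I)) :=
  ⟨h.1.comp (by fun_prop) hST, h.2.imp fun _ hC s hs => hC _ (hST s hs)⟩

lemma decHol_cayForm {S : Set ℂ} {α : ℝ}
    (h : CoshBelow S (fun s => Complex.cosh s - (Real.cos α : ℝ))) (m : ℕ) :
    DecHol S (cayForm α m) := by
  refine ⟨fun s hs => ?_, ?_⟩
  · have := h.ne_zero hs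
    unfold cayForm
    exact DifferentiableAt.differentiableWithinAt
      (by fun_prop (disch := exact pow_ne_zero _ this))
  · obtain ⟨δ, h0, hδ⟩ := h
    refine ⟨2 * 2 ^ m / δ ^ (m + 2), fun s hs => ?_⟩
    have h1 := hδ s hs
    have hC := Real.cosh_pos s.re
    have hpos : 0 < δ * Real.cosh s.re := by positivity
    unfold cayForm
    rw [norm_div, norm_mul, norm_mul, norm_mul, norm_pow, norm_pow, Complex.norm_real]
    have h2 := norm_sinh_le s
    have h3 := norm_cosh_add_cos_le s α
    have h4 := Real.abs_cos_le_one α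
    calc ‖(2 : ℂ)‖ * ‖Real.cos α‖ * ‖Complex.sinh s‖ * ‖Complex.cosh s + (Real.cos α : ℝ)‖ ^ m /
          ‖Complex.cosh s - (Real.cos α : ℝ)‖ ^ (m + 2)
        ≤ 2 * 1 * Real.cosh s.re * (2 * Real.cosh s.re) ^ m / (δ * Real.cosh s.re) ^ (m + 2) := by
          gcongr
          · simp
          · exact h4
      _ = 2 * 2 ^ m / δ ^ (m + 2) / Real.cosh s.re := by
          field_simp
          ring

/-! ### Contour shifts in strips -/

lemma one_add_sq_le_two_mul_cosh (a : ℝ) : 1 + a ^ 2 ≤ 2 * Real.cosh a := by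
  have h2 : (a / 2) ^ 2 ≤ Real.sinh (a / 2) ^ 2 := by
    rw [← sq_abs (a / 2), ← sq_abs (Real.sinh (a / 2)), Real.abs_sinh]
    exact pow_le_pow_left₀ (abs_nonneg _) (Real.self_le_sinh_iff.2 (abs_nonneg _)) 2
  have h3 := Real.cosh_sq (a / 2)
  have h4 := Real.cosh_two_mul (a / 2)
  rw [mul_div_cancel₀ a two_ne_zero] at h4
  nlinarith

lemma integrable_inv_cosh : Integrable (fun a : ℝ => 1 / Real.cosh a) := by
  refine (integrable_inv_one_add_sq.const_mul 2).mono' ?_ (Eventually.of_forall fun a => ?_)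
  · exact (Continuous.aestronglyMeasurable
      (continuous_const.div Real.continuous_cosh fun a => (Real.cosh_pos a).ne'))
  · have h := Real.cosh_pos a
    rw [Real.norm_eq_abs, abs_of_pos (by positivity), ← div_eq_mul_inv,
      div_le_div_iff₀ h (by positivity)]
    have := one_add_sq_le_two_mul_cosh a
    linarith

lemma tendsto_cosh_cocompact : Tendsto Real.cosh (cocompact ℝ) atTop := by
  have h1 : Tendsto (fun a : ℝ => |a|) (cocompact ℝ) atTop := tendsto_norm_cocompact_atTop
  refine tendsto_atTop_mono (fun a => ?_) h1
  have := one_add_sq_le_two_mul_cosh a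
  rw [← sq_abs] at this
  nlinarith [sq_nonneg (|a| - 1)]

lemma tendsto_cosh_atBot : Tendsto Real.cosh atBot atTop :=
  tendsto_cosh_cocompact.mono_left atBot_le_cocompact

/-- Restriction of a decaying function to a horizontal line, or to a part of it. -/
lemma DecHol.integrableOn {S : Set ℂ} {G : ℂ → ℂ} (h : DecHol S G) {A : Set ℝ}
    (hA : MeasurableSet A) {x : ℝ} (hS : ∀ a ∈ A, (a + x * Complex.I : ℂ) ∈ S) :
    IntegrableOn (fun a : ℝ => G (a + x * Complex.I)) A := by
  obtain ⟨dG, C, hC⟩ := h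
  refine Integrable.mono' (integrable_inv_cosh.const_mul C).integrableOn ?_ ?_
  · refine ContinuousOn.aestronglyMeasurable ?_ hA
    exact dG.continuousOn.comp (by fun_prop) hS
  · refine (ae_restrict_iff' hA).2 (Eventually.of_forall fun a ha => ?_)
    have := hC _ (hS a ha)
    simpa [div_eq_mul_inv] using this

lemma DecHol.integrable {S : Set ℂ} {G : ℂ → ℂ} (h : DecHol S G) {x : ℝ}
    (hS : ∀ a : ℝ, (a + x * Complex.I : ℂ) ∈ S) :
    Integrable (fun a : ℝ => G (a + x * Complex.I)) :=
  integrableOn_univ.1 (h.integrableOn MeasurableSet.univ fun a _ => hS a)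

/-- Cauchy's theorem in a half-strip which extends to the left. -/
lemma DecHol.integral_Iic_sub {G : ℂ → ℂ} {b x y : ℝ}
    (h : DecHol {s | s.re ≤ b ∧ s.im ∈ Set.uIcc x y} G) :
    (∫ a in Set.Iic b, G (a + x * Complex.I)) - (∫ a in Set.Iic b, G (a + y * Complex.I)) =
      -(Complex.I * ∫ t in x..y, G (b + t * Complex.I)) := by
  have hx := h.integrableOn (A := Set.Iic b) measurableSet_Iic (x := x)
    fun a ha => ⟨by simpa using ha, by simp⟩
  have hy := h.integrableOn (A := Set.Iic b) measurableSet_Iic (x := y)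
    fun a ha => ⟨by simpa using ha, by simp⟩
  obtain ⟨dG, C, hC⟩ := h
  have tx := intervalIntegral_tendsto_integral_Iic b hx tendsto_id
  have ty := intervalIntegral_tendsto_integral_Iic b hy tendsto_id
  have tz : Tendsto (fun T : ℝ => ∫ t in x..y, G (T + t * Complex.I)) atBot (nhds 0) := by
    have hlim : Tendsto (fun T : ℝ => C / Real.cosh T * |y - x|) atBot (nhds 0) := by
      simpa using (tendsto_cosh_atBot.const_div_atTop C).mul_const |y - x|
    refine squeeze_zero_norm' ?_ hlim
    filter_upwards [eventually_le_atBot b] with T hT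
    refine intervalIntegral.norm_integral_le_of_norm_le_const fun t ht => ?_
    have := hC (T + t * Complex.I) ⟨by simpa using hT, by
      simpa using Set.uIoc_subset_uIcc ht⟩
    simpa using this
  have key : ∀ᶠ T : ℝ in atBot, (∫ a in T..b, G (a + x * Complex.I)) -
      (∫ a in T..b, G (a + y * Complex.I)) - Complex.I * (∫ t in x..y, G (T + t * Complex.I)) =
      -(Complex.I * ∫ t in x..y, G (b + t * Complex.I)) := by
    filter_upwards [eventually_le_atBot b] with T hT
    have := Complex.integral_boundary_rect_eq_zero_of_differentiableOn G
      (T + x * Complex.I) (b + y * Complex.I) (dG.mono ?_)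
    · simp only [Complex.add_re, Complex.ofReal_re, Complex.mul_re, Complex.I_re, mul_zero,
        Complex.ofReal_im, Complex.I_im, mul_one, sub_self, add_zero, Complex.add_im,
        Complex.mul_im, zero_add, smul_eq_mul] at this
      linear_combination this
    · intro s hs
      rw [Complex.mem_reProdIm] at hs
      simp only [Complex.add_re, Complex.ofReal_re, Complex.mul_re, Complex.I_re, mul_zero,
        Complex.ofReal_im, Complex.I_im, mul_one, sub_self, add_zero, Complex.add_im,
        Complex.mul_im, zero_add] at hs
      refine ⟨?_, hs.2⟩
      have := hs.1
      rw [Set.uIcc_of_le hT] at this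
      exact this.2
  have hl := (tx.sub ty).sub (tz.const_mul Complex.I)
  rw [mul_zero, sub_zero] at hl
  exact tendsto_nhds_unique (hl.congr' key) tendsto_const_nhds |>.symm ▸ rfl

/-- Cauchy's theorem in a half-strip which extends to the right. -/
lemma DecHol.integral_Ioi_sub {G : ℂ → ℂ} {b x y : ℝ}
    (h : DecHol {s | b ≤ s.re ∧ s.im ∈ Set.uIcc x y} G) :
    (∫ a in Set.Ioi b, G (a + x * Complex.I)) - (∫ a in Set.Ioi b, G (a + y * Complex.I)) =
      Complex.I * ∫ t in x..y, G (b + t * Complex.I) := by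
  -- Reflect `s ↦ -s` and use the left half-strip.
  have h' : DecHol {s | s.re ≤ -b ∧ s.im ∈ Set.uIcc (-x) (-y)} (fun s => G (-s)) := by
    have hmaps : ∀ s ∈ {s : ℂ | s.re ≤ -b ∧ s.im ∈ Set.uIcc (-x) (-y)},
        -s ∈ {s : ℂ | b ≤ s.re ∧ s.im ∈ Set.uIcc x y} := by
      rintro s ⟨h1, h2⟩
      refine ⟨by rw [Complex.neg_re]; linarith, ?_⟩
      rw [Complex.neg_im]
      rw [Set.mem_uIcc] at h2 ⊢
      rcases h2 with h2 | h2
      · right; constructor <;> linarith [h2.1, h2.2]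
      · left; constructor <;> linarith [h2.1, h2.2]
    obtain ⟨dG, C, hC⟩ := h
    refine ⟨dG.comp (by fun_prop) hmaps, C, fun s hs => ?_⟩
    have := hC _ (hmaps s hs)
    simpa using this
  have key := h'.integral_Iic_sub
  have e : ∀ x : ℝ, ∫ a in Set.Iic (-b), G (-((a : ℂ) + (-x : ℝ) * Complex.I)) =
      ∫ a in Set.Ioi b, G (a + x * Complex.I) := by
    intro x
    have := integral_comp_neg_Iic (-b) (fun a : ℝ => G (a + x * Complex.I))
    rw [neg_neg] at this
    rw [← this]
    congr 1
    funext a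
    congr 1
    push_cast
    ring
  rw [e x, e y] at key
  rw [key]
  have e2 := intervalIntegral.integral_comp_neg (fun t : ℝ => G (b + t * Complex.I)) (a := -x) (b := -y)
  rw [neg_neg, neg_neg] at e2
  rw [intervalIntegral.integral_symm y x, ← e2, mul_neg, neg_inj]
  congr 2
  funext a
  congr 1
  push_cast
  ring

/-- Cauchy's theorem in a strip. -/
lemma DecHol.integral_eq {G : ℂ → ℂ} {x y : ℝ} (h : DecHol {s | s.im ∈ Set.uIcc x y} G) :
    (∫ a : ℝ, G (a + x * Complex.I)) = ∫ a : ℝ, G (a + y * Complex.I) := by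
  have hx := h.integrable (x := x) fun a => by simp
  have hy := h.integrable (x := y) fun a => by simp
  have h1 := (h.mono (S := {s | s.re ≤ 0 ∧ s.im ∈ Set.uIcc x y}) fun s hs => hs.2).integral_Iic_sub
  have h2 := (h.mono (S := {s | 0 ≤ s.re ∧ s.im ∈ Set.uIcc x y}) fun s hs => hs.2).integral_Ioi_sub
  rw [← intervalIntegral.integral_Iic_add_Ioi hx.integrableOn hx.integrableOn (b := 0),
    ← intervalIntegral.integral_Iic_add_Ioi hy.integrableOn hy.integrableOn (b := 0)]
  linear_combination h1 + h2

/-! ### The orbit sum and the contour integral -/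

section

/-- The function `cay α` rotated by `m` times the angle `π / n`. -/
def rot (n : ℕ) (α : ℝ) (m : ℕ) (s : ℂ) : ℂ :=
  cay α (s - (m * (Real.pi / n) : ℝ) * Complex.I)

/-- The alternating sum of the function `x ^ p y ^ q` over one half of the orbit of a point under the
group of the walk; here `x = cay α` and `y = cay β`, rotated by `π / n` against each other. -/
def orbitSum (n : ℕ) (α β : ℝ) (p q : ℕ) (s : ℂ) : ℂ :=
  ∑ k ∈ Finset.range (n / 2), rot n α (2 * k + 2) s ^ p * rot n β (2 * k + 1) s ^ q -
    ∑ l ∈ Finset.range ((n + 1) / 2), rot n α (2 * l) s ^ p * rot n β (2 * l + 1) s ^ q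

/-- The height of the line of integration; any number between `π / 2` and `2 π / 3` would do. -/
def height : ℝ := 7 * Real.pi / 12

/-- The contour integral which solves the Dirichlet problem: the coefficient of `x ^ (m + 1)` in
`orbitSum`, taken along the line `Im s = height` which all the terms of the orbit sum admit. -/
def exitInt (n : ℕ) (α β : ℝ) (m p q : ℕ) : ℂ :=
  (∫ a : ℝ, orbitSum n α β p q (a + height * Complex.I) * cayForm α m (a + height * Complex.I)) /
    (2 * Real.pi * Complex.I)

lemma pi_div_le {n : ℕ} (hn : 3 ≤ n) : Real.pi / n ≤ Real.pi / 3 := by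
  have hn' : (3 : ℝ) ≤ n := by exact_mod_cast hn
  exact div_le_div_of_nonneg_left Real.pi_pos.le (by norm_num) hn'

lemma pi_div_pos {n : ℕ} (hn : 3 ≤ n) : 0 < Real.pi / n := by
  have hn' : (3 : ℝ) ≤ n := by exact_mod_cast hn
  have := Real.pi_pos
  positivity

lemma mul_pi_div_le {n m : ℕ} (hn : 3 ≤ n) (hm : m ≤ n) : m * (Real.pi / n) ≤ Real.pi := by
  have hn' : (0 : ℝ) < n := by exact_mod_cast (by omega : 0 < n)
  have hm' : (m : ℝ) ≤ n := by exact_mod_cast hm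
  calc m * (Real.pi / n) ≤ n * (Real.pi / n) := by
        have := (pi_div_pos hn).le
        gcongr
    _ = Real.pi := by field_simp

lemma rot_natCast_self {n : ℕ} (hn : 3 ≤ n) (α : ℝ) (s : ℂ) : rot n α n s = (cay α s)⁻¹ := by
  have hn' : (n : ℝ) ≠ 0 := by exact_mod_cast (by omega : n ≠ 0)
  have h1 : (n : ℝ) * (Real.pi / n) = Real.pi := by field_simp
  have h2 : Complex.cosh (s - (Real.pi : ℝ) * Complex.I) = -Complex.cosh s := by
    rw [Complex.cosh_sub, Complex.cosh_mul_I, Complex.sinh_mul_I]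
    simp
  rw [rot, h1, cay, cay, h2, inv_div, ← neg_div_neg_eq]
  congr 1 <;> ring

lemma rot_zero (n : ℕ) (α : ℝ) (s : ℂ) : rot n α 0 s = cay α s := by
  simp [rot]

lemma bddHol_rot {n m : ℕ} {α x y : ℝ} (hα : 0 ≤ α) (hα' : α ≤ Real.pi / n)
    (hx : |x - m * (Real.pi / n)| < Real.pi - Real.pi / n)
    (hy : |y - m * (Real.pi / n)| < Real.pi - Real.pi / n) :
    BddHol {s | s.im ∈ Set.uIcc x y} (rot n α m) := by
  rw [abs_lt] at hx hy
  have h := bddHol_cay (coshBelow_add_strip (γ := α)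
    (lo := min (x - m * (Real.pi / n)) (y - m * (Real.pi / n)))
    (hi := max (x - m * (Real.pi / n)) (y - m * (Real.pi / n))) hα
    (lt_min (by linarith [hx.1]) (by linarith [hy.1]))
    (max_lt (by linarith [hx.2]) (by linarith [hy.2])))
  refine h.shift (m * (Real.pi / n)) fun s hs => ?_
  have h1 : s.im ∈ Set.uIcc x y := hs
  have h2 : (s - (m * (Real.pi / n) : ℝ) * Complex.I).im = s.im - m * (Real.pi / n) := by simp
  show _ ∈ Set.uIcc _ _
  rw [h2]
  rw [Set.mem_uIcc] at h1 ⊢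
  rcases h1 with h1 | h1
  · left; constructor <;> linarith [h1.1, h1.2]
  · right; constructor <;> linarith [h1.1, h1.2]

lemma decHol_cayForm_strip {n : ℕ} {α x y : ℝ} (hα : 0 ≤ α) (hα' : α ≤ Real.pi / n) (m : ℕ)
    (hx : Real.pi / n < x ∧ x < 2 * Real.pi - Real.pi / n)
    (hy : Real.pi / n < y ∧ y < 2 * Real.pi - Real.pi / n) :
    DecHol {s | s.im ∈ Set.uIcc x y} (cayForm α m) :=
  decHol_cayForm (coshBelow_strip (γ := α) hα (lt_min (by linarith [hx.1]) (by linarith [hy.1]))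
    (max_lt (by linarith [hx.2]) (by linarith [hy.2]))) m

lemma abs_height_sub_lt {n m : ℕ} (hn : 3 ≤ n) (hm : m ≤ n) :
    |height - m * (Real.pi / n)| < Real.pi - Real.pi / n := by
  have h1 := pi_div_le hn
  have h2 := mul_pi_div_le hn hm
  have h3 := Real.pi_pos
  have h4 : 0 ≤ m * (Real.pi / n) := by positivity
  unfold height
  rw [abs_lt]
  constructor <;> linarith

lemma height_mem {n : ℕ} (hn : 3 ≤ n) :
    Real.pi / n < height ∧ height < 2 * Real.pi - Real.pi / n := by
  have h1 := pi_div_le hn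
  have h3 := Real.pi_pos
  unfold height
  constructor <;> linarith

variable {n : ℕ} {α β : ℝ}

lemma bddHol_orbitSum (hn : 3 ≤ n) (hα : 0 ≤ α) (hα' : α ≤ Real.pi / n) (hβ : 0 ≤ β)
    (hβ' : β ≤ Real.pi / n) (p q : ℕ) {S : Set ℂ} (hS : ∀ s ∈ S, s.im = height) :
    BddHol S (orbitSum n α β p q) := by
  have hr : ∀ (γ : ℝ) (m : ℕ), 0 ≤ γ → γ ≤ Real.pi / n → m ≤ n → BddHol S (rot n γ m) :=
    fun γ m h0 h1 hm => (bddHol_rot (x := height) (y := height) h0 h1 (abs_height_sub_lt hn hm)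
      (abs_height_sub_lt hn hm)).mono fun s hs => by simp [hS s hs]
  refine BddHol.sub (BddHol.sum fun k hk => ?_) (BddHol.sum fun l hl => ?_)
  · rw [Finset.mem_range] at hk
    exact ((hr α _ hα hα' (by omega)).pow p).mul ((hr β _ hβ hβ' (by omega)).pow q)
  · rw [Finset.mem_range] at hl
    exact ((hr α _ hα hα' (by omega)).pow p).mul ((hr β _ hβ hβ' (by omega)).pow q)

lemma integrable_orbitSum_mul (hn : 3 ≤ n) (hα : 0 ≤ α) (hα' : α ≤ Real.pi / n) (hβ : 0 ≤ β)
    (hβ' : β ≤ Real.pi / n) (m p q : ℕ) :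
    Integrable (fun a : ℝ => orbitSum n α β p q (a + height * Complex.I) *
      cayForm α m (a + height * Complex.I)) := by
  have h := (bddHol_orbitSum hn hα hα' hβ hβ' p q (S := {s | s.im ∈ Set.uIcc height height})
    (fun s hs => by simpa using hs)).mul_decHol
    (decHol_cayForm_strip hα hα' m (height_mem hn) (height_mem hn))
  exact h.integrable fun a => by simp

/-! ### Boundedness -/

lemma re_cosh (s : ℂ) : (Complex.cosh s).re = Real.cosh s.re * Real.cos s.im := by
  conv_lhs => rw [← Complex.re_add_im s, Complex.cosh_add, Complex.cosh_mul_I, Complex.sinh_mul_I]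
  rw [← Complex.ofReal_cosh, ← Complex.ofReal_sinh, ← Complex.ofReal_cos, ← Complex.ofReal_sin]
  simp [-Complex.ofReal_cosh, -Complex.ofReal_sinh, -Complex.ofReal_cos, -Complex.ofReal_sin]

lemma norm_cay_le_one (hα : 0 ≤ Real.cos α) {s : ℂ} (hs : 0 ≤ Real.cos s.im) :
    ‖cay α s‖ ≤ 1 := by
  unfold cay
  rw [norm_div]
  refine div_le_one_of_le₀ (le_of_sq_le_sq ?_ (norm_nonneg _)) (norm_nonneg _)
  have h : 0 ≤ (Complex.cosh s).re := by
    rw [re_cosh]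
    exact mul_nonneg (Real.cosh_pos _).le hs
  rw [← Complex.normSq_eq_norm_sq, ← Complex.normSq_eq_norm_sq, Complex.normSq_apply,
    Complex.normSq_apply, Complex.sub_re, Complex.add_re, Complex.sub_im, Complex.add_im,
    Complex.ofReal_re, Complex.ofReal_im]
  nlinarith [mul_nonneg h hα]

lemma norm_integral_term_le (hn : 3 ≤ n) (hα : 0 ≤ α) (hα' : α ≤ Real.pi / n) (hβ : 0 ≤ β)
    (hβ' : β ≤ Real.pi / n) (m p q : ℕ) {m₁ m₂ : ℕ} (h₁ : m₁ ≤ n) (h₂ : m₂ ≤ n) {ψ : ℝ}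
    (hψ : Real.pi / n < ψ ∧ ψ < 2 * Real.pi - Real.pi / n)
    (hψ₁ : |ψ - m₁ * (Real.pi / n)| ≤ Real.pi / 2) (hψ₂ : |ψ - m₂ * (Real.pi / n)| ≤ Real.pi / 2) :
    Integrable (fun a : ℝ => rot n α m₁ (a + height * Complex.I) ^ p *
      rot n β m₂ (a + height * Complex.I) ^ q * cayForm α m (a + height * Complex.I)) ∧
    ‖∫ a : ℝ, rot n α m₁ (a + height * Complex.I) ^ p * rot n β m₂ (a + height * Complex.I) ^ q *
      cayForm α m (a + height * Complex.I)‖ ≤ ∫ a : ℝ, ‖cayForm α m (a + ψ * Complex.I)‖ := by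
  have hθ := pi_div_le hn
  have hθ0 := pi_div_pos hn
  have hpi := Real.pi_pos
  have hD : DecHol {s | s.im ∈ Set.uIcc height ψ}
      (fun s => rot n α m₁ s ^ p * rot n β m₂ s ^ q * cayForm α m s) :=
    (((bddHol_rot hα hα' (abs_height_sub_lt hn h₁) (by linarith)).pow p).mul
      ((bddHol_rot hβ hβ' (abs_height_sub_lt hn h₂) (by linarith)).pow q)).mul_decHol
      (decHol_cayForm_strip hα hα' m (height_mem hn) hψ)
  refine ⟨hD.integrable fun a => by simp, ?_⟩
  rw [hD.integral_eq]
  refine norm_integral_le_of_norm_le ?_ (Eventually.of_forall fun a => ?_)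
  · exact ((decHol_cayForm_strip hα hα' m (height_mem hn) hψ).integrable
      fun a => by simp).norm
  · have hle : ∀ (γ : ℝ) (k : ℕ), 0 ≤ γ → γ ≤ Real.pi / n → |ψ - k * (Real.pi / n)| ≤ Real.pi / 2 →
        ‖rot n γ k (a + ψ * Complex.I)‖ ≤ 1 := by
      intro γ k h0 h1 h2
      refine norm_cay_le_one (Real.cos_nonneg_of_mem_Icc ⟨by linarith, by linarith⟩) ?_
      rw [abs_le] at h2
      refine Real.cos_nonneg_of_mem_Icc ?_
      simpa using h2
    rw [norm_mul, norm_mul, norm_pow, norm_pow]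
    have e1 := pow_le_one₀ (n := p) (norm_nonneg _) (hle α m₁ hα hα' hψ₁)
    have e2 := pow_le_one₀ (n := q) (norm_nonneg _) (hle β m₂ hβ hβ' hψ₂)
    have e3 := mul_le_one₀ e1 (by positivity) e2
    exact mul_le_of_le_one_left (norm_nonneg _) e3

/-- The contour integral is bounded uniformly in the starting point: each term of the orbit sum can
be moved to a line on which both of its factors are at most one in modulus. -/
lemma exists_norm_exitInt_le (hn : 3 ≤ n) (hα : 0 ≤ α) (hα' : α ≤ Real.pi / n) (hβ : 0 ≤ β)
    (hβ' : β ≤ Real.pi / n) (m : ℕ) : ∃ C, ∀ p q, ‖exitInt n α β m p q‖ ≤ C := by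
  have hθ := pi_div_le hn
  have hθ0 := pi_div_pos hn
  have hpi := Real.pi_pos
  -- Both terms with index `k` are moved to the height `(2 k + 3 / 2) π / n`, which differs by at most
  -- `(3 / 2) π / n ≤ π / 2` from the heights at which their factors are centred.
  set D : ℕ → ℝ := fun k => ∫ a : ℝ, ‖cayForm α m
    (a + ((2 * k + 3 / 2) * (Real.pi / n) : ℝ) * Complex.I)‖ with hD
  have hψ : ∀ k : ℕ, 2 * k + 1 ≤ n → Real.pi / n < (2 * k + 3 / 2) * (Real.pi / n) ∧
      (2 * k + 3 / 2) * (Real.pi / n) < 2 * Real.pi - Real.pi / n := by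
    intro k hk
    have h1 := mul_pi_div_le hn hk
    push_cast at h1
    have h2 : 0 ≤ (k : ℝ) * (Real.pi / n) := by positivity
    constructor <;> nlinarith
  refine ⟨(∑ k ∈ Finset.range (n / 2), D k + ∑ k ∈ Finset.range ((n + 1) / 2), D k) /
    ‖(2 * Real.pi * Complex.I : ℂ)‖, fun p q => ?_⟩
  have h1 : ∀ k ∈ Finset.range (n / 2), _ := fun k hk =>
    norm_integral_term_le hn hα hα' hβ hβ' m p q (m₁ := 2 * k + 2) (m₂ := 2 * k + 1)
      (by rw [Finset.mem_range] at hk; omega) (by rw [Finset.mem_range] at hk; omega)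
      (hψ k (by rw [Finset.mem_range] at hk; omega))
      (by rw [abs_le]; push_cast; constructor <;> linarith)
      (by rw [abs_le]; push_cast; constructor <;> linarith)
  have h2 : ∀ k ∈ Finset.range ((n + 1) / 2), _ := fun k hk =>
    norm_integral_term_le hn hα hα' hβ hβ' m p q (m₁ := 2 * k) (m₂ := 2 * k + 1)
      (by rw [Finset.mem_range] at hk; omega) (by rw [Finset.mem_range] at hk; omega)
      (hψ k (by rw [Finset.mem_range] at hk; omega))
      (by rw [abs_le]; push_cast; constructor <;> linarith)
      (by rw [abs_le]; push_cast; constructor <;> linarith)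
  unfold exitInt
  rw [norm_div]
  gcongr
  simp only [orbitSum, sub_mul, Finset.sum_mul]
  rw [integral_sub (integrable_finsetSum _ fun k hk => (h1 k hk).1)
    (integrable_finsetSum _ fun k hk => (h2 k hk).1),
    integral_finsetSum _ fun k hk => (h1 k hk).1, integral_finsetSum _ fun k hk => (h2 k hk).1]
  exact (norm_sub_le _ _).trans (add_le_add (norm_sum_le_of_le _ fun k hk => (h1 k hk).2)
    (norm_sum_le_of_le _ fun k hk => (h2 k hk).2))

end

/-! ### Boundary values of the contour integral -/

section

variable {n : ℕ} {α β : ℝ}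

/-- For `q = 0` the orbit sum telescopes to its first and its last term. -/
lemma orbitSum_zero_right (n : ℕ) (α β : ℝ) (p : ℕ) (s : ℂ) :
    orbitSum n α β p 0 s = (if Even n then rot n α n s ^ p else 0) - rot n α 0 s ^ p := by
  unfold orbitSum
  simp only [pow_zero, mul_one]
  have htel := Finset.sum_range_succ' (fun k => rot n α (2 * k) s ^ p) (n / 2)
  rcases Nat.even_or_odd' n with ⟨K, hK | hK⟩
  · have h1 : n / 2 = K := by omega
    have h2 : (n + 1) / 2 = K := by omega
    rw [if_pos ⟨K, by omega⟩, h2]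
    rw [h1, Finset.sum_range_succ] at htel
    have h3 : rot n α n s = rot n α (2 * K) s := by rw [← hK]
    rw [h1, h3]
    simp only [mul_add, mul_one, mul_zero] at htel
    linear_combination -htel
  · have h1 : n / 2 = K := by omega
    have h2 : (n + 1) / 2 = K + 1 := by omega
    rw [if_neg (by rw [Nat.not_even_iff_odd]; exact ⟨K, hK⟩), h2, h1]
    rw [h1] at htel
    simp only [mul_add, mul_one, mul_zero] at htel
    rw [htel]
    ring

/-- For `p = 0` the terms of the orbit sum cancel, except for the last one if `n` is odd. -/
lemma orbitSum_zero_left (n : ℕ) (α β : ℝ) (q : ℕ) (s : ℂ) :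
    orbitSum n α β 0 q s = if Even n then 0 else -rot n β n s ^ q := by
  unfold orbitSum
  simp only [pow_zero, one_mul]
  rcases Nat.even_or_odd' n with ⟨K, hK | hK⟩
  · have h1 : n / 2 = K := by omega
    have h2 : (n + 1) / 2 = K := by omega
    rw [if_pos ⟨K, by omega⟩, h1, h2, sub_self]
  · have h1 : n / 2 = K := by omega
    have h2 : (n + 1) / 2 = K + 1 := by omega
    have h3 : rot n β n s = rot n β (2 * K + 1) s := by rw [← hK]
    rw [if_neg (by rw [Nat.not_even_iff_odd]; exact ⟨K, hK⟩), h1, h2, Finset.sum_range_succ, h3]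
    exact sub_add_cancel_left _ _

lemma hasDerivAt_cay {s : ℂ} (h : Complex.cosh s + (Real.cos α : ℝ) ≠ 0) :
    HasDerivAt (cay α) (2 * (Real.cos α : ℝ) * Complex.sinh s /
      (Complex.cosh s + (Real.cos α : ℝ)) ^ 2) s := by
  have h1 := ((Complex.hasDerivAt_cosh s).sub_const ((Real.cos α : ℝ) : ℂ)).div
    ((Complex.hasDerivAt_cosh s).add_const ((Real.cos α : ℝ) : ℂ)) h
  exact h1.congr_deriv (by ring)

lemma tendsto_cay_line (hn : 3 ≤ n) (hα : 0 ≤ α) (hα' : α ≤ Real.pi / n) :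
    Tendsto (fun a : ℝ => cay α (a + height * Complex.I)) (cocompact ℝ) (nhds 1) := by
  have hθ := pi_div_le hn
  have hpi := Real.pi_pos
  obtain ⟨δ, h0, hδ⟩ := coshBelow_add_strip (γ := α) (lo := height) (hi := height) hα
    (by unfold height; linarith) (by unfold height; linarith)
  rw [tendsto_iff_norm_sub_tendsto_zero]
  have hlim := tendsto_cosh_cocompact.const_div_atTop (2 / δ)
  refine squeeze_zero (fun _ => norm_nonneg _) (fun a => ?_) hlim
  have h1 := hδ (a + height * Complex.I) (by simp)
  have hre : (a + height * Complex.I : ℂ).re = a := by simp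
  rw [hre] at h1
  have hC := Real.cosh_pos a
  have hpos : 0 < ‖Complex.cosh (a + height * Complex.I) + (Real.cos α : ℝ)‖ :=
    lt_of_lt_of_le (by positivity) h1
  have hne := norm_pos_iff.1 hpos
  have : cay α (a + height * Complex.I) - 1 =
      -(2 * (Real.cos α : ℝ)) / (Complex.cosh (a + height * Complex.I) + (Real.cos α : ℝ)) := by
    unfold cay
    field_simp
    ring
  rw [this, norm_div, norm_neg, norm_mul, Complex.norm_real, div_div]
  gcongr
  have := Real.abs_cos_le_one α
  simpa using this

/-- All powers `x ^ k dx` except `x⁻¹ dx` are exact. -/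
lemma integral_zpow_mul_cayForm (hn : 3 ≤ n) (hα : 0 ≤ α) (hα' : α ≤ Real.pi / n) {k : ℤ} {m : ℕ}
    (hk : k ≠ m + 1)
    (hint : Integrable (fun a : ℝ => cay α (a + height * Complex.I) ^ k *
      cayForm α m (a + height * Complex.I))) :
    ∫ a : ℝ, cay α (a + height * Complex.I) ^ k * cayForm α m (a + height * Complex.I) = 0 := by
  have hθ := pi_div_le hn
  have hθ0 := pi_div_pos hn
  have hpi := Real.pi_pos
  have hplus := coshBelow_add_strip (γ := α) (lo := height) (hi := height) hα
    (by unfold height; linarith) (by unfold height; linarith)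
  have hminus := coshBelow_strip (γ := α) (lo := height) (hi := height) hα
    (by unfold height; linarith) (by unfold height; linarith)
  have hlim := tendsto_cay_line hn hα hα'
  set j : ℤ := k - m - 1 with hj
  have hj0 : (j : ℂ) ≠ 0 := by
    rw [Int.cast_ne_zero]; omega
  have hder : ∀ a : ℝ, HasDerivAt (fun a : ℝ => (j : ℂ)⁻¹ * cay α (a + height * Complex.I) ^ j)
      (cay α (a + height * Complex.I) ^ k * cayForm α m (a + height * Complex.I)) a := by
    intro a
    have h1 : Complex.cosh (a + height * Complex.I) + (Real.cos α : ℝ) ≠ 0 :=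
      hplus.ne_zero (s := a + height * Complex.I) (by simp)
    have h2 : Complex.cosh (a + height * Complex.I) - (Real.cos α : ℝ) ≠ 0 :=
      hminus.ne_zero (s := a + height * Complex.I) (by simp)
    have hne : cay α (a + height * Complex.I) ≠ 0 := div_ne_zero h2 h1
    have hinner : HasDerivAt (fun a : ℝ => (a : ℂ) + height * Complex.I) 1 a :=
      (Complex.ofRealCLM.hasDerivAt (x := a)).add_const _
    have hd := (((hasDerivAt_zpow j _ (Or.inl hne)).comp _ (hasDerivAt_cay h1)).comp a
      hinner).const_mul ((j : ℂ)⁻¹)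
    refine hd.congr_deriv ?_
    have e1 : k = (j - 1) + (m + 2 : ℕ) := by rw [hj]; push_cast; ring
    have e2 : cay α (a + height * Complex.I) ^ k = cay α (a + height * Complex.I) ^ (j - 1) *
        cay α (a + height * Complex.I) ^ (m + 2) := by
      rw [← zpow_natCast, ← zpow_add₀ hne, ← e1]
    have e3 : cay α (a + height * Complex.I) ^ (m + 2) * cayForm α m (a + height * Complex.I) =
        2 * (Real.cos α : ℝ) * Complex.sinh (a + height * Complex.I) /
          (Complex.cosh (a + height * Complex.I) + (Real.cos α : ℝ)) ^ 2 := by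
      unfold cay cayForm
      rw [div_pow]
      field_simp
      ring
    rw [e2, mul_assoc (cay α (a + height * Complex.I) ^ (j - 1)), e3]
    field_simp
  have hp : Tendsto (fun a : ℝ => (j : ℂ)⁻¹ * cay α (a + height * Complex.I) ^ j) (cocompact ℝ)
      (nhds ((j : ℂ)⁻¹ * 1 ^ j)) := (hlim.zpow₀ j (Or.inl one_ne_zero)).const_mul _
  rw [integral_of_hasDerivAt_of_tendsto hder hint (hp.mono_left atBot_le_cocompact)
    (hp.mono_left atTop_le_cocompact), sub_self]

/-- The winding number of `cay α` along the line of integration. -/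
lemma integral_pow_succ_mul_cayForm (hn : 3 ≤ n) (hα : 0 ≤ α) (hα' : α ≤ Real.pi / n) (m : ℕ) :
    ∫ a : ℝ, rot n α 0 (a + height * Complex.I) ^ (m + 1) *
      cayForm α m (a + height * Complex.I) = -(2 * Real.pi * Complex.I) := by
  have hθ := pi_div_le hn
  have hθ0 := pi_div_pos hn
  have hpi := Real.pi_pos
  have hc : 0 < Real.cos α := Real.cos_pos_of_mem_Ioo ⟨by linarith, by linarith⟩
  have hD : DecHol {s | s.im ∈ Set.uIcc height (Real.pi / 2)}
      (fun s => rot n α 0 s ^ (m + 1) * cayForm α m s) :=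
    ((bddHol_rot hα hα' (abs_height_sub_lt hn (Nat.zero_le n)) (by
      rw [abs_lt]; push_cast; constructor <;> linarith)).pow _).mul_decHol
      (decHol_cayForm_strip hα hα' m (height_mem hn) ⟨by linarith, by linarith⟩)
  -- On the line `Im s = π / 2` the function `cay α` runs around the unit circle.
  rw [hD.integral_eq]
  have hcosh : ∀ a : ℝ, Complex.cosh (a + (Real.pi / 2 : ℝ) * Complex.I) =
      Real.sinh a * Complex.I := by
    intro a
    rw [Complex.cosh_add, Complex.cosh_mul_I, Complex.sinh_mul_I, ← Complex.ofReal_cos,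
      ← Complex.ofReal_sin, Real.cos_pi_div_two, Real.sin_pi_div_two]
    simp
  have hsinh : ∀ a : ℝ, Complex.sinh (a + (Real.pi / 2 : ℝ) * Complex.I) =
      Real.cosh a * Complex.I := by
    intro a
    rw [Complex.sinh_add, Complex.cosh_mul_I, Complex.sinh_mul_I, ← Complex.ofReal_cos,
      ← Complex.ofReal_sin, Real.cos_pi_div_two, Real.sin_pi_div_two]
    simp
  have hint : Integrable (fun a : ℝ => rot n α 0 (a + (Real.pi / 2 : ℝ) * Complex.I) ^ (m + 1) *
      cayForm α m (a + (Real.pi / 2 : ℝ) * Complex.I)) := hD.integrable fun a => by simp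
  have hder : ∀ a : ℝ, HasDerivAt (fun a : ℝ =>
      -(2 * Complex.I) * (Real.arctan (Real.sinh a / Real.cos α) : ℝ))
      (rot n α 0 (a + (Real.pi / 2 : ℝ) * Complex.I) ^ (m + 1) *
        cayForm α m (a + (Real.pi / 2 : ℝ) * Complex.I)) a := by
    intro a
    have h1 := ((Real.hasDerivAt_sinh a).div_const (Real.cos α)).arctan.ofReal_comp.const_mul
      (-(2 * Complex.I))
    refine h1.congr_deriv ?_
    rw [rot_zero, cay, cayForm, hcosh, hsinh]
    have hplus : (Real.sinh a * Complex.I + (Real.cos α : ℝ) : ℂ) ≠ 0 := by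
      intro h
      have := congrArg Complex.re h
      simp at this
      exact hc.ne' this
    have hminus : (Real.sinh a * Complex.I - (Real.cos α : ℝ) : ℂ) ≠ 0 := by
      intro h
      have := congrArg Complex.re h
      simp at this
      exact hc.ne' this
    have hprod : ((1 + (Real.sinh a / Real.cos α) ^ 2 : ℝ) : ℂ) =
        -((Real.sinh a * Complex.I + (Real.cos α : ℝ)) *
          (Real.sinh a * Complex.I - (Real.cos α : ℝ))) / (Real.cos α : ℝ) ^ 2 := by
      have hc' : ((Real.cos α : ℝ) : ℂ) ≠ 0 := by exact_mod_cast hc.ne'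
      rw [eq_div_iff (pow_ne_zero 2 hc')]
      rw [Complex.ofReal_add, Complex.ofReal_pow, Complex.ofReal_div, Complex.ofReal_one]
      field_simp
      linear_combination ((Real.sinh a : ℝ) : ℂ) ^ 2 * Complex.I_sq
    have hc' : ((Real.cos α : ℝ) : ℂ) ≠ 0 := by exact_mod_cast hc.ne'
    rw [Complex.ofReal_mul, Complex.ofReal_div, Complex.ofReal_one, hprod, Complex.ofReal_div]
    rw [div_pow]
    generalize ((Real.sinh a : ℝ) : ℂ) * Complex.I + (Real.cos α : ℝ) = u at *
    generalize ((Real.sinh a : ℝ) : ℂ) * Complex.I - (Real.cos α : ℝ) = v at *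
    field_simp
    ring
  have hsinhTop : Tendsto Real.sinh atTop atTop := by
    refine tendsto_atTop_mono' _ ?_ tendsto_id
    filter_upwards [eventually_ge_atTop 0] with a ha using Real.self_le_sinh_iff.2 ha
  have hsinhBot : Tendsto Real.sinh atBot atBot := by
    refine tendsto_atBot_mono' _ ?_ tendsto_id
    filter_upwards [eventually_le_atBot 0] with a ha using Real.sinh_le_self_iff.2 ha
  have htop := ((Complex.continuous_ofReal.tendsto _).comp
    ((Real.tendsto_arctan_atTop.mono_right nhdsWithin_le_nhds).comp
      (hsinhTop.atTop_div_const hc))).const_mul (-(2 * Complex.I))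
  have hbot := ((Complex.continuous_ofReal.tendsto _).comp
    ((Real.tendsto_arctan_atBot.mono_right nhdsWithin_le_nhds).comp
      (hsinhBot.atBot_div_const hc))).const_mul (-(2 * Complex.I))
  rw [integral_of_hasDerivAt_of_tendsto hder hint hbot htop]
  push_cast
  ring

/-- Of the two end terms of the telescoped orbit sum, one is a negative power of `cay α` and is exact,
and the other is exact unless it is the residue at `p = m + 1`. -/
lemma exitInt_zero_right (hn : 3 ≤ n) (hα : 0 ≤ α) (hα' : α ≤ Real.pi / n) (m p : ℕ) :
    exitInt n α β m p 0 = if p = m + 1 then 1 else 0 := by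
  have hne : (2 * Real.pi * Complex.I : ℂ) ≠ 0 := Complex.two_pi_I_ne_zero
  have hint : ∀ k : ℕ, k ≤ n → Integrable (fun a : ℝ => rot n α k (a + height * Complex.I) ^ p *
      cayForm α m (a + height * Complex.I)) := by
    intro k hk
    exact (((bddHol_rot hα hα' (abs_height_sub_lt hn hk) (abs_height_sub_lt hn hk)).pow
      p).mul_decHol (decHol_cayForm_strip hα hα' m (height_mem hn) (height_mem hn))).integrable
      fun a => by simp
  have hn0 : ∫ a : ℝ, rot n α n (a + height * Complex.I) ^ p *
      cayForm α m (a + height * Complex.I) = 0 := by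
    have h := hint n le_rfl
    have e : ∀ s, rot n α n s ^ p = cay α s ^ (-(p : ℤ)) := fun s => by
      rw [rot_natCast_self hn, zpow_neg, zpow_natCast, inv_pow]
    simp only [e] at h ⊢
    exact integral_zpow_mul_cayForm hn hα hα' (by omega) h
  have h00 : ∫ a : ℝ, rot n α 0 (a + height * Complex.I) ^ p *
      cayForm α m (a + height * Complex.I) = if p = m + 1 then -(2 * Real.pi * Complex.I) else 0 := by
    split_ifs with hp
    · rw [hp]
      exact integral_pow_succ_mul_cayForm hn hα hα' m
    · have h := hint 0 (Nat.zero_le n)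
      have e : ∀ s, rot n α 0 s ^ p = cay α s ^ (p : ℤ) := fun s => by
        rw [rot_zero, zpow_natCast]
      simp only [e] at h ⊢
      exact integral_zpow_mul_cayForm hn hα hα' (by exact_mod_cast hp) h
  unfold exitInt
  simp only [orbitSum_zero_right]
  have hsplit : ∫ a : ℝ, ((if Even n then rot n α n (a + height * Complex.I) ^ p else 0) -
      rot n α 0 (a + height * Complex.I) ^ p) * cayForm α m (a + height * Complex.I) =
      -(if p = m + 1 then -(2 * Real.pi * Complex.I) else 0) := by
    rw [← h00]
    split_ifs with hev
    · simp only [sub_mul]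
      rw [integral_sub (hint n le_rfl) (hint 0 (Nat.zero_le n)), hn0, zero_sub]
    · simp only [zero_sub, neg_mul]
      rw [integral_neg]
  rw [hsplit]
  split_ifs
  · rw [neg_neg, div_self hne]
  · simp

lemma exitInt_zero_left (hn : 3 ≤ n) (hα : 0 ≤ α) (hα' : α ≤ Real.pi / n) (hβ : 0 ≤ β)
    (hβ' : β ≤ Real.pi / n) (m q : ℕ) : exitInt n α β m 0 q = 0 := by
  have hθ := pi_div_le hn
  have hθ0 := pi_div_pos hn
  have hpi := Real.pi_pos
  unfold exitInt
  simp only [orbitSum_zero_left]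
  split_ifs with hev
  · simp
  have hnπ : (n : ℝ) * (Real.pi / n) = Real.pi := by
    have hn' : (n : ℝ) ≠ 0 := by exact_mod_cast (by omega : n ≠ 0)
    field_simp
  have hD : DecHol {s | s.im ∈ Set.uIcc height Real.pi}
      (fun s => rot n β n s ^ q * cayForm α m s) :=
    ((bddHol_rot hβ hβ' (abs_height_sub_lt hn le_rfl) (by
      rw [hnπ, sub_self, abs_zero]; linarith)).pow _).mul_decHol
      (decHol_cayForm_strip hα hα' m (height_mem hn) ⟨by linarith, by linarith⟩)
  simp only [neg_mul]
  rw [integral_neg, hD.integral_eq]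
  -- On the line `Im s = π` the function is even and the form is odd.
  have hodd : ∀ a : ℝ, rot n β n ((-a : ℝ) + Real.pi * Complex.I) ^ q *
      cayForm α m ((-a : ℝ) + Real.pi * Complex.I) =
      -(rot n β n (a + Real.pi * Complex.I) ^ q * cayForm α m (a + Real.pi * Complex.I)) := by
    intro a
    simp only [rot, hnπ, add_sub_cancel_right]
    simp only [cay, cayForm, Complex.cosh_add, Complex.sinh_add, Complex.cosh_mul_I,
      Complex.sinh_mul_I, Complex.cos_pi, Complex.sin_pi, Complex.ofReal_neg, Complex.cosh_neg,
      Complex.sinh_neg]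
    ring
  have h := integral_neg_eq_self (fun a : ℝ => rot n β n (a + Real.pi * Complex.I) ^ q *
    cayForm α m (a + Real.pi * Complex.I)) volume
  simp only [hodd] at h
  rw [integral_neg] at h
  have h0 : ∫ a : ℝ, rot n β n (a + Real.pi * Complex.I) ^ q *
      cayForm α m (a + Real.pi * Complex.I) = 0 := by
    linear_combination (-1 / 2 : ℂ) * h
  rw [h0]
  simp

end

/-! ### The solutions of the Dirichlet problem -/

section

variable {n : ℕ} {α β : ℝ}

/-- The pair `(X, Y)` is a zero of the kernel of the walk, equivalently `X ^ i * Y ^ j` is harmonic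
in the interior of the quarter plane. -/
def OnKernel (n : ℕ) (X Y : ℂ) : Prop :=
  (Real.sin (Real.pi / n) : ℂ) ^ 2 / 2 * (X ^ 2 + 1) * Y +
    (Real.cos (Real.pi / n) : ℂ) ^ 2 / 2 * (X ^ 2 + Y ^ 2) = X * Y

/-- The curve `(cay θ s, cay 0 (s ± i θ))` with `θ = π / n` uniformizes the kernel. -/
lemma onKernel_cay (n : ℕ) {s t : ℂ}
    (ht : t = s + (Real.pi / n : ℝ) * Complex.I ∨ t = s - (Real.pi / n : ℝ) * Complex.I)
    (h1 : Complex.cosh s + (Real.cos (Real.pi / n) : ℝ) ≠ 0)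
    (h2 : Complex.cosh t + (Real.cos 0 : ℝ) ≠ 0) :
    OnKernel n (cay (Real.pi / n) s) (cay 0 t) := by
  have hsq : (Real.sin (Real.pi / n) : ℂ) ^ 2 + (Real.cos (Real.pi / n) : ℂ) ^ 2 = 1 := by
    exact_mod_cast Real.sin_sq_add_cos_sq (Real.pi / n)
  have hC := Complex.cosh_sq s
  have hct : Complex.cosh t = Complex.cosh s * (Real.cos (Real.pi / n) : ℝ) +
      Complex.sinh s * (Real.sin (Real.pi / n) : ℝ) * Complex.I ∨
      Complex.cosh t = Complex.cosh s * (Real.cos (Real.pi / n) : ℝ) -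
      Complex.sinh s * (Real.sin (Real.pi / n) : ℝ) * Complex.I := by
    rcases ht with rfl | rfl
    · left
      rw [Complex.cosh_add, Complex.cosh_mul_I, Complex.sinh_mul_I, ← Complex.ofReal_cos,
        ← Complex.ofReal_sin]
      ring
    · right
      rw [Complex.cosh_sub, Complex.cosh_mul_I, Complex.sinh_mul_I, ← Complex.ofReal_cos,
        ← Complex.ofReal_sin]
      ring
  unfold OnKernel cay
  rw [Real.cos_zero] at h2 ⊢
  have hD : (Complex.cosh t - Complex.cosh s * (Real.cos (Real.pi / n) : ℝ)) ^ 2 =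
      -((Complex.cosh s ^ 2 - 1) * (1 - (Real.cos (Real.pi / n) : ℝ) ^ 2)) := by
    rw [hC, ← hsq]
    rcases hct with h | h <;> rw [h] <;>
    linear_combination (Complex.sinh s ^ 2 * (Real.sin (Real.pi / n) : ℂ) ^ 2) * Complex.I_sq
  have hs2 : (Real.sin (Real.pi / n) : ℂ) ^ 2 = 1 - (Real.cos (Real.pi / n) : ℂ) ^ 2 := by
    linear_combination hsq
  rw [hs2]
  generalize Complex.cosh s = C at *
  generalize Complex.cosh t = D at *
  generalize ((Real.cos (Real.pi / n) : ℝ) : ℂ) = c at *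
  push_cast at *
  field_simp
  linear_combination (4 * c ^ 2) * hD

lemma OnKernel.harmonic {X Y : ℂ} (h : OnKernel n X Y) (i j : ℕ) :
    (Real.sin (Real.pi / n) : ℂ) ^ 2 / 2 * (X ^ (i + 2) * Y ^ (j + 1) + X ^ i * Y ^ (j + 1)) +
      (Real.cos (Real.pi / n) : ℂ) ^ 2 / 2 * (X ^ (i + 2) * Y ^ j + X ^ i * Y ^ (j + 2)) =
      X ^ (i + 1) * Y ^ (j + 1) := by
  unfold OnKernel at h
  linear_combination X ^ i * Y ^ j * h

lemma rot_denom_ne_zero (hn : 3 ≤ n) (hα : 0 ≤ α) (hα' : α ≤ Real.pi / n) {m : ℕ} (hm : m ≤ n)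
    (a : ℝ) : Complex.cosh (a + height * Complex.I - (m * (Real.pi / n) : ℝ) * Complex.I) +
      (Real.cos α : ℝ) ≠ 0 := by
  have h := abs_height_sub_lt hn hm
  rw [abs_lt] at h
  refine (coshBelow_add_strip (γ := α) (lo := height - m * (Real.pi / n))
    (hi := height - m * (Real.pi / n)) hα (by linarith) (by linarith)).ne_zero ?_
  simp

lemma onKernel_rot (hn : 3 ≤ n) {k l : ℕ} (hk : k ≤ n) (hl : l ≤ n) (hkl : k = l + 1 ∨ l = k + 1)
    (a : ℝ) : OnKernel n (rot n (Real.pi / n) k (a + height * Complex.I))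
      (rot n 0 l (a + height * Complex.I)) := by
  refine onKernel_cay n ?_ (rot_denom_ne_zero hn (pi_div_pos hn).le le_rfl hk a)
    (rot_denom_ne_zero hn le_rfl (pi_div_pos hn).le hl a)
  rcases hkl with rfl | rfl
  · left; push_cast; ring
  · right; push_cast; ring

lemma orbitSum_harmonic (hn : 3 ≤ n) (i j : ℕ) (a : ℝ) :
    (Real.sin (Real.pi / n) : ℂ) ^ 2 / 2 *
      (orbitSum n (Real.pi / n) 0 (i + 2) (j + 1) (a + height * Complex.I) +
        orbitSum n (Real.pi / n) 0 i (j + 1) (a + height * Complex.I)) +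
    (Real.cos (Real.pi / n) : ℂ) ^ 2 / 2 *
      (orbitSum n (Real.pi / n) 0 (i + 2) j (a + height * Complex.I) +
        orbitSum n (Real.pi / n) 0 i (j + 2) (a + height * Complex.I)) =
      orbitSum n (Real.pi / n) 0 (i + 1) (j + 1) (a + height * Complex.I) := by
  unfold orbitSum
  rw [← Finset.sum_congr rfl fun k hk => (onKernel_rot hn (k := 2 * k + 2) (l := 2 * k + 1)
      (by rw [Finset.mem_range] at hk; omega) (by rw [Finset.mem_range] at hk; omega)
      (by omega) a).harmonic i j,
    ← Finset.sum_congr rfl fun k hk => (onKernel_rot hn (k := 2 * k) (l := 2 * k + 1)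
      (by rw [Finset.mem_range] at hk; omega) (by rw [Finset.mem_range] at hk; omega)
      (by omega) a).harmonic i j]
  simp only [Finset.sum_add_distrib, ← Finset.mul_sum]
  ring

lemma orbitSum_harmonic' (hn : 3 ≤ n) (i j : ℕ) (a : ℝ) :
    (Real.sin (Real.pi / n) : ℂ) ^ 2 / 2 *
      (orbitSum n 0 (Real.pi / n) (j + 1) (i + 2) (a + height * Complex.I) +
        orbitSum n 0 (Real.pi / n) (j + 1) i (a + height * Complex.I)) +
    (Real.cos (Real.pi / n) : ℂ) ^ 2 / 2 *
      (orbitSum n 0 (Real.pi / n) j (i + 2) (a + height * Complex.I) +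
        orbitSum n 0 (Real.pi / n) (j + 2) i (a + height * Complex.I)) =
      orbitSum n 0 (Real.pi / n) (j + 1) (i + 1) (a + height * Complex.I) := by
  unfold orbitSum
  simp only [mul_comm (rot n 0 _ _ ^ _)]
  rw [← Finset.sum_congr rfl fun k hk => (onKernel_rot hn (k := 2 * k + 1) (l := 2 * k + 2)
      (by rw [Finset.mem_range] at hk; omega) (by rw [Finset.mem_range] at hk; omega)
      (by omega) a).harmonic i j,
    ← Finset.sum_congr rfl fun k hk => (onKernel_rot hn (k := 2 * k + 1) (l := 2 * k)
      (by rw [Finset.mem_range] at hk; omega) (by rw [Finset.mem_range] at hk; omega)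
      (by omega) a).harmonic i j]
  simp only [Finset.sum_add_distrib, ← Finset.mul_sum]
  ring

/-- The bounded harmonic function with boundary values the indicator function of `(m + 1, 0)`. The
integral is in fact real; taking the real part avoids having to show it. -/
def solX (n m : ℕ) (z : ℕ × ℕ) : ℝ := (exitInt n (Real.pi / n) 0 m z.1 z.2).re

/-- The bounded harmonic function with boundary values the indicator function of `(0, m + 1)`: the
roles of the two coordinates, and of their angles, are exchanged. -/
def solY (n m : ℕ) (z : ℕ × ℕ) : ℝ := (exitInt n 0 (Real.pi / n) m z.2 z.1).re

/-- A function which is a linear functional of the sequence of functions `Φ` inherits its linear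
relations. -/
lemma integral_five_term {F₁ F₂ F₃ F₄ F₅ W : ℝ → ℂ} {s c : ℂ}
    (h : ∀ a, s * (F₁ a + F₂ a) + c * (F₃ a + F₄ a) = F₅ a)
    (h₁ : Integrable fun a => F₁ a * W a) (h₂ : Integrable fun a => F₂ a * W a)
    (h₃ : Integrable fun a => F₃ a * W a) (h₄ : Integrable fun a => F₄ a * W a) :
    s * ((∫ a, F₁ a * W a) + ∫ a, F₂ a * W a) + c * ((∫ a, F₃ a * W a) + ∫ a, F₄ a * W a) =
      ∫ a, F₅ a * W a := by
  have e := integral_add (f := fun a => s * (F₁ a * W a + F₂ a * W a))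
    (g := fun a => c * (F₃ a * W a + F₄ a * W a)) ((h₁.add h₂).const_mul s)
    ((h₃.add h₄).const_mul c)
  rw [← integral_add h₁ h₂, ← integral_add h₃ h₄, ← integral_const_mul, ← integral_const_mul, ← e]
  refine integral_congr_ae (Eventually.of_forall fun a => ?_)
  simp only [← h a]
  ring

lemma re_five_term {s c : ℝ} {E₁ E₂ E₃ E₄ E₅ : ℂ}
    (h : (s : ℂ) ^ 2 / 2 * (E₁ + E₂) + (c : ℂ) ^ 2 / 2 * (E₃ + E₄) = E₅) :
    s ^ 2 / 2 * (E₁.re + E₂.re) + c ^ 2 / 2 * (E₃.re + E₄.re) = E₅.re := by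
  have h1 : ((s ^ 2 / 2 : ℝ) : ℂ) * (E₁ + E₂) + ((c ^ 2 / 2 : ℝ) : ℂ) * (E₃ + E₄) = E₅ := by
    push_cast; exact h
  have := congrArg Complex.re h1
  rwa [Complex.add_re, Complex.re_ofReal_mul, Complex.re_ofReal_mul, Complex.add_re,
    Complex.add_re] at this

lemma step_solX (hn : 3 ≤ n) (m : ℕ) : step n (solX n m) = solX n m := by
  funext ⟨i, j⟩
  unfold step
  split_ifs with h
  · obtain ⟨i, rfl⟩ := Nat.exists_eq_succ_of_ne_zero h.1.ne'
    obtain ⟨j, rfl⟩ := Nat.exists_eq_succ_of_ne_zero h.2.ne'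
    simp only [Nat.succ_eq_add_one, Nat.add_sub_cancel, solX]
    refine re_five_term ?_
    have hI := fun p q => integrable_orbitSum_mul hn (pi_div_pos hn).le le_rfl le_rfl
      (pi_div_pos hn).le m p q
    have := integral_five_term (orbitSum_harmonic hn i j) (hI _ _) (hI _ _) (hI _ _) (hI _ _)
    unfold exitInt
    rw [← this]
    ring
  · rfl

lemma step_solY (hn : 3 ≤ n) (m : ℕ) : step n (solY n m) = solY n m := by
  funext ⟨i, j⟩
  unfold step
  split_ifs with h
  · obtain ⟨i, rfl⟩ := Nat.exists_eq_succ_of_ne_zero h.1.ne'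
    obtain ⟨j, rfl⟩ := Nat.exists_eq_succ_of_ne_zero h.2.ne'
    simp only [Nat.succ_eq_add_one, Nat.add_sub_cancel, solY]
    refine re_five_term ?_
    have hI := fun p q => integrable_orbitSum_mul hn le_rfl (pi_div_pos hn).le
      (pi_div_pos hn).le le_rfl m p q
    have := integral_five_term (orbitSum_harmonic' hn i j) (hI _ _) (hI _ _) (hI _ _) (hI _ _)
    unfold exitInt
    rw [← this]
    ring
  · rfl

lemma solX_boundary (hn : 3 ≤ n) (m : ℕ) (z : ℕ × ℕ) (hz : z.1 = 0 ∨ z.2 = 0) :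
    solX n m z = pointMass (m + 1, 0) z := by
  obtain ⟨i, j⟩ := z
  have h0 := (pi_div_pos hn).le
  unfold solX pointMass
  rcases Nat.eq_zero_or_pos j with rfl | hj
  · simp only [exitInt_zero_right hn h0 le_rfl, Prod.mk.injEq, and_true]
    split_ifs <;> simp
  · obtain rfl : i = 0 := by simp only at hz; omega
    simp only [exitInt_zero_left hn h0 le_rfl le_rfl h0, Prod.mk.injEq]
    rw [if_neg (by omega)]
    simp

lemma solY_boundary (hn : 3 ≤ n) (m : ℕ) (z : ℕ × ℕ) (hz : z.1 = 0 ∨ z.2 = 0) :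
    solY n m z = pointMass (0, m + 1) z := by
  obtain ⟨i, j⟩ := z
  have h0 := (pi_div_pos hn).le
  unfold solY pointMass
  rcases Nat.eq_zero_or_pos i with rfl | hi
  · simp only [exitInt_zero_right hn le_rfl h0, Prod.mk.injEq, true_and]
    split_ifs <;> simp
  · obtain rfl : j = 0 := by simp only at hz; omega
    simp only [exitInt_zero_left hn le_rfl h0 h0 le_rfl, Prod.mk.injEq]
    rw [if_neg (by omega)]
    simp

lemma exists_abs_solX_le (hn : 3 ≤ n) (m : ℕ) : ∃ C, ∀ z, |solX n m z| ≤ C := by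
  obtain ⟨C, hC⟩ := exists_norm_exitInt_le hn (pi_div_pos hn).le le_rfl le_rfl (pi_div_pos hn).le m
  exact ⟨C, fun z => (Complex.abs_re_le_norm _).trans (hC _ _)⟩

lemma exists_abs_solY_le (hn : 3 ≤ n) (m : ℕ) : ∃ C, ∀ z, |solY n m z| ≤ C := by
  obtain ⟨C, hC⟩ := exists_norm_exitInt_le hn le_rfl (pi_div_pos hn).le (pi_div_pos hn).le le_rfl m
  exact ⟨C, fun z => (Complex.abs_re_le_norm _).trans (hC _ _)⟩

lemma solX_nonneg (hn : 3 ≤ n) (m : ℕ) (z : ℕ × ℕ) : 0 ≤ solX n m z := by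
  obtain ⟨C, hC⟩ := exists_abs_solX_le hn m
  refine ge_of_tendsto' (tendsto_iterate_step_pointMass hn (Or.inr rfl) hC (step_solX hn m)
    (solX_boundary hn m) z) fun k => iterate_step_nonneg n k (fun w => ?_) z
  unfold pointMass
  split_ifs <;> simp

end

/-! ### Laplace asymptotics -/

lemma integral_pow_mul_exp_neg (n : ℕ) {κ : ℝ} (hκ : 0 < κ) :
    ∫ t in Set.Ioi (0 : ℝ), t ^ n * Real.exp (-(κ * t)) = n.factorial / κ ^ (n + 1) := by
  have h := Real.integral_rpow_mul_exp_neg_mul_Ioi (a := (n : ℝ) + 1) (by positivity) hκ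
  rw [Real.Gamma_nat_eq_factorial] at h
  simp only [add_sub_cancel_right, Real.rpow_natCast] at h
  rw [h, one_div, Real.inv_rpow hκ.le]
  rw [show ((n : ℝ) + 1) = ((n + 1 : ℕ) : ℝ) by push_cast; rfl, Real.rpow_natCast]
  field_simp

lemma integrableOn_pow_mul_exp_neg (n : ℕ) {κ : ℝ} (hκ : 0 < κ) :
    IntegrableOn (fun t : ℝ => t ^ n * Real.exp (-(κ * t))) (Set.Ioi 0) := by
  -- The integral of a function which is not integrable would be zero.
  by_contra h
  have h1 := integral_undef h
  rw [integral_pow_mul_exp_neg n hκ] at h1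
  have : (0 : ℝ) < n.factorial / κ ^ (n + 1) := by positivity
  exact this.ne' h1

/-- Watson's lemma for `∫ g β ^ M` where `β r = 1 - κ r + o(r)` and `g r ~ L r ^ n`. -/
lemma tendsto_laplace {n : ℕ} {κ κ' ρ C : ℝ} {L : ℂ} {g : ℝ → ℂ} {β : ℝ → ℝ} (hκ : 0 < κ)
    (hκ' : 0 < κ') (hρ : 0 < ρ) (hg : ContinuousOn g (Set.Ioo 0 ρ))
    (hβ : ContinuousOn β (Set.Ioo 0 ρ)) (hgb : ∀ r ∈ Set.Ioo 0 ρ, ‖g r‖ ≤ C * r ^ n)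
    (hβb : ∀ r ∈ Set.Ioo 0 ρ, 0 ≤ β r ∧ β r ≤ Real.exp (-(κ' * r)))
    (hgl : Tendsto (fun r : ℝ => g r / (r : ℂ) ^ n) (nhdsWithin 0 (Set.Ioi 0)) (nhds L))
    (hβl : Tendsto (fun r : ℝ => (β r - 1) / r) (nhdsWithin 0 (Set.Ioi 0)) (nhds (-κ))) :
    Tendsto (fun M : ℕ => (M : ℂ) ^ (n + 1) * ∫ r in Set.Ioo 0 ρ, g r * (β r : ℂ) ^ M) atTop
      (nhds (L * (n.factorial / κ ^ (n + 1) : ℝ))) := by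
  have hdiv : ∀ {t : ℝ}, 0 < t → Tendsto (fun M : ℕ => t / M) atTop (nhdsWithin 0 (Set.Ioi 0)) := by
    intro t ht
    refine tendsto_nhdsWithin_iff.2 ⟨tendsto_const_div_atTop_nhds_zero_nat t, ?_⟩
    filter_upwards [eventually_gt_atTop 0] with M hM
    have : (0 : ℝ) < M := by exact_mod_cast hM
    exact div_pos ht this
  -- Substitute `r = t / M` and apply dominated convergence.
  set F : ℕ → ℝ → ℂ := fun M t => (Set.Ioo 0 ρ).indicator
    (fun r => (M : ℂ) ^ n * (g r * (β r : ℂ) ^ M)) (t / M) with hF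
  have hscale : ∀ᶠ M : ℕ in atTop, ∫ t in Set.Ioi (0 : ℝ), F M t =
      (M : ℂ) ^ (n + 1) * ∫ r in Set.Ioo 0 ρ, g r * (β r : ℂ) ^ M := by
    filter_upwards [eventually_gt_atTop 0] with M hM
    have hM' : (0 : ℝ) < M := by exact_mod_cast hM
    have h1 := integral_comp_mul_left_Ioi ((Set.Ioo 0 ρ).indicator
      (fun r => (M : ℂ) ^ n * (g r * (β r : ℂ) ^ M))) 0 (b := (M : ℝ)⁻¹) (inv_pos.2 hM')
    rw [mul_zero, inv_inv] at h1
    have h2 : ∫ x in Set.Ioi (0 : ℝ), (Set.Ioo 0 ρ).indicator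
        (fun r => (M : ℂ) ^ n * (g r * (β r : ℂ) ^ M)) x =
        ∫ r in Set.Ioo 0 ρ, (M : ℂ) ^ n * (g r * (β r : ℂ) ^ M) := by
      rw [setIntegral_indicator measurableSet_Ioo]
      congr 2
      ext x
      simp only [Set.mem_inter_iff, Set.mem_Ioi, Set.mem_Ioo]
      tauto
    rw [h2, integral_const_mul] at h1
    simp only [hF, div_eq_inv_mul]
    rw [h1, Complex.real_smul, pow_succ]
    push_cast
    ring
  have hlim : Tendsto (fun M : ℕ => ∫ t in Set.Ioi (0 : ℝ), F M t) atTop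
      (nhds (∫ t in Set.Ioi (0 : ℝ), L * ((t ^ n * Real.exp (-(κ * t)) : ℝ) : ℂ))) := by
    refine tendsto_integral_of_dominated_convergence (fun t => C * (t ^ n * Real.exp (-(κ' * t))))
      (fun M => ?_) ((integrableOn_pow_mul_exp_neg n hκ').const_mul C) (fun M => ?_) ?_
    · refine AEStronglyMeasurable.restrict ?_
      have hm : Measurable ((Set.Ioo 0 ρ).indicator
          (fun r => (M : ℂ) ^ n * (g r * (β r : ℂ) ^ M))) := by
        classical
        rw [← Set.piecewise_eq_indicator]
        refine ContinuousOn.measurable_piecewise ?_ continuousOn_const measurableSet_Ioo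
        exact continuousOn_const.mul (hg.mul
          ((Complex.continuous_ofReal.comp_continuousOn hβ).pow M))
      exact (hm.comp (measurable_id.div_const _)).aestronglyMeasurable
    · refine (ae_restrict_iff' measurableSet_Ioi).2 (Eventually.of_forall fun t ht => ?_)
      have ht : 0 < t := ht
      simp only [hF]
      by_cases hmem : t / M ∈ Set.Ioo 0 ρ
      · have hM' : (M : ℝ) ≠ 0 := fun h => by simp [h] at hmem
        have hM : 0 < (M : ℝ) := lt_of_le_of_ne (Nat.cast_nonneg M) hM'.symm
        rw [Set.indicator_of_mem hmem, norm_mul, norm_mul, norm_pow, norm_pow, Complex.norm_natCast,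
          Complex.norm_real, Real.norm_eq_abs, abs_of_nonneg (hβb _ hmem).1]
        calc (M : ℝ) ^ n * (‖g (t / M)‖ * β (t / M) ^ M)
            ≤ (M : ℝ) ^ n * (C * (t / M) ^ n * Real.exp (-(κ' * (t / M))) ^ M) := by
              have h1 := hgb _ hmem
              have h2 := hβb _ hmem
              have h3 := (norm_nonneg _).trans h1
              exact mul_le_mul_of_nonneg_left (mul_le_mul h1 (pow_le_pow_left₀ h2.1 h2.2 M)
                (pow_nonneg h2.1 M) h3) (by positivity)
          _ = C * (t ^ n * Real.exp (-(κ' * t))) := by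
              rw [← Real.exp_nat_mul, div_pow]
              have : (M : ℝ) * -(κ' * (t / M)) = -(κ' * t) := by field_simp
              rw [this]
              field_simp
      · rw [Set.indicator_of_notMem hmem, norm_zero]
        have hC : 0 ≤ C := by
          have hmid : ρ / 2 ∈ Set.Ioo 0 ρ := ⟨by linarith, by linarith⟩
          have h1 := (norm_nonneg _).trans (hgb _ hmid)
          exact nonneg_of_mul_nonneg_left h1 (by positivity)
        positivity
    · refine (ae_restrict_iff' measurableSet_Ioi).2 (Eventually.of_forall fun t ht => ?_)
      have ht : 0 < t := ht
      have h1 := (hgl.comp (hdiv ht)).mul_const ((t : ℂ) ^ n)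
      have h2 : Tendsto (fun M : ℕ => (1 + (β (t / M) - 1)) ^ M) atTop
          (nhds (Real.exp (-(κ * t)))) := by
        refine Real.tendsto_one_add_pow_exp_of_tendsto ?_
        have h3 := (hβl.comp (hdiv ht)).mul_const t
        rw [neg_mul] at h3
        refine h3.congr' ?_
        filter_upwards [eventually_gt_atTop 0] with M hM
        have hM' : (0 : ℝ) < M := by exact_mod_cast hM
        simp only [Function.comp_apply]
        field_simp
      have h4 := h1.mul ((Complex.continuous_ofReal.tendsto _).comp h2)
      have h5 : L * ((t ^ n * Real.exp (-(κ * t)) : ℝ) : ℂ) =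
          L * (t : ℂ) ^ n * ((Real.exp (-(κ * t)) : ℝ) : ℂ) := by push_cast; ring
      rw [h5]
      refine h4.congr' ?_
      have hev := (hdiv ht).eventually (Ioo_mem_nhdsGT hρ)
      filter_upwards [eventually_gt_atTop 0, hev] with M hM hmem'
      have hmem : t / (M : ℝ) ∈ Set.Ioo 0 ρ := hmem'
      have hM' : (M : ℂ) ≠ 0 := by exact_mod_cast hM.ne'
      have ht' : (t : ℂ) ≠ 0 := by exact_mod_cast ht.ne'
      simp only [hF, Function.comp_apply]
      rw [Set.indicator_of_mem hmem]
      push_cast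
      rw [add_sub_cancel, div_pow]
      field_simp
  have hval : ∫ t in Set.Ioi (0 : ℝ), L * ((t ^ n * Real.exp (-(κ * t)) : ℝ) : ℂ) =
      L * (n.factorial / κ ^ (n + 1) : ℝ) := by
    rw [integral_const_mul, ← integral_pow_mul_exp_neg n hκ]
    exact congrArg _ integral_ofReal
  rw [← hval]
  exact hlim.congr' hscale

/-- Parts of the contour on which `cosh s` has negative real part, so that `|cay α s| > 1`, contribute
an exponentially small amount. -/
lemma tendsto_integral_path {α : ℝ} (hα : 0 < Real.cos α) {Φ : ℂ → ℂ} {γ : ℝ → ℂ} {x y : ℝ}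
    (hγ : Continuous γ) (hΦ : ContinuousOn (fun t => Φ (γ t)) (Set.uIcc x y))
    (hneg : ∀ t ∈ Set.uIcc x y, (Complex.cosh (γ t)).re < 0) (k : ℕ) :
    Tendsto (fun m : ℕ => ((m + 1 : ℕ) : ℂ) ^ k * ∫ t in x..y, Φ (γ t) * cayForm α m (γ t)) atTop
      (nhds 0) := by
  have hne : ∀ t ∈ Set.uIcc x y, Complex.cosh (γ t) - (Real.cos α : ℝ) ≠ 0 := by
    intro t ht h
    have h1 := congrArg Complex.re h
    rw [Complex.sub_re, Complex.ofReal_re, Complex.zero_re] at h1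
    linarith [hneg t ht]
  have hcosh : Continuous fun t => Complex.cosh (γ t) := Complex.continuous_cosh.comp hγ
  have hsinh : Continuous fun t => Complex.sinh (γ t) := Complex.continuous_sinh.comp hγ
  have hB : ContinuousOn (fun t => ‖(Complex.cosh (γ t) + (Real.cos α : ℝ)) /
      (Complex.cosh (γ t) - (Real.cos α : ℝ))‖) (Set.uIcc x y) :=
    (ContinuousOn.div (hcosh.add continuous_const).continuousOn
      (hcosh.sub continuous_const).continuousOn hne).norm
  have hD : ContinuousOn (fun t => ‖Φ (γ t) * (2 * (Real.cos α : ℝ) * Complex.sinh (γ t) /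
      (Complex.cosh (γ t) - (Real.cos α : ℝ)) ^ 2)‖) (Set.uIcc x y) :=
    (hΦ.mul (ContinuousOn.div (continuous_const.mul hsinh).continuousOn
      ((hcosh.sub continuous_const).pow 2).continuousOn fun t ht => pow_ne_zero 2 (hne t ht))).norm
  obtain ⟨t₁, ht₁, hmax₁⟩ := isCompact_uIcc.exists_isMaxOn Set.nonempty_uIcc hB
  obtain ⟨t₂, ht₂, hmax₂⟩ := isCompact_uIcc.exists_isMaxOn Set.nonempty_uIcc hD
  set b := ‖(Complex.cosh (γ t₁) + (Real.cos α : ℝ)) / (Complex.cosh (γ t₁) - (Real.cos α : ℝ))‖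
    with hb
  set d := ‖Φ (γ t₂) * (2 * (Real.cos α : ℝ) * Complex.sinh (γ t₂) /
      (Complex.cosh (γ t₂) - (Real.cos α : ℝ)) ^ 2)‖ with hd
  have hb0 : 0 ≤ b := norm_nonneg _
  have hb1 : b < 1 := by
    rw [hb, norm_div, div_lt_one (norm_pos_iff.2 (hne t₁ ht₁))]
    refine lt_of_pow_lt_pow_left₀ 2 (norm_nonneg _) ?_
    have h := hneg t₁ ht₁
    rw [← Complex.normSq_eq_norm_sq, ← Complex.normSq_eq_norm_sq, Complex.normSq_apply,
      Complex.normSq_apply, Complex.sub_re, Complex.add_re, Complex.sub_im, Complex.add_im,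
      Complex.ofReal_re, Complex.ofReal_im]
    nlinarith [mul_pos_of_neg_of_neg h (neg_lt_zero.2 hα)]
  have hbound : ∀ m : ℕ, ‖∫ t in x..y, Φ (γ t) * cayForm α m (γ t)‖ ≤ d * b ^ m * |y - x| := by
    intro m
    refine intervalIntegral.norm_integral_le_of_norm_le_const fun t ht => ?_
    have ht' := Set.uIoc_subset_uIcc ht
    have e : Φ (γ t) * cayForm α m (γ t) = Φ (γ t) * (2 * (Real.cos α : ℝ) * Complex.sinh (γ t) /
        (Complex.cosh (γ t) - (Real.cos α : ℝ)) ^ 2) *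
        ((Complex.cosh (γ t) + (Real.cos α : ℝ)) / (Complex.cosh (γ t) - (Real.cos α : ℝ))) ^ m := by
      have := hne t ht'
      unfold cayForm
      rw [div_pow]
      field_simp
      ring
    rw [e, norm_mul, norm_pow]
    exact mul_le_mul (hmax₂ ht') (pow_le_pow_left₀ (norm_nonneg _) (hmax₁ ht') m)
      (by positivity) (norm_nonneg _)
  have hlim : Tendsto (fun m : ℕ => ((m + 1 : ℕ) : ℝ) ^ k * (d * b ^ m * |y - x|)) atTop
      (nhds 0) := by
    rcases hb0.eq_or_lt with h0 | h0
    · refine tendsto_const_nhds.congr' ?_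
      filter_upwards [eventually_gt_atTop 0] with m hm
      rw [← h0, zero_pow hm.ne']
      ring
    · have h1 := ((tendsto_pow_const_mul_const_pow_of_lt_one k hb0 hb1).comp
        (tendsto_add_atTop_nat 1)).const_mul (b⁻¹ * d * |y - x|)
      rw [mul_zero] at h1
      refine h1.congr fun m => ?_
      simp only [Function.comp_apply, pow_succ]
      field_simp
  refine squeeze_zero_norm (fun m => ?_) hlim
  rw [norm_mul, norm_pow, Complex.norm_natCast]
  gcongr
  exact hbound m

/-! ### Asymptotics of the contour integral -/

section

variable {n : ℕ} {α β : ℝ}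

lemma bddHol_orbitSum_tail (n : ℕ) (α β : ℝ) (p q : ℕ) {R : ℝ} (hR : 0 < R) :
    BddHol {s | R ≤ |s.re|} (orbitSum n α β p q) := by
  have hr : ∀ (γ : ℝ) (m : ℕ), BddHol {s | R ≤ |s.re|} (rot n γ m) := fun γ m =>
    (bddHol_cay (coshBelow_add_tail (γ := γ) hR)).shift _ fun s hs => by simpa using hs
  exact BddHol.sub (BddHol.sum fun k _ => ((hr α _).pow p).mul ((hr β _).pow q))
    (BddHol.sum fun l _ => ((hr α _).pow p).mul ((hr β _).pow q))

/-- The difference of the values of the orbit sum at the points `z = -r` and `z = -1 / r` of the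
negative real axis, where `z = exp s`. -/
def foldSum (n : ℕ) (α β : ℝ) (p q : ℕ) (r : ℝ) : ℂ :=
  orbitSum n α β p q (Real.log r + Real.pi * Complex.I) -
    orbitSum n α β p q ((-Real.log r : ℝ) + Real.pi * Complex.I)

lemma cayForm_neg_line (α : ℝ) (m : ℕ) (a : ℝ) :
    cayForm α m ((-a : ℝ) + Real.pi * Complex.I) = -cayForm α m (a + Real.pi * Complex.I) := by
  simp only [cayForm, Complex.cosh_add, Complex.sinh_add, Complex.cosh_mul_I,
    Complex.sinh_mul_I, Complex.cos_pi, Complex.sin_pi, Complex.ofReal_neg, Complex.cosh_neg,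
    Complex.sinh_neg]
  ring

/-- The form `cayForm` on the negative real axis of the coordinate `exp s`, at `-r = -exp a`. -/
lemma cayForm_line (hα : 0 < Real.cos α) (m : ℕ) {a : ℝ} (ha : a < 0) :
    cayForm α m (a + Real.pi * Complex.I) = Real.exp a *
      (((4 * Real.cos α * (1 - Real.exp a ^ 2) /
        ((1 - 2 * Real.cos α * Real.exp a + Real.exp a ^ 2) *
          (1 + 2 * Real.cos α * Real.exp a + Real.exp a ^ 2)) : ℝ) : ℂ) *
        (((1 - 2 * Real.cos α * Real.exp a + Real.exp a ^ 2) /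
          (1 + 2 * Real.cos α * Real.exp a + Real.exp a ^ 2) : ℝ) : ℂ) ^ (m + 1)) := by
  have hc1 := Real.cos_le_one α
  have hr := Real.exp_pos a
  have hr1 : Real.exp a < 1 := by
    rw [← Real.exp_zero]; exact Real.exp_lt_exp.2 ha
  have hcosh : Complex.cosh (a + Real.pi * Complex.I) =
      ((-((1 + Real.exp a ^ 2) / (2 * Real.exp a)) : ℝ) : ℂ) := by
    rw [Complex.cosh_add, Complex.cosh_mul_I, Complex.sinh_mul_I, Complex.cos_pi, Complex.sin_pi,
      ← Complex.ofReal_cosh, Real.cosh_eq, Real.exp_neg]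
    push_cast
    have : (Complex.exp a) ≠ 0 := Complex.exp_ne_zero _
    field_simp
    ring
  have hsinh : Complex.sinh (a + Real.pi * Complex.I) =
      (((1 - Real.exp a ^ 2) / (2 * Real.exp a) : ℝ) : ℂ) := by
    rw [Complex.sinh_add, Complex.cosh_mul_I, Complex.sinh_mul_I, Complex.cos_pi, Complex.sin_pi,
      ← Complex.ofReal_sinh, Real.sinh_eq, Real.exp_neg]
    push_cast
    have : (Complex.exp a) ≠ 0 := Complex.exp_ne_zero _
    field_simp
    ring
  rw [cayForm, hcosh, hsinh]
  norm_cast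
  set r := Real.exp a
  set c := Real.cos α
  have hP : 0 < 1 - 2 * c * r + r ^ 2 := by nlinarith [sq_nonneg (1 - r)]
  have hQ : 0 < 1 + 2 * c * r + r ^ 2 := by positivity
  have e1 : -((1 + r ^ 2) / (2 * r)) + c = -(1 - 2 * c * r + r ^ 2) / (2 * r) := by
    field_simp; ring
  have e2 : -((1 + r ^ 2) / (2 * r)) - c = -(1 + 2 * c * r + r ^ 2) / (2 * r) := by
    field_simp; ring
  rw [e1, e2]
  generalize 1 - 2 * c * r + r ^ 2 = u at *
  generalize 1 + 2 * c * r + r ^ 2 = v at *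
  have hsign : (-v) ^ (m + 2) = (-1) ^ m * v ^ (m + 2) := by
    rw [neg_pow, pow_add (-1 : ℝ) m 2]; norm_num
  have hsign' : (-u) ^ m = (-1) ^ m * u ^ m := neg_pow u m
  rw [div_pow, div_pow, div_pow, hsign, hsign']
  have : ((-1 : ℝ)) ^ m ≠ 0 := pow_ne_zero _ (by norm_num)
  field_simp
  ring

/-- The two tails of the line `Im s = π` are folded onto each other by `s ↦ 2 π i - s`, under which
`cayForm` is odd. -/
lemma integral_tails (hα : 0 < Real.cos α) (m p q : ℕ) {R : ℝ} (hR : 0 < R) :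
    (∫ a in Set.Iic (-R), orbitSum n α β p q (a + Real.pi * Complex.I) *
        cayForm α m (a + Real.pi * Complex.I)) +
      (∫ a in Set.Ioi R, orbitSum n α β p q (a + Real.pi * Complex.I) *
        cayForm α m (a + Real.pi * Complex.I)) =
      ∫ r in Set.Ioo 0 (Real.exp (-R)), foldSum n α β p q r *
        ((4 * Real.cos α * (1 - r ^ 2) / ((1 - 2 * Real.cos α * r + r ^ 2) *
          (1 + 2 * Real.cos α * r + r ^ 2)) : ℝ) : ℂ) *
        (((1 - 2 * Real.cos α * r + r ^ 2) / (1 + 2 * Real.cos α * r + r ^ 2) : ℝ) : ℂ) ^ (m + 1) := by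
  have hD : DecHol {s | R ≤ |s.re|} (fun s => orbitSum n α β p q s * cayForm α m s) :=
    (bddHol_orbitSum_tail n α β p q hR).mul_decHol (decHol_cayForm (coshBelow_tail hR) m)
  have h1 := hD.integrableOn (A := Set.Iic (-R)) measurableSet_Iic (x := Real.pi) fun a ha => by
    have ha : a ≤ -R := ha
    simpa using le_abs.2 (Or.inr (by linarith : R ≤ -a))
  have h2 := hD.integrableOn (A := Set.Ioi R) measurableSet_Ioi (x := Real.pi) fun a ha => by
    have ha : R < a := ha
    simpa using le_abs.2 (Or.inl ha.le)
  have h2' : IntegrableOn (fun a : ℝ => orbitSum n α β p q ((-a : ℝ) + Real.pi * Complex.I) *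
      cayForm α m ((-a : ℝ) + Real.pi * Complex.I)) (Set.Iic (-R)) := by
    have := hD.integrableOn (A := Set.Ici (- -R)) measurableSet_Ici (x := Real.pi) fun a ha => by
      have ha : - -R ≤ a := ha
      rw [neg_neg] at ha
      simpa using le_abs.2 (Or.inl ha)
    exact this.comp_neg_Iic
  rw [← neg_neg R, ← integral_comp_neg_Iic (-R) (fun a : ℝ =>
    orbitSum n α β p q (a + Real.pi * Complex.I) * cayForm α m (a + Real.pi * Complex.I)), neg_neg,
    ← integral_add h1 h2', integral_Iic_eq_integral_Iio, ← Real.image_exp_Iio,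
    integral_image_eq_integral_abs_deriv_smul measurableSet_Iio
      (fun x _ => (Real.hasDerivAt_exp x).hasDerivWithinAt) (Real.exp_injective.injOn)]
  refine setIntegral_congr_fun measurableSet_Iio fun a ha => ?_
  have ha : a < -R := ha
  rw [cayForm_neg_line, cayForm_line hα m (by linarith : a < 0), foldSum, Real.log_exp,
    abs_of_pos (Real.exp_pos a), Complex.real_smul]
  ring

/-- The asymptotics of the contour integral are governed by the behaviour of the orbit sum at the
two ends of the negative real axis. -/
theorem tendsto_exitInt (hn : 3 ≤ n) (hα : 0 ≤ α) (hα' : α ≤ Real.pi / n) (hβ : 0 ≤ β)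
    (hβ' : β ≤ Real.pi / n) (p q : ℕ) {L : ℂ}
    (hL : Tendsto (fun r : ℝ => foldSum n α β p q r / (r : ℂ) ^ n) (nhdsWithin 0 (Set.Ioi 0))
      (nhds L)) :
    Tendsto (fun m : ℕ => ((m + 1 : ℕ) : ℂ) ^ (n + 1) * exitInt n α β m p q) atTop
      (nhds (L * (n.factorial / (4 * Real.cos α) ^ n : ℝ) / (2 * Real.pi * Complex.I))) := by
  have hθ := pi_div_le hn
  have hθ0 := pi_div_pos hn
  have hpi := Real.pi_pos
  have hc : 0 < Real.cos α := Real.cos_pos_of_mem_Ioo ⟨by linarith, by linarith⟩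
  have hc1 := Real.cos_le_one α
  obtain ⟨R, hR, hbd⟩ : ∃ R : ℝ, 0 < R ∧ ∀ r ∈ Set.Ioo 0 (Real.exp (-R)),
      ‖foldSum n α β p q r‖ ≤ (‖L‖ + 1) * r ^ n := by
    have h1 : ∀ᶠ r : ℝ in nhdsWithin 0 (Set.Ioi 0), ‖foldSum n α β p q r / (r : ℂ) ^ n‖ < ‖L‖ + 1 :=
      hL.norm.eventually (gt_mem_nhds (by linarith))
    obtain ⟨ρ, hρ, hsub⟩ := mem_nhdsGT_iff_exists_Ioo_subset.1 h1
    have hρ : 0 < ρ := hρ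
    refine ⟨max 1 (-Real.log ρ), lt_max_of_lt_left one_pos, fun r hr => ?_⟩
    have hle : Real.exp (-max 1 (-Real.log ρ)) ≤ ρ := by
      rw [← Real.le_log_iff_exp_le hρ]
      linarith [le_max_right 1 (-Real.log ρ)]
    have h2 := hsub ⟨hr.1, hr.2.trans_le hle⟩
    simp only [Set.mem_ofPred_eq, norm_div, norm_pow, Complex.norm_real, Real.norm_eq_abs,
      abs_of_pos hr.1] at h2
    exact ((div_lt_iff₀ (pow_pos hr.1 n)).1 h2).le
  set ρ := Real.exp (-R) with hρdef
  have hρ0 : 0 < ρ := Real.exp_pos _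
  have hρ1 : ρ < 1 := by
    rw [hρdef, ← Real.exp_zero]; exact Real.exp_lt_exp.2 (by linarith)
  set P : ℝ → ℝ := fun r => 1 - 2 * Real.cos α * r + r ^ 2 with hP
  set Q : ℝ → ℝ := fun r => 1 + 2 * Real.cos α * r + r ^ 2 with hQ
  have hPpos : ∀ r ∈ Set.Ioo 0 ρ, 0 < P r := fun r hr => by
    have := hr.1
    have := hr.2
    simp only [hP]
    nlinarith [sq_nonneg (1 - r)]
  have hQpos : ∀ r ∈ Set.Ioo 0 ρ, 0 < Q r := fun r hr => by
    have := hr.1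
    simp only [hQ]
    positivity
  have hPc : Continuous P := by fun_prop
  have hQc : Continuous Q := by fun_prop
  set g : ℝ → ℂ := fun r => foldSum n α β p q r *
    ((4 * Real.cos α * (1 - r ^ 2) / (P r * Q r) : ℝ) : ℂ) with hg
  have hlap := tendsto_laplace (n := n) (κ := 4 * Real.cos α) (κ' := Real.cos α) (ρ := ρ)
    (C := (‖L‖ + 1) * (4 * Real.cos α / (1 - ρ) ^ 2)) (L := L * (4 * Real.cos α : ℝ))
    (g := g) (β := fun r => P r / Q r) (by positivity) hc hρ0
    ?_ ?_ ?_ ?_ ?_ ?_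
  rotate_left
  -- The six conditions of Watson's lemma: continuity, domination and the behaviour at `0`.
  · refine ContinuousOn.mul ?_ ?_
    · have hdiff := (bddHol_orbitSum_tail n α β p q hR).1.continuousOn
      have hlog : ∀ r ∈ Set.Ioo 0 ρ, Real.log r ≤ -R := fun r hr => by
        rw [Real.log_le_iff_le_exp hr.1]; exact hr.2.le
      have hlogc : ContinuousOn (fun r : ℝ => (Real.log r : ℂ)) (Set.Ioo 0 ρ) :=
        Complex.continuous_ofReal.comp_continuousOn
          (Real.continuousOn_log.mono fun r hr => hr.1.ne')
      unfold foldSum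
      refine ContinuousOn.sub (hdiff.comp (hlogc.add continuousOn_const) fun r hr => ?_)
        (hdiff.comp (ContinuousOn.add ?_ continuousOn_const) fun r hr => ?_)
      · have := hlog r hr
        simpa using le_abs.2 (Or.inr (by linarith : R ≤ -Real.log r))
      · push_cast
        exact hlogc.neg
      · have := hlog r hr
        simpa using le_abs.2 (Or.inr (by linarith : R ≤ -Real.log r))
    · refine Complex.continuous_ofReal.comp_continuousOn (ContinuousOn.div (by fun_prop)
        (hPc.mul hQc).continuousOn fun r hr => (mul_pos (hPpos r hr) (hQpos r hr)).ne')
  · exact hPc.continuousOn.div hQc.continuousOn fun r hr => (hQpos r hr).ne'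
  · intro r hr
    have h1 := hbd r hr
    have h0 := hr.1
    have h2 := hr.2
    have hPr : (1 - ρ) ^ 2 ≤ P r := by
      simp only [hP]
      nlinarith
    have hQr : 1 ≤ Q r := by
      simp only [hQ]
      nlinarith [mul_pos hc h0, sq_nonneg r]
    simp only [hg]
    rw [norm_mul, Complex.norm_real, Real.norm_eq_abs, abs_of_nonneg (div_nonneg
      (mul_nonneg (by positivity) (by nlinarith)) (mul_pos (hPpos r hr) (hQpos r hr)).le)]
    have h3 : 4 * Real.cos α * (1 - r ^ 2) / (P r * Q r) ≤ 4 * Real.cos α / (1 - ρ) ^ 2 := by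
      have hρ2 : 0 < (1 - ρ) ^ 2 := pow_pos (by linarith) 2
      refine div_le_div₀ (by positivity) ?_ hρ2 ?_
      · nlinarith [sq_nonneg r]
      · nlinarith
    calc ‖foldSum n α β p q r‖ * (4 * Real.cos α * (1 - r ^ 2) / (P r * Q r))
        ≤ ((‖L‖ + 1) * r ^ n) * (4 * Real.cos α / (1 - ρ) ^ 2) := by
          refine mul_le_mul h1 h3 ?_ (by positivity)
          exact div_nonneg (mul_nonneg (by positivity) (by nlinarith))
            (mul_pos (hPpos r hr) (hQpos r hr)).le
      _ = _ := by ring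
  · intro r hr
    have h0 := hr.1
    have h2 := hr.2
    refine ⟨div_nonneg (hPpos r hr).le (hQpos r hr).le, ?_⟩
    have h3 : P r / Q r ≤ 1 - Real.cos α * r := by
      rw [div_le_iff₀ (hQpos r hr)]
      simp only [hP, hQ]
      nlinarith [mul_pos hc h0, mul_pos (mul_pos hc h0) h0, sq_nonneg r,
        mul_pos (mul_pos (mul_pos hc h0) h0) h0]
    have h4 := Real.one_sub_le_exp_neg (Real.cos α * r)
    linarith
  · have h1 : Tendsto (fun r : ℝ => ((4 * Real.cos α * (1 - r ^ 2) / (P r * Q r) : ℝ) : ℂ))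
        (nhdsWithin 0 (Set.Ioi 0)) (nhds ((4 * Real.cos α : ℝ) : ℂ)) := by
      refine (Complex.continuous_ofReal.tendsto _).comp ?_
      have hct : ContinuousAt (fun r : ℝ => 4 * Real.cos α * (1 - r ^ 2) / (P r * Q r)) 0 := by
        refine ContinuousAt.div (by fun_prop) (hPc.mul hQc).continuousAt ?_
        simp [hP, hQ]
      have := hct.tendsto
      simp only [hP, hQ] at this
      norm_num at this
      exact this.mono_left nhdsWithin_le_nhds
    refine (hL.mul h1).congr fun r => ?_
    simp only [hg]
    ring
  · have h1 : Tendsto (fun r : ℝ => -(4 * Real.cos α) / Q r) (nhdsWithin 0 (Set.Ioi 0))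
        (nhds (-(4 * Real.cos α))) := by
      have hct : ContinuousAt (fun r : ℝ => -(4 * Real.cos α) / Q r) 0 := by
        refine ContinuousAt.div (by fun_prop) hQc.continuousAt ?_
        simp [hQ]
      have := hct.tendsto
      simp only [hQ] at this
      norm_num at this
      refine (this.mono_left nhdsWithin_le_nhds).congr fun r => ?_
      simp only [hQ]
    refine h1.congr' ?_
    filter_upwards [Ioo_mem_nhdsGT hρ0] with r hr
    have := (hQpos r hr).ne'
    have := hr.1.ne'
    field_simp
    simp only [hP, hQ]
    ring
  -- The rest of the contour: the segment at the original height, and two vertical segments which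
  -- join it to the line `Im s = π`.
  have hK1 := tendsto_integral_path (Φ := orbitSum n α β p q) hc (x := -R) (y := R)
    (γ := fun a : ℝ => (a : ℂ) + height * Complex.I) (by fun_prop)
    ((bddHol_orbitSum hn hα hα' hβ hβ' p q (S := {s | s.im = height}) fun s hs => hs).1.continuousOn.comp
      (by fun_prop) fun a _ => by simp)
    (fun t _ => by
      rw [re_cosh]
      refine mul_neg_of_pos_of_neg (Real.cosh_pos _) ?_
      have him : ((t : ℂ) + height * Complex.I).im = height := by simp
      rw [him]
      exact Real.cos_neg_of_pi_div_two_lt_of_lt (by unfold height; linarith)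
        (by unfold height; linarith)) (n + 1)
  have hvert : ∀ b : ℝ, R ≤ |b| → Tendsto (fun m : ℕ => ((m + 1 : ℕ) : ℂ) ^ (n + 1) *
      ∫ t in height..Real.pi, orbitSum n α β p q (b + t * Complex.I) *
        cayForm α m (b + t * Complex.I)) atTop (nhds 0) := by
    intro b hb
    refine tendsto_integral_path (Φ := orbitSum n α β p q) hc
      (γ := fun t : ℝ => (b : ℂ) + t * Complex.I) (by fun_prop)
      ((bddHol_orbitSum_tail n α β p q hR).1.continuousOn.comp (by fun_prop)
        fun a _ => by simpa using hb) (fun t ht => ?_) (n + 1)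
    rw [re_cosh]
    refine mul_neg_of_pos_of_neg (Real.cosh_pos _) ?_
    have him : ((b : ℂ) + t * Complex.I).im = t := by simp
    rw [him]
    rw [Set.uIcc_of_le (by unfold height; linarith)] at ht
    have h1 := ht.1
    have h2 := ht.2
    unfold height at h1
    exact Real.cos_neg_of_pi_div_two_lt_of_lt (by linarith) (by linarith)
  have hK2 := hvert (-R) (by rw [abs_neg, abs_of_pos hR])
  have hK3 := hvert R (by rw [abs_of_pos hR])
  have hsplit : ∀ m : ℕ, exitInt n α β m p q = ((∫ r in Set.Ioo 0 ρ, g r *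
      ((P r / Q r : ℝ) : ℂ) ^ (m + 1)) + (∫ t in (-R)..R, orbitSum n α β p q (t + height * Complex.I) *
        cayForm α m (t + height * Complex.I)) -
      Complex.I * (∫ t in height..Real.pi, orbitSum n α β p q ((-R : ℝ) + t * Complex.I) *
        cayForm α m ((-R : ℝ) + t * Complex.I)) +
      Complex.I * (∫ t in height..Real.pi, orbitSum n α β p q (R + t * Complex.I) *
        cayForm α m (R + t * Complex.I))) / (2 * Real.pi * Complex.I) := by
    intro m
    unfold exitInt
    congr 1
    have hint := integrable_orbitSum_mul hn hα hα' hβ hβ' m p q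
    have hD : DecHol {s | R ≤ |s.re|} (fun s => orbitSum n α β p q s * cayForm α m s) :=
      (bddHol_orbitSum_tail n α β p q hR).mul_decHol (decHol_cayForm (coshBelow_tail hR) m)
    have h1 := (hD.mono (S := {s | s.re ≤ -R ∧ s.im ∈ Set.uIcc height Real.pi})
      fun s hs => show R ≤ |s.re| by
        have : s.re ≤ -R := hs.1
        exact le_abs.2 (Or.inr (by linarith))).integral_Iic_sub
    have h2 := (hD.mono (S := {s | R ≤ s.re ∧ s.im ∈ Set.uIcc height Real.pi})
      fun s hs => show R ≤ |s.re| from le_abs.2 (Or.inl hs.1)).integral_Ioi_sub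
    have h3 := integral_tails (n := n) (β := β) hc m p q hR
    rw [← intervalIntegral.integral_Iic_add_Ioi hint.integrableOn hint.integrableOn (b := R),
      ← intervalIntegral.integral_Iic_sub_Iic hint.integrableOn hint.integrableOn (a := -R)]
    simp only [hg, hP, hQ]
    rw [← h3]
    linear_combination h1 + h2
  have hlap' := hlap.comp (tendsto_add_atTop_nat 1)
  have htot := (((hlap'.add hK1).sub (hK2.const_mul Complex.I)).add
    (hK3.const_mul Complex.I)).div_const (2 * Real.pi * Complex.I)
  have hval : (L * (4 * Real.cos α : ℝ) * (n.factorial / (4 * Real.cos α) ^ (n + 1) : ℝ) + 0 -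
      Complex.I * 0 + Complex.I * 0) / (2 * Real.pi * Complex.I) =
      L * (n.factorial / (4 * Real.cos α) ^ n : ℝ) / (2 * Real.pi * Complex.I) := by
    have : ((4 * Real.cos α : ℝ) : ℂ) ≠ 0 := by
      rw [Complex.ofReal_ne_zero]; positivity
    congr 1
    rw [Complex.ofReal_div, Complex.ofReal_div, Complex.ofReal_pow, Complex.ofReal_pow, pow_succ]
    field_simp
    ring
  rw [hval] at htot
  refine htot.congr fun m => ?_
  rw [hsplit m]
  simp only [Function.comp_apply]
  ring

end

/-! ### Taylor coefficients and roots of unity -/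

section

variable {n : ℕ}

/-- The monomial `x ^ i y ^ j` in the uniformizing coordinate `z`. -/
def unifMonomial (n i j : ℕ) (z : ℂ) : ℂ := unifX n z ^ i * unifY n z ^ j

lemma cay_neg (α : ℝ) (s : ℂ) : cay α (-s) = cay α s := by
  simp [cay, Complex.cosh_neg]

lemma conj_cay (α : ℝ) (s : ℂ) : starRingEnd ℂ (cay α s) = cay α (starRingEnd ℂ s) := by
  simp [cay, Complex.cosh_conj, -Complex.ofReal_cos]

lemma base_eq (n : ℕ) : base n = -Complex.exp (-((Real.pi / n : ℝ) * Complex.I)) := by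
  unfold base; congr 3; push_cast; ring

lemma conj_base (n : ℕ) :
    starRingEnd ℂ (base n) = -Complex.exp ((Real.pi / n : ℝ) * Complex.I) := by
  rw [base_eq, map_neg, ← Complex.exp_conj, map_neg, map_mul, Complex.conj_ofReal, Complex.conj_I]
  congr 2; ring

lemma unifX_exp (n : ℕ) (s : ℂ) : unifX n (Complex.exp s) = cay (Real.pi / n) s := by
  have hc : Complex.exp ((Real.pi / n : ℝ) * Complex.I) +
      Complex.exp (-((Real.pi / n : ℝ) * Complex.I)) = 2 * (Real.cos (Real.pi / n) : ℝ) := by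
    rw [Complex.ofReal_cos, Complex.cos]; ring_nf
  have h1 : Complex.exp ((Real.pi / n : ℝ) * Complex.I) *
      Complex.exp (-((Real.pi / n : ℝ) * Complex.I)) = 1 := by
    rw [← Complex.exp_add]; simp
  have h2 : Complex.exp s * Complex.exp (-s) = 1 := by rw [← Complex.exp_add]; simp
  have h3 : (2 * Complex.exp s) ≠ 0 := mul_ne_zero two_ne_zero (Complex.exp_ne_zero s)
  rw [unifX, conj_base, base_eq, cay, ← mul_div_mul_left (Complex.cosh s - _) _ h3, Complex.cosh]
  congr 1
  · linear_combination h1 - Complex.exp s * hc - h2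
  · linear_combination h1 + Complex.exp s * hc - h2

lemma unifY_exp (n : ℕ) (s : ℂ) :
    unifY n (Complex.exp s) = cay 0 (s + (Real.pi / n : ℝ) * Complex.I) := by
  set e := (Real.pi / n : ℝ) * Complex.I with he
  have h2 : Complex.exp (s + e) * Complex.exp (-(s + e)) = 1 := by
    rw [← Complex.exp_add]; simp
  have h4 : Complex.exp s = Complex.exp (-e) * Complex.exp (s + e) := by
    rw [← Complex.exp_add]; congr 1; ring
  have h3 : 2 * Complex.exp (s + e) ≠ 0 := mul_ne_zero two_ne_zero (Complex.exp_ne_zero _)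
  have h5 : Complex.exp (-e) ^ 2 ≠ 0 := pow_ne_zero _ (Complex.exp_ne_zero _)
  rw [unifY, base_eq, ← he, cay, ← mul_div_mul_left (Complex.cosh (s + e) - _) _ h3,
    ← mul_div_mul_left (2 * Complex.exp (s + e) * (Complex.cosh (s + e) - _)) _ h5, Complex.cosh, h4, Real.cos_zero]
  push_cast
  congr 1
  · linear_combination - Complex.exp (-e) ^ 2 * h2
  · linear_combination - Complex.exp (-e) ^ 2 * h2

lemma unifMonomial_exp (n i j : ℕ) (s : ℂ) : unifMonomial n i j (Complex.exp s) =
    cay (Real.pi / n) s ^ i * cay 0 (s + (Real.pi / n : ℝ) * Complex.I) ^ j := by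
  rw [unifMonomial, unifX_exp, unifY_exp]

/-- The reflection `z ↦ 1 / conj z` conjugates the monomials; here `z = exp s`. -/
lemma unifMonomial_exp_neg_conj (n i j : ℕ) (s : ℂ) :
    unifMonomial n i j (Complex.exp (-starRingEnd ℂ s)) =
      starRingEnd ℂ (unifMonomial n i j (Complex.exp s)) := by
  rw [unifMonomial_exp, unifMonomial_exp, map_mul, map_pow, map_pow, conj_cay, conj_cay, cay_neg,
    ← cay_neg 0]
  congr 3
  simp only [map_add, map_mul, Complex.conj_ofReal, Complex.conj_I]
  ring

lemma base_ne_zero (n : ℕ) : base n ≠ 0 := neg_ne_zero.2 (Complex.exp_ne_zero _)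

lemma analyticAt_unifMonomial (n i j : ℕ) : AnalyticAt ℂ (unifMonomial n i j) 0 := by
  have h := base_ne_zero n
  have h' : starRingEnd ℂ (base n) ≠ 0 := (map_ne_zero _).2 h
  unfold unifMonomial unifX unifY
  refine AnalyticAt.mul (AnalyticAt.pow (AnalyticAt.div (by fun_prop) (by fun_prop) ?_) _)
    (AnalyticAt.pow (AnalyticAt.div (by fun_prop) (by fun_prop) ?_) _)
  · simpa using h
  · simpa using h

lemma kappa_zero (n i j : ℕ) : kappa n 0 i j = 1 := by
  have h := base_ne_zero n
  simp [kappa, unifX, unifY, h]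

lemma unifMonomial_sub_taylor_isBigO (n i j N : ℕ) :
    (fun z => unifMonomial n i j z - ∑ k ∈ Finset.range N, kappa n k i j * z ^ k)
      =O[nhds 0] fun z => z ^ N := by
  have h := (analyticAt_unifMonomial n i j).hasFPowerSeriesAt.isBigO_sub_partialSum_pow N
  refine (IsBigO.congr (h.trans (isBigO_of_le _ fun z => ?_)) (fun z => ?_) fun z => rfl)
  · simp
  · rw [zero_add, FormalMultilinearSeries.partialSum]
    congr 1
    refine Finset.sum_congr rfl fun k _ => ?_
    rw [FormalMultilinearSeries.ofScalars_apply_eq, smul_eq_mul]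
    rfl

/-- The two halves of a sum over `n` terms, the second one in reversed order. -/
lemma sum_range_half {E : Type*} [AddCommMonoid E] (n : ℕ) (φ : ℕ → E) :
    ∑ k ∈ Finset.range (n / 2), φ k + ∑ l ∈ Finset.range ((n + 1) / 2), φ (n - 1 - l) =
      ∑ t ∈ Finset.range n, φ t := by
  have hn : n = n / 2 + (n + 1) / 2 := by omega
  conv_rhs => rw [hn, Finset.sum_range_add]
  congr 1
  rw [← Finset.sum_range_reflect]
  refine Finset.sum_congr rfl fun l hl => ?_
  rw [Finset.mem_range] at hl
  congr 1
  omega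

/-- The sum of the Taylor polynomial over a rotated set of all roots of unity keeps only the
coefficients of degrees `0` and `n`. -/
lemma sum_taylor_roots (hn : 3 ≤ n) (a : ℕ → ℂ) {ω : ℂ} (hω : IsPrimitiveRoot ω n) (c : ℂ) :
    ∑ t ∈ Finset.range n, ∑ k ∈ Finset.range (n + 1), a k * (c * ω ^ t) ^ k =
      n * a 0 + n * a n * c ^ n := by
  rw [Finset.sum_comm, Finset.sum_range_succ]
  have h0 : (n : ℕ) = (n - 1) + 1 := by omega
  have h1 : ∀ k, ∑ t ∈ Finset.range n, a k * (c * ω ^ t) ^ k =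
      a k * c ^ k * ∑ t ∈ Finset.range n, (ω ^ k) ^ t := by
    intro k
    rw [Finset.mul_sum]
    refine Finset.sum_congr rfl fun t _ => ?_
    rw [mul_pow, ← pow_mul, ← pow_mul, mul_comm t k]
    ring
  rw [Finset.sum_eq_single 0]
  · rw [h1, h1, hω.pow_eq_one]
    simp
    ring
  · intro k hk hk0
    rw [Finset.mem_range] at hk
    have h2 : ω ^ k ≠ 1 := hω.pow_ne_one_of_pos_of_lt hk0 hk
    rw [h1, geom_sum_eq h2, ← pow_mul, mul_comm k n, pow_mul, hω.pow_eq_one, one_pow, sub_self,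
      zero_div, mul_zero]
  · intro h; exact absurd (Finset.mem_range.2 (by omega)) h

/-- The sum of a monomial over a rotated set of roots of unity times `-r` is determined, up to
`o(r ^ n)`, by its Taylor coefficients of degrees `0` and `n`. -/
lemma tendsto_sum_unifMonomial (hn : 3 ≤ n) (i j : ℕ) {ω ζ : ℂ} (hω : IsPrimitiveRoot ω n) :
    Tendsto (fun r : ℝ => (∑ t ∈ Finset.range n, unifMonomial n i j (-r * ζ * ω ^ t) - n) /
      (r : ℂ) ^ n) (nhdsWithin 0 (Set.Ioi 0)) (nhds (n * kappa n n i j * (-1) ^ n * ζ ^ n)) := by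
  set R : ℂ → ℂ := fun z => unifMonomial n i j z -
    ∑ k ∈ Finset.range (n + 1), kappa n k i j * z ^ k with hR
  have hlim : ∀ t : ℕ, Tendsto (fun r : ℝ => R (-r * ζ * ω ^ t) / (r : ℂ) ^ n)
      (nhdsWithin 0 (Set.Ioi 0)) (nhds 0) := by
    intro t
    have h1 : Tendsto (fun r : ℝ => -(r : ℂ) * ζ * ω ^ t) (nhdsWithin 0 (Set.Ioi 0)) (nhds 0) := by
      have : Continuous fun r : ℝ => -(r : ℂ) * ζ * ω ^ t := by fun_prop
      simpa using (this.tendsto 0).mono_left nhdsWithin_le_nhds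
    have h2 := (unifMonomial_sub_taylor_isBigO n i j (n + 1)).comp_tendsto h1
    have h3 : (fun r : ℝ => (-(r : ℂ) * ζ * ω ^ t) ^ (n + 1)) =O[nhdsWithin 0 (Set.Ioi 0)]
        fun r : ℝ => (r : ℂ) ^ (n + 1) := by
      refine IsBigO.of_bound (‖(-ζ * ω ^ t) ^ (n + 1)‖) (Eventually.of_forall fun r => ?_)
      rw [← norm_mul, ← mul_pow]
      exact le_of_eq (by congr 2; ring)
    have h4 : (fun r : ℝ => (r : ℂ) ^ (n + 1)) =o[nhdsWithin 0 (Set.Ioi 0)]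
        fun r : ℝ => (r : ℂ) ^ n := by
      have h5 : (fun z : ℂ => z ^ (n + 1)) =o[nhds 0] fun z : ℂ => z ^ n :=
        isLittleO_pow_pow (by omega)
      refine h5.comp_tendsto ?_
      have : Continuous fun r : ℝ => (r : ℂ) := by fun_prop
      simpa using (this.tendsto 0).mono_left nhdsWithin_le_nhds
    exact ((h2.trans h3).trans_isLittleO h4).tendsto_div_nhds_zero
  have hsum := tendsto_finsetSum (Finset.range n) fun t _ => hlim t
  rw [Finset.sum_const_zero] at hsum
  have := hsum.add_const (n * kappa n n i j * (-1) ^ n * ζ ^ n)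
  rw [zero_add] at this
  refine this.congr' ?_
  filter_upwards [self_mem_nhdsWithin] with r hr
  have hr0 : (r : ℂ) ^ n ≠ 0 := pow_ne_zero _ (by exact_mod_cast (Set.mem_Ioi.1 hr).ne')
  rw [← Finset.sum_div]
  simp only [hR, Finset.sum_sub_distrib]
  rw [sum_taylor_roots hn _ hω, kappa_zero, eq_div_iff hr0, add_mul, div_mul_cancel₀ _ hr0]
  rw [mul_pow, neg_pow (r : ℂ)]
  ring

lemma exp_log_add {r : ℝ} (hr : 0 < r) (s : ℂ) :
    Complex.exp (Real.log r + s) = r * Complex.exp s := by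
  rw [Complex.exp_add, ← Complex.ofReal_exp, Real.exp_log hr]

lemma two_pi_eq (hn : 3 ≤ n) : 2 * (n : ℂ) * (Real.pi / n : ℝ) = 2 * Real.pi := by
  have : (n : ℂ) ≠ 0 := by exact_mod_cast (by omega : n ≠ 0)
  push_cast; field_simp

/-- The half orbits at `z = -r` and at `z = -1 / r` make up a full set of `n`-th roots of unity around
`0`, and its reflection in the unit circle. -/
lemma foldSum_eq (hn : 3 ≤ n) (i j : ℕ) {r : ℝ} (hr : 0 < r) :
    foldSum n (Real.pi / n) 0 i j r =
      ∑ t ∈ Finset.range n, unifMonomial n i j (-r * Complex.exp (-(2 * Real.pi * Complex.I / n)) *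
        Complex.exp (-(2 * Real.pi * Complex.I / n)) ^ t) -
      starRingEnd ℂ (∑ t ∈ Finset.range n, unifMonomial n i j
        (-r * Complex.exp (-(2 * Real.pi * Complex.I / n)) *
        Complex.exp (-(2 * Real.pi * Complex.I / n)) ^ t)) := by
  set φ : ℕ → ℂ := fun t => unifMonomial n i j (Complex.exp (Real.log r +
    (Real.pi * Complex.I - 2 * (t + 1) * ((Real.pi / n : ℝ) * Complex.I)))) with hφ
  have h1 : ∀ t, unifMonomial n i j (-r * Complex.exp (-(2 * Real.pi * Complex.I / n)) *
      Complex.exp (-(2 * Real.pi * Complex.I / n)) ^ t) = φ t := by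
    intro t
    simp only [hφ]
    rw [exp_log_add hr, ← Complex.exp_nat_mul, mul_assoc, ← Complex.exp_add, Complex.exp_sub,
      Complex.exp_pi_mul_I, neg_div, one_div, ← Complex.exp_neg, neg_mul, mul_neg]
    congr 4
    push_cast; ring_nf
  simp only [h1]
  rw [← sum_range_half]
  have h2 := two_pi_eq hn
  have e1 : ∀ k : ℕ, rot n (Real.pi / n) (2 * k + 2) (Real.log r + Real.pi * Complex.I) ^ i *
      rot n 0 (2 * k + 1) (Real.log r + Real.pi * Complex.I) ^ j = φ k := by
    intro k
    simp only [hφ, rot, unifMonomial_exp]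
    congr 3 <;> push_cast <;> ring
  have e2 : ∀ k : ℕ, rot n (Real.pi / n) (2 * k + 2) ((-Real.log r : ℝ) + Real.pi * Complex.I) ^ i *
      rot n 0 (2 * k + 1) ((-Real.log r : ℝ) + Real.pi * Complex.I) ^ j =
      starRingEnd ℂ (φ k) := by
    intro k
    simp only [hφ]
    rw [← unifMonomial_exp_neg_conj, unifMonomial_exp, rot, rot]
    simp only [map_add, map_sub, map_mul, Complex.conj_ofReal, Complex.conj_I, map_one, map_ofNat,
      map_natCast]
    congr 3 <;> push_cast <;> ring
  have e3 : ∀ l ∈ Finset.range ((n + 1) / 2),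
      rot n (Real.pi / n) (2 * l) (Real.log r + Real.pi * Complex.I) ^ i *
      rot n 0 (2 * l + 1) (Real.log r + Real.pi * Complex.I) ^ j =
      starRingEnd ℂ (φ (n - 1 - l)) := by
    intro l hl
    rw [Finset.mem_range] at hl
    simp only [hφ]
    rw [← unifMonomial_exp_neg_conj, unifMonomial_exp, rot, rot, ← cay_neg, ← cay_neg 0]
    rw [show n - 1 - l = n - (1 + l) by omega, Nat.cast_sub (by omega)]
    simp only [map_add, map_sub, map_mul, Complex.conj_ofReal, Complex.conj_I, map_one, map_ofNat,
      map_natCast, Nat.cast_add, Nat.cast_one]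
    congr 3 <;> push_cast at h2 ⊢ <;> linear_combination Complex.I * h2
  have e4 : ∀ l ∈ Finset.range ((n + 1) / 2),
      rot n (Real.pi / n) (2 * l) ((-Real.log r : ℝ) + Real.pi * Complex.I) ^ i *
      rot n 0 (2 * l + 1) ((-Real.log r : ℝ) + Real.pi * Complex.I) ^ j = φ (n - 1 - l) := by
    intro l hl
    rw [Finset.mem_range] at hl
    simp only [hφ]
    rw [unifMonomial_exp, rot, rot, ← cay_neg, ← cay_neg 0]
    rw [show n - 1 - l = n - (1 + l) by omega, Nat.cast_sub (by omega)]
    congr 3 <;> push_cast at h2 ⊢ <;> linear_combination (Complex.I) * h2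
  rw [foldSum, orbitSum, orbitSum, Finset.sum_congr rfl fun k _ => e1 k,
    Finset.sum_congr rfl fun k _ => e2 k, Finset.sum_congr rfl e3, Finset.sum_congr rfl e4,
    map_add, map_sum, map_sum]
  ring

/-- The analogue of `foldSum_eq` with the coordinates exchanged: the roots of unity are rotated by
`exp (i π / n)`, an `n`-th root of `-1`, and the signs are reversed. -/
lemma foldSum_eq' (hn : 3 ≤ n) (i j : ℕ) {r : ℝ} (hr : 0 < r) :
    foldSum n 0 (Real.pi / n) j i r =
      starRingEnd ℂ (∑ t ∈ Finset.range n, unifMonomial n i j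
        (-r * Complex.exp (Real.pi * Complex.I / n) *
        Complex.exp (2 * Real.pi * Complex.I / n) ^ t)) -
      ∑ t ∈ Finset.range n, unifMonomial n i j (-r * Complex.exp (Real.pi * Complex.I / n) *
        Complex.exp (2 * Real.pi * Complex.I / n) ^ t) := by
  set φ : ℕ → ℂ := fun t => unifMonomial n i j (Complex.exp (Real.log r +
    ((2 * t + 1) * ((Real.pi / n : ℝ) * Complex.I) - Real.pi * Complex.I))) with hφ
  have h1 : ∀ t, unifMonomial n i j (-r * Complex.exp (Real.pi * Complex.I / n) *
      Complex.exp (2 * Real.pi * Complex.I / n) ^ t) = φ t := by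
    intro t
    simp only [hφ]
    rw [exp_log_add hr, ← Complex.exp_nat_mul, mul_assoc, ← Complex.exp_add, Complex.exp_sub,
      Complex.exp_pi_mul_I, div_neg, div_one, neg_mul, mul_neg]
    congr 4
    push_cast; ring
  simp only [h1]
  rw [← sum_range_half]
  have h2 := two_pi_eq hn
  have e1 : ∀ k : ℕ, rot n 0 (2 * k + 2) (Real.log r + Real.pi * Complex.I) ^ j *
      rot n (Real.pi / n) (2 * k + 1) (Real.log r + Real.pi * Complex.I) ^ i =
      starRingEnd ℂ (φ k) := by
    intro k
    simp only [hφ]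
    rw [← unifMonomial_exp_neg_conj, unifMonomial_exp, rot, rot, mul_comm, ← cay_neg,
      ← cay_neg 0]
    simp only [map_add, map_sub, map_mul, Complex.conj_ofReal, Complex.conj_I, map_one, map_ofNat,
      map_natCast]
    congr 3 <;> push_cast <;> ring
  have e2 : ∀ k : ℕ, rot n 0 (2 * k + 2) ((-Real.log r : ℝ) + Real.pi * Complex.I) ^ j *
      rot n (Real.pi / n) (2 * k + 1) ((-Real.log r : ℝ) + Real.pi * Complex.I) ^ i = φ k := by
    intro k
    simp only [hφ, rot, unifMonomial_exp]
    rw [mul_comm, ← cay_neg, ← cay_neg 0]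
    congr 3 <;> push_cast <;> ring
  have e3 : ∀ l ∈ Finset.range ((n + 1) / 2),
      rot n 0 (2 * l) (Real.log r + Real.pi * Complex.I) ^ j *
      rot n (Real.pi / n) (2 * l + 1) (Real.log r + Real.pi * Complex.I) ^ i =
      φ (n - 1 - l) := by
    intro l hl
    rw [Finset.mem_range] at hl
    simp only [hφ]
    rw [unifMonomial_exp, rot, rot, mul_comm]
    rw [show n - 1 - l = n - (1 + l) by omega, Nat.cast_sub (by omega)]
    congr 3 <;> push_cast at h2 ⊢ <;> linear_combination (-Complex.I) * h2
  have e4 : ∀ l ∈ Finset.range ((n + 1) / 2),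
      rot n 0 (2 * l) ((-Real.log r : ℝ) + Real.pi * Complex.I) ^ j *
      rot n (Real.pi / n) (2 * l + 1) ((-Real.log r : ℝ) + Real.pi * Complex.I) ^ i =
      starRingEnd ℂ (φ (n - 1 - l)) := by
    intro l hl
    rw [Finset.mem_range] at hl
    simp only [hφ]
    rw [← unifMonomial_exp_neg_conj, unifMonomial_exp, rot, rot, mul_comm]
    rw [show n - 1 - l = n - (1 + l) by omega, Nat.cast_sub (by omega)]
    simp only [map_add, map_sub, map_mul, Complex.conj_ofReal, Complex.conj_I, map_one, map_ofNat,
      map_natCast, Nat.cast_add, Nat.cast_one]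
    congr 3 <;> push_cast at h2 ⊢ <;> linear_combination (-Complex.I) * h2
  rw [foldSum, orbitSum, orbitSum, Finset.sum_congr rfl fun k _ => e1 k,
    Finset.sum_congr rfl fun k _ => e2 k, Finset.sum_congr rfl e3, Finset.sum_congr rfl e4,
    map_add, map_sum, map_sum]
  ring

lemma coe_harm_eq (n i j : ℕ) : (n : ℂ) * (kappa n n i j - starRingEnd ℂ (kappa n n i j)) * (-1) ^ n =
    Complex.I * harm n i j := by
  have h : ((-1 : ℂ) ^ n) * (-1) ^ n = 1 := by rw [← mul_pow]; simp
  have h0 : (-1 : ℂ) ^ n ≠ 0 := pow_ne_zero _ (by norm_num)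
  rw [coe_harm]
  have := Complex.I_ne_zero
  field_simp
  linear_combination n * (kappa n n i j - starRingEnd ℂ (kappa n n i j)) * h

/-- A real constant `c` does not contribute to `f - conj f`. -/
lemma tendsto_sub_conj_div {f : ℝ → ℂ} {l : Filter ℝ} {c L : ℂ} (hc : starRingEnd ℂ c = c)
    (h : Tendsto (fun r : ℝ => (f r - c) / (r : ℂ) ^ n) l (nhds L)) :
    Tendsto (fun r : ℝ => (f r - starRingEnd ℂ (f r)) / (r : ℂ) ^ n) l
      (nhds (L - starRingEnd ℂ L)) := by
  refine (h.sub ((Complex.continuous_conj.tendsto L).comp h)).congr fun r => ?_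
  simp only [Function.comp, map_div₀, map_sub, map_pow, Complex.conj_ofReal, hc]
  ring

lemma tendsto_foldSum (hn : 3 ≤ n) (i j : ℕ) :
    Tendsto (fun r : ℝ => foldSum n (Real.pi / n) 0 i j r / (r : ℂ) ^ n)
      (nhdsWithin 0 (Set.Ioi 0)) (nhds (Complex.I * harm n i j)) := by
  have hn0 : n ≠ 0 := by omega
  have hω : IsPrimitiveRoot (Complex.exp (-(2 * Real.pi * Complex.I / n))) n := by
    rw [Complex.exp_neg]; exact (Complex.isPrimitiveRoot_exp n hn0).inv
  have h := tendsto_sub_conj_div (by simp) (tendsto_sum_unifMonomial hn i j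
    (ζ := Complex.exp (-(2 * Real.pi * Complex.I / n))) hω)
  rw [hω.pow_eq_one] at h
  have e : n * kappa n n i j * (-1) ^ n * 1 - starRingEnd ℂ (n * kappa n n i j * (-1) ^ n * 1) =
      Complex.I * harm n i j := by
    rw [← coe_harm_eq]; simp; ring
  rw [e] at h
  refine h.congr' ?_
  filter_upwards [self_mem_nhdsWithin] with r hr
  rw [foldSum_eq hn i j hr]

lemma tendsto_foldSum' (hn : 3 ≤ n) (i j : ℕ) :
    Tendsto (fun r : ℝ => foldSum n 0 (Real.pi / n) j i r / (r : ℂ) ^ n)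
      (nhdsWithin 0 (Set.Ioi 0)) (nhds (Complex.I * harm n i j)) := by
  have hn0 : n ≠ 0 := by omega
  have hn1 : (n : ℂ) ≠ 0 := by exact_mod_cast hn0
  have hζ : Complex.exp (Real.pi * Complex.I / n) ^ n = -1 := by
    rw [← Complex.exp_nat_mul, mul_div_cancel₀ _ hn1, Complex.exp_pi_mul_I]
  have h := (tendsto_sub_conj_div (by simp) (tendsto_sum_unifMonomial hn i j
    (ζ := Complex.exp (Real.pi * Complex.I / n)) (Complex.isPrimitiveRoot_exp n hn0))).neg
  rw [hζ] at h
  have e : -(n * kappa n n i j * (-1) ^ n * (-1) -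
      starRingEnd ℂ (n * kappa n n i j * (-1) ^ n * (-1))) = Complex.I * harm n i j := by
    rw [← coe_harm_eq]; simp; ring
  rw [e] at h
  refine h.congr' ?_
  filter_upwards [self_mem_nhdsWithin] with r hr
  rw [foldSum_eq' hn i j hr]
  ring

lemma tendsto_re_mul_I {m : ℕ → ℂ} {h C : ℝ}
    (hm : Tendsto m atTop (nhds (Complex.I * h * C / (2 * Real.pi * Complex.I)))) :
    Tendsto (fun k => (m k).re) atTop (nhds (1 / (2 * Real.pi) * C * h)) := by
  have h1 := (Complex.continuous_re.tendsto _).comp hm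
  have e : Complex.I * h * C / (2 * Real.pi * Complex.I) = ((1 / (2 * Real.pi) * C * h : ℝ) : ℂ) := by
    have := Complex.I_ne_zero
    have : (Real.pi : ℂ) ≠ 0 := by exact_mod_cast Real.pi_ne_zero
    push_cast
    field_simp
  rw [e, Complex.ofReal_re] at h1
  exact h1

lemma tendsto_solX (hn : 3 ≤ n) (i j : ℕ) :
    Tendsto (fun m : ℕ => ((m + 1 : ℕ) : ℝ) ^ (n + 1) * solX n m (i, j)) atTop
      (nhds (1 / (2 * Real.pi) * (n.factorial / (4 * Real.cos (Real.pi / n)) ^ n) *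
        harm n i j)) := by
  have h := tendsto_exitInt hn (pi_div_pos hn).le le_rfl le_rfl (pi_div_pos hn).le i j
    (tendsto_foldSum hn i j)
  refine (tendsto_re_mul_I h).congr fun m => ?_
  rw [solX, ← Complex.re_ofReal_mul]
  push_cast
  rfl

lemma tendsto_solY (hn : 3 ≤ n) (i j : ℕ) :
    Tendsto (fun m : ℕ => ((m + 1 : ℕ) : ℝ) ^ (n + 1) * solY n m (i, j)) atTop
      (nhds (1 / (2 * Real.pi) * (n.factorial / 4 ^ n) * harm n i j)) := by
  have h := tendsto_exitInt hn le_rfl (pi_div_pos hn).le (pi_div_pos hn).le le_rfl j i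
    (tendsto_foldSum' hn i j)
  rw [Real.cos_zero, mul_one] at h
  refine (tendsto_re_mul_I h).congr fun m => ?_
  rw [solY, ← Complex.re_ofReal_mul]
  push_cast
  rfl

end

/-! ### Positivity of the limit -/

section

variable {n : ℕ}

lemma limit_const_pos (hn : 3 ≤ n) :
    0 < 1 / (2 * Real.pi) * (n.factorial / (4 * Real.cos (Real.pi / n)) ^ n) := by
  have h1 := cos_pi_div_pos hn
  have h2 := Real.pi_pos
  have h3 : (0 : ℝ) < n.factorial := by exact_mod_cast n.factorial_pos
  positivity

lemma harm_nonneg (hn : 3 ≤ n) (i j : ℕ) : 0 ≤ harm n i j := by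
  refine nonneg_of_mul_nonneg_right (ge_of_tendsto' (tendsto_solX hn i j) fun m => ?_)
    (limit_const_pos hn)
  exact mul_nonneg (by positivity) (solX_nonneg hn m _)

/-- The limit of the harmonic functions `solX n m` is harmonic. -/
lemma harm_harmonic (hn : 3 ≤ n) (i j : ℕ) :
    Real.sin (Real.pi / n) ^ 2 / 2 * (harm n (i + 2) (j + 1) + harm n i (j + 1)) +
      Real.cos (Real.pi / n) ^ 2 / 2 * (harm n (i + 2) j + harm n i (j + 2)) =
      harm n (i + 1) (j + 1) := by
  have h := fun i j => tendsto_solX hn i j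
  have h1 := (((h (i + 2) (j + 1)).add (h i (j + 1))).const_mul
    (Real.sin (Real.pi / n) ^ 2 / 2)).add
    (((h (i + 2) j).add (h i (j + 2))).const_mul (Real.cos (Real.pi / n) ^ 2 / 2))
  have h2 := tendsto_nhds_unique (h1.congr fun m => ?_) (h (i + 1) (j + 1))
  · refine mul_left_cancel₀ (limit_const_pos hn).ne' ?_
    rw [← h2]
    ring
  · have h3 := congrFun (step_solX hn m) (i + 1, j + 1)
    unfold step at h3
    rw [if_pos ⟨Nat.succ_pos i, Nat.succ_pos j⟩] at h3
    simp only [Nat.add_sub_cancel] at h3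
    rw [← h3]
    ring

/-- By the minimum principle, the nonnegative harmonic function `harm` vanishes at all interior
points if it vanishes at one of them. -/
lemma harm_eq_zero_of_exists (hn : 3 ≤ n) {i₀ j₀ : ℕ} (h₀ : harm n (i₀ + 1) (j₀ + 1) = 0)
    (i j : ℕ) : harm n (i + 1) (j + 1) = 0 := by
  have hs : 0 < Real.sin (Real.pi / n) ^ 2 / 2 := by
    have := sin_pi_div_pos hn; positivity
  have hc : 0 < Real.cos (Real.pi / n) ^ 2 / 2 := by
    have := cos_pi_div_pos hn; positivity
  have key : ∀ i j, harm n (i + 1) (j + 1) = 0 → harm n (i + 2) (j + 1) = 0 ∧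
      harm n i (j + 1) = 0 ∧ harm n (i + 2) j = 0 ∧ harm n i (j + 2) = 0 := by
    intro i j h
    have e := harm_harmonic hn i j
    rw [h] at e
    have p1 := harm_nonneg hn (i + 2) (j + 1)
    have p2 := harm_nonneg hn i (j + 1)
    have p3 := harm_nonneg hn (i + 2) j
    have p4 := harm_nonneg hn i (j + 2)
    have q1 := mul_nonneg hs.le (add_nonneg p1 p2)
    have q2 := mul_nonneg hc.le (add_nonneg p3 p4)
    have r1 := (mul_eq_zero.1 (by linarith :
      Real.sin (Real.pi / n) ^ 2 / 2 * (harm n (i + 2) (j + 1) + harm n i (j + 1)) = 0)).resolve_left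
      hs.ne'
    have r2 := (mul_eq_zero.1 (by linarith :
      Real.cos (Real.pi / n) ^ 2 / 2 * (harm n (i + 2) j + harm n i (j + 2)) = 0)).resolve_left
      hc.ne'
    refine ⟨?_, ?_, ?_, ?_⟩ <;> linarith
  have row : ∀ i j, harm n (i + 1) (j + 1) = 0 → ∀ i', harm n (i' + 1) (j + 1) = 0 := by
    intro i j h
    have h1 : harm n (0 + 1) (j + 1) = 0 := by
      induction i with
      | zero => exact h
      | succ i ih => exact ih (key _ _ h).2.1
    intro i'
    induction i' with
    | zero => exact h1
    | succ i' ih => exact (key _ _ ih).1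
  have h1 : harm n (0 + 1) (0 + 1) = 0 := by
    induction j₀ generalizing i₀ with
    | zero => exact row _ _ h₀ 0
    | succ j₀ ih => exact ih (key _ _ h₀).2.2.1
  have h2 : harm n (0 + 1) (j + 1) = 0 := by
    induction j with
    | zero => exact h1
    | succ j ih => exact (key _ _ (row _ _ ih 1)).2.2.2
  exact row _ _ h2 i

/-- The sum of `H` over the `n`-th roots of unity times `-r`, which isolates the coefficient of `z ^ n`
in the Taylor expansion of `H`. -/
def rootSum (n : ℕ) (H : ℂ → ℂ) (r : ℝ) : ℂ :=
  ∑ t ∈ Finset.range n, H (-r * Complex.exp (2 * Real.pi * Complex.I / n) ^ t)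

lemma tendsto_im_rootSum (hn : 3 ≤ n) (i j : ℕ) :
    Tendsto (fun r : ℝ => (rootSum n (unifMonomial n i j) r).im / r ^ n)
      (nhdsWithin 0 (Set.Ioi 0)) (nhds (harm n i j / 2)) := by
  have h := (Complex.continuous_im.tendsto _).comp (tendsto_sum_unifMonomial hn i j (ζ := 1)
    (Complex.isPrimitiveRoot_exp n (by omega)))
  have e : (n * kappa n n i j * (-1) ^ n * 1 ^ n).im = harm n i j / 2 := by
    have h1 := Complex.sub_conj (n * kappa n n i j * (-1) ^ n * 1 ^ n)
    have h2 := coe_harm_eq n i j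
    simp only [map_mul, map_pow, map_neg, map_one, map_natCast, one_pow, mul_one] at h1 ⊢
    rw [← sub_mul, ← mul_sub, h2, mul_comm Complex.I] at h1
    have h3 := mul_right_cancel₀ Complex.I_ne_zero h1
    have h4 : harm n i j = 2 * (n * kappa n n i j * (-1) ^ n).im := by exact_mod_cast h3
    rw [h4]; ring
  rw [e] at h
  refine h.congr fun r => ?_
  simp only [Function.comp, mul_one, rootSum]
  rw [← Complex.ofReal_pow, Complex.div_ofReal_im, Complex.sub_im, Complex.natCast_im, sub_zero]

/-- The leading Taylor coefficient of `(x - 1) ^ (n - 1) (y - 1) x y` is `x'(0) ^ (n - 1) y'(0)`, where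
`x'(0) = -4 cos (π / n)` and `y'(0) = -4 exp (i π / n)`. -/
lemma tendsto_rootSum_pow (hn : 3 ≤ n) :
    Tendsto (fun r : ℝ => (rootSum n (fun z => (unifX n z - 1) ^ (n - 1) * (unifY n z - 1) *
        unifMonomial n 1 1 z) r).im / r ^ n)
      (nhdsWithin 0 (Set.Ioi 0)) (nhds (n * (-1) ^ n * (-4 * Real.cos (Real.pi / n)) ^ (n - 1) *
        (-4 * Real.sin (Real.pi / n)))) := by
  have hb := base_ne_zero n
  have hb' : starRingEnd ℂ (base n) ≠ 0 := (map_ne_zero _).2 hb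
  set b := base n with hbdef
  set b' := starRingEnd ℂ b with hbdef'
  have hmul : b * b' = 1 := by
    rw [hbdef', hbdef, conj_base, base_eq, neg_mul_neg, ← Complex.exp_add]; simp
  have hadd : b + b' = (-2 * Real.cos (Real.pi / n) : ℝ) := by
    have : Complex.exp ((Real.pi / n : ℝ) * Complex.I) +
        Complex.exp (-((Real.pi / n : ℝ) * Complex.I)) = 2 * (Real.cos (Real.pi / n) : ℝ) := by
      rw [Complex.ofReal_cos, Complex.cos]; ring_nf
    rw [hbdef', hbdef, conj_base, base_eq]
    push_cast at this ⊢
    linear_combination -this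
  have him : b'.im = -Real.sin (Real.pi / n) := by
    rw [hbdef', hbdef, conj_base, Complex.neg_im, Complex.exp_ofReal_mul_I_im]
  -- Near `0`, the quotient by `z ^ n` extends continuously.
  set Q : ℂ → ℂ := fun z => (2 * (b + b') / ((z - b) * (z - b'))) ^ (n - 1) *
    (4 * b / (z - b) ^ 2) * unifMonomial n 1 1 z with hQ
  have hQc : Tendsto Q (nhds 0) (nhds (Q 0)) := by
    have h1 : ContinuousAt (fun z => 2 * (b + b') / ((z - b) * (z - b'))) 0 :=
      ContinuousAt.div (by fun_prop) (by fun_prop) (by simpa using ⟨hb, hb'⟩)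
    have h2 : ContinuousAt (fun z => 4 * b / (z - b) ^ 2) 0 :=
      ContinuousAt.div (by fun_prop) (by fun_prop) (by simpa using hb)
    exact ((h1.pow _).mul h2).mul (analyticAt_unifMonomial n 1 1).continuousAt
  have hQ0 : Q 0 = ((-4 * Real.cos (Real.pi / n)) ^ (n - 1) : ℝ) * (4 * b') := by
    have e1 : 2 * (b + b') / ((0 - b) * (0 - b')) = (-4 * Real.cos (Real.pi / n) : ℝ) := by
      rw [zero_sub, zero_sub, neg_mul_neg, hmul, hadd]; push_cast; ring
    have e2 : 4 * b / (0 - b) ^ 2 = 4 * b' := by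
      rw [div_eq_iff (by simpa using hb)]
      linear_combination (-4 * b) * hmul
    have e3 : unifMonomial n 1 1 0 = 1 := by
      simp [unifMonomial, unifX, unifY, ← hbdef, ← hbdef', hb, hb']
    simp only [hQ]
    rw [e1, e2, e3, Complex.ofReal_pow, mul_one]
  have hev : ∀ᶠ z in nhds (0 : ℂ), (unifX n z - 1) ^ (n - 1) * (unifY n z - 1) *
      unifMonomial n 1 1 z = z ^ n * Q z := by
    have h1 : ∀ᶠ z in nhds (0 : ℂ), z - b ≠ 0 :=
      ContinuousAt.eventually_ne (by fun_prop) (by simpa using hb)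
    have h2 : ∀ᶠ z in nhds (0 : ℂ), z - b' ≠ 0 :=
      ContinuousAt.eventually_ne (by fun_prop) (by simpa using hb')
    filter_upwards [h1, h2] with z hz1 hz2
    have e1 : unifX n z - 1 = z * (2 * (b + b') / ((z - b) * (z - b'))) := by
      rw [unifX, ← hbdef, ← hbdef']
      field_simp
      ring
    have e2 : unifY n z - 1 = z * (4 * b / (z - b) ^ 2) := by
      rw [unifY, ← hbdef]
      field_simp
      ring
    have e3 : z ^ n = z ^ (n - 1) * z := by
      rw [← pow_succ]; congr 1; omega
    simp only [hQ]
    rw [e1, e2, e3, mul_pow]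
    ring
  have hlim : ∀ t : ℕ, Tendsto (fun r : ℝ =>
      -(r : ℂ) * Complex.exp (2 * Real.pi * Complex.I / n) ^ t)
      (nhdsWithin 0 (Set.Ioi 0)) (nhds 0) := by
    intro t
    have : Continuous fun r : ℝ => -(r : ℂ) * Complex.exp (2 * Real.pi * Complex.I / n) ^ t := by
      fun_prop
    simpa using (this.tendsto 0).mono_left nhdsWithin_le_nhds
  have hsum := tendsto_finsetSum (Finset.range n) fun t _ =>
    ((hQc.comp (hlim t)).const_mul ((-1) ^ n))
  have him2 := (Complex.continuous_im.tendsto _).comp hsum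
  have e : (∑ t ∈ Finset.range n, (-1) ^ n * Q 0).im = n * (-1) ^ n *
      (-4 * Real.cos (Real.pi / n)) ^ (n - 1) * (-4 * Real.sin (Real.pi / n)) := by
    rw [Finset.sum_const, Finset.card_range, nsmul_eq_mul, hQ0]
    have : (n : ℂ) * ((-1) ^ n * ((((-4 * Real.cos (Real.pi / n)) ^ (n - 1) : ℝ) : ℂ) * (4 * b'))) =
        ((n * (-1) ^ n * (-4 * Real.cos (Real.pi / n)) ^ (n - 1) * 4 : ℝ) : ℂ) * b' := by
      push_cast; ring
    rw [this, Complex.im_ofReal_mul, him]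
    ring
  rw [e] at him2
  refine him2.congr' ?_
  have hev' : ∀ᶠ r : ℝ in nhdsWithin 0 (Set.Ioi 0), ∀ t ∈ Finset.range n, _ :=
    (Finset.eventually_all (Finset.range n)).2 fun t _ => (hlim t).eventually hev
  filter_upwards [hev', self_mem_nhdsWithin] with r h1 hr
  have hr0 : (r : ℂ) ^ n ≠ 0 := pow_ne_zero _ (by exact_mod_cast (Set.mem_Ioi.1 hr).ne')
  have hω := (Complex.isPrimitiveRoot_exp n (by omega)).pow_eq_one
  simp only [Function.comp]
  rw [← Complex.div_ofReal_im, rootSum, Finset.sum_congr rfl h1, Finset.sum_div]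
  congr 1
  refine Finset.sum_congr rfl fun t _ => ?_
  rw [mul_pow, ← pow_mul, mul_comm t n, pow_mul, hω, one_pow, neg_pow (r : ℂ), Complex.ofReal_pow]
  field_simp

/-- The function `harm` is positive in the interior: otherwise it would vanish there identically, and
the leading coefficient of `(x - 1) ^ (n - 1) (y - 1) x y` would be real. -/
lemma harm_pos (hn : 3 ≤ n) {i j : ℕ} (hi : 1 ≤ i) (hj : 1 ≤ j) : 0 < harm n i j := by
  obtain ⟨i, rfl⟩ := Nat.exists_eq_add_of_le' hi
  obtain ⟨j, rfl⟩ := Nat.exists_eq_add_of_le' hj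
  refine lt_of_le_of_ne (harm_nonneg hn _ _) fun h0 => ?_
  have hz := harm_eq_zero_of_exists hn h0.symm
  -- Otherwise all differences of the monomials `x ^ i y ^ j` have a real coefficient of degree `n`.
  have hdiff : ∀ p i j, Tendsto (fun r : ℝ => (rootSum n (fun z => (unifX n z - 1) ^ p *
      unifMonomial n (i + 1) (j + 1) z) r).im / r ^ n) (nhdsWithin 0 (Set.Ioi 0)) (nhds 0) := by
    intro p
    induction p with
    | zero =>
      intro i j
      have := tendsto_im_rootSum hn (i + 1) (j + 1)
      rw [hz, zero_div] at this
      simpa using this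
    | succ p ih =>
      intro i j
      have := (ih (i + 1) j).sub (ih i j)
      rw [sub_zero] at this
      refine this.congr fun r => ?_
      rw [← sub_div, ← Complex.sub_im, rootSum, rootSum, rootSum, ← Finset.sum_sub_distrib]
      congr 2
      refine Finset.sum_congr rfl fun t _ => ?_
      simp only [unifMonomial]
      ring
  have h1 := (hdiff (n - 1) 0 1).sub (hdiff (n - 1) 0 0)
  rw [sub_zero] at h1
  have h2 := tendsto_nhds_unique (h1.congr fun r => ?_) (tendsto_rootSum_pow hn)
  · have hc := cos_pi_div_pos hn
    have hs := sin_pi_div_pos hn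
    have hn0 : (n : ℝ) ≠ 0 := by exact_mod_cast (by omega : n ≠ 0)
    refine absurd h2.symm (mul_ne_zero (mul_ne_zero (mul_ne_zero hn0 ?_) ?_) ?_)
    · exact pow_ne_zero _ (by norm_num)
    · exact pow_ne_zero _ (by linarith)
    · linarith
  · rw [← sub_div, ← Complex.sub_im, rootSum, rootSum, rootSum, ← Finset.sum_sub_distrib]
    congr 2
    refine Finset.sum_congr rfl fun t _ => ?_
    simp only [unifMonomial]
    ring

lemma isEquivalent_of_tendsto_succ {u : ℕ → ℝ} {N : ℕ} {K : ℝ} (hK : K ≠ 0)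
    (h : Tendsto (fun m : ℕ => ((m + 1 : ℕ) : ℝ) ^ N * u (m + 1)) atTop (nhds K)) :
    u ~[atTop] fun i : ℕ => K * (1 / (i : ℝ) ^ N) := by
  have h1 : Tendsto (fun i : ℕ => (i : ℝ) ^ N * u i) atTop (nhds K) :=
    (tendsto_add_atTop_iff_nat (f := fun i : ℕ => (i : ℝ) ^ N * u i) 1).1 h
  have hne : ∀ᶠ i : ℕ in atTop, (i : ℝ) ≠ 0 := by
    filter_upwards [eventually_gt_atTop 0] with i hi
    exact_mod_cast hi.ne'
  refine (isEquivalent_iff_tendsto_one ?_).2 ?_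
  · filter_upwards [hne] with i hi
    exact mul_ne_zero hK (one_div_ne_zero (pow_ne_zero _ hi))
  · have h2 := h1.div_const K
    rw [div_self hK] at h2
    refine h2.congr' ?_
    filter_upwards [hne] with i hi
    simp only [Pi.div_apply]
    field_simp

end

end WeylWalk

end

theorem mainTheorem3 (n : ℕ) (hn : 3 ≤ n) (i₀ j₀ : ℕ) (hi₀ : 1 ≤ i₀) (hj₀ : 1 ≤ j₀)
    {Ω : Type*} [MeasurableSpace Ω] (P : Measure Ω) [IsProbabilityMeasure P]
    (Z : ℕ → Ω → ℕ × ℕ) (hZ : WeylWalk.IsKilledWalk n (i₀, j₀) Z P) :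
    (fun i : ℕ => P.real (WeylWalk.killedAt Z (i, 0))) ~[atTop]
      (fun i : ℕ => 1 / (2 * Real.pi) * ((n.factorial : ℝ) / (4 * Real.cos (Real.pi / n)) ^ n) *
        WeylWalk.harm n i₀ j₀ * (1 / (i : ℝ) ^ (n + 1))) ∧
    (fun j : ℕ => P.real (WeylWalk.killedAt Z (0, j))) ~[atTop]
      (fun j : ℕ => 1 / (2 * Real.pi) * ((n.factorial : ℝ) / 4 ^ n) *
        WeylWalk.harm n i₀ j₀ * (1 / (j : ℝ) ^ (n + 1))) := by
  have hpos := WeylWalk.harm_pos hn hi₀ hj₀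
  have hfac : (0 : ℝ) < n.factorial := by exact_mod_cast n.factorial_pos
  have hpi := Real.pi_pos
  constructor
  · refine WeylWalk.isEquivalent_of_tendsto_succ
      (mul_pos (WeylWalk.limit_const_pos hn) hpos).ne'
      ((WeylWalk.tendsto_solX hn i₀ j₀).congr fun m => ?_)
    obtain ⟨C, hC⟩ := WeylWalk.exists_abs_solX_le hn m
    rw [hZ.real_killedAt hn (Or.inr rfl) hC (WeylWalk.step_solX hn m)
      (WeylWalk.solX_boundary hn m)]
  · refine WeylWalk.isEquivalent_of_tendsto_succ (by positivity)
      ((WeylWalk.tendsto_solY hn i₀ j₀).congr fun m => ?_)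
    obtain ⟨C, hC⟩ := WeylWalk.exists_abs_solY_le hn m
    rw [hZ.real_killedAt hn (Or.inl rfl) hC (WeylWalk.step_solY hn m)
      (WeylWalk.solY_boundary hn m)]
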